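/- Let $G$ be a compact connected Lie group which is a product of a simply connected group and a torus, with Lie algebra $\mathfrak g$, and fix an invariant inner product on $\mathfrak g$ (used to identify $\mathfrak g\cong\mathfrak g^*$), a maximal torus $T\subset G$ with Lie algebra $\mathfrak t$ and weight lattice $\Lambda^*$, and a Weyl chamber, with positive roots $\mathfrak R_+$, dominant weights $\Lambda^*_+$ and half-sum of positive roots $\rho$. Roots and weights are normalized by $(\exp\xi)^\lambda=e^{2\pi i\langle\lambda,\xi\rangle}$. For $\alpha\in\mathfrak R_+$ let $e_\alpha\in\mathfrak g_{\mathbb C}$ be a root vector with $e_\alpha\cdot e_{-\alpha}=1$, where $e_{-\alpha}=\overline{e_\alpha}$, and let $$r=\sum_{a,b} r_{ab}\,e_a\otimes e_b=\tfrac12\sum_{\alpha\in\mathfrak R_+}(e_\alpha\otimes e_{-\alpha}-e_{-\alpha}\otimes e_\alpha)\in\wedge^2\mathfrak g_{\mathbb C}$$ be the classical $r$-matrix ($e_a$ an orthonormal basis of $\mathfrak g$). Let $\mathcal E'(G)$ be the space of complex-valued distributions on $G$, and let $\mathcal E'(T)^-$ be the space of distributions $v$ on $T$ with $\langle v,t^\nu\rangle=0$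 for all $\nu\in\Lambda^*\setminus(\rho+\Lambda^*_+)$. Let $r_G^T:\mathcal E'(G)\to\mathcal E'(T)^-$ be the linear map with $\langle r_G^T(u),t^{\lambda+\rho}\rangle=\langle u,\Delta_\lambda\rangle$ for $\lambda\in\Lambda^*_+$, where $\Delta_\lambda(g)=(v_\lambda,g\cdot v_\lambda)$ for a unit highest weight vector $v_\lambda$ of the unitary irreducible representation of highest weight $\lambda$. For a Euclidean vector space $V$ let $\mathrm{Cl}(V)$ be the Clifford algebra with relations $2\xi\xi=\xi\cdot\xi$, with contractions $\iota_\xi=\mathrm{ad}(\xi)$ (super-commutator). Let $p_G^T:\mathrm{Cl}(\mathfrak g)_{\mathbb C}\to\mathrm{Cl}(\mathfrak t)_{\mathbb C}$ be the orthogonal projection and $\mathcal T=\exp(\tfrac12\sum r_{ab}\iota_a\iota_b)$ on $\mathrm{Cl}(\mathfrak g)_{\mathbb C}$. Put $\widehat{\mathcal W}_G=\mathcal E'(G)\otimes\mathrm{Cl}(\mathfrak g)_{\mathbb C}$, $\widehat{\mathcal W}_T^-=\mathcal E'(T)^-\otimes\mathrm{Cl}(\mathfrak t)_{\mathbb C}$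 and $\mathcal R_G^T=r_G^T\otimes(p_G^T\circ\mathcal T):\widehat{\mathcal W}_G\to\widehat{\mathcal W}_T^-$. Let $M$ be a $G$-manifold, $\Omega(M)$ its complex-valued differential forms, $\xi_M=\frac{d}{dt}\big|_{0}\exp(-t\xi)^*$ the fundamental vector fields, and $\iota_\xi=\iota(\xi_M)$. Tensor products of spaces of distributions with $\Omega(M)$ are completed, i.e. consist of $\Omega(M)$-valued distributions. Let $$\widehat{\mathcal C}_G(M)=(\mathcal E'(G)\otimes\Omega(M))^G,\qquad \widehat{\mathcal C}_T^-(M)=\mathcal E'(T)^-\otimes\Omega(M)^T$$ be the Cartan models, and let $(\widehat{\mathcal W}_G\otimes\Omega(M))_{basic}$ and $(\widehat{\mathcal W}_T^-\otimes\Omega(M))_{basic}$ be the Weil models, i.e. the subspaces of $G$-invariant (resp. $T$-invariant) elements annihilated by all $\iota_\xi\otimes1+1\otimes\iota_\xi$, $\xi\in\mathfrak g$ (resp. $\xi\in\mathfrak t$), with the graded sign convention. **Proposition (Cartan model of $\mathcal R_G^T$).** The map $r_G^T$ exists; the horizontal projections $P_{hor}\otimes1$ (given by the degree zero part of the symbol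 in the Clifford algebra) restrict to linear isomorphisms $$(\widehat{\mathcal W}_G\otimes\Omega(M))_{basic}\cong\widehat{\mathcal C}_G(M),\qquad(\widehat{\mathcal W}_T^-\otimes\Omega(M))_{basic}\cong\widehat{\mathcal C}_T^-(M);$$ the map $\mathcal R_G^T\otimes1$ takes basic elements to basic elements; and under these isomorphisms the induced map between Cartan models is $$r_G^T\otimes\exp(\tfrac12\iota(r_M)):\ \widehat{\mathcal C}_G(M)\to\widehat{\mathcal C}_T^-(M),$$ where $r_M=\sum r_{ab}\,(e_a)_M\wedge(e_b)_M$ is the bi-vector field on $M$ induced by the classical $r$-matrix (with $\iota(X\wedge Y)=\iota(X)\iota(Y)$). -/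

import Mathlib

open scoped Manifold ContDiff TensorProduct

namespace WeilCartan

noncomputable section

/-! ### The exponential of a nilpotent operator -/

/-- `exp N = ∑ᵢ Nⁱ / i!` for a nilpotent operator `N`. -/
def nilExp {V : Type*} [AddCommGroup V] [Module ℂ V] (N : Module.End ℂ V) : Module.End ℂ V :=
  ∑ i ∈ Finset.range (nilpotencyClass N), ((i.factorial : ℂ)⁻¹) • N ^ i

/-- If `J : 𝔞 → End V` is a linear family of operators (extended complex linearly to `𝔞 ⊗ ℂ`), then
`quadOp J (∑ X ⊗ Y) = ∑ J X ∘ J Y`; in terms of a basis `e_a` of `𝔞`, the 2-tensor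
`∑ r_ab e_a ⊗ e_b` goes to `∑ r_ab J_a J_b`. -/
def quadOp {𝔞 V : Type*} [AddCommGroup 𝔞] [Module ℝ 𝔞] [AddCommGroup V] [Module ℂ V]
    (J : 𝔞 →ₗ[ℝ] Module.End ℂ V) :
    ((ℂ ⊗[ℝ] 𝔞) ⊗[ℂ] (ℂ ⊗[ℝ] 𝔞)) →ₗ[ℂ] Module.End ℂ V :=
  TensorProduct.lift
    ((LinearMap.mul ℂ (Module.End ℂ V)).compl₁₂ (J.liftBaseChange ℂ) (J.liftBaseChange ℂ))

/-- Complex conjugation on `𝔞 ⊗ ℂ`. -/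
def conjC (𝔞 : Type*) [AddCommGroup 𝔞] [Module ℝ 𝔞] : (ℂ ⊗[ℝ] 𝔞) →ₗ[ℝ] (ℂ ⊗[ℝ] 𝔞) :=
  LinearMap.rTensor 𝔞 Complex.conjAe.toLinearMap

/-! ### Differential forms -/

/-- Complex valued alternating forms on a real vector space, of all degrees (these vanish in
degrees above the dimension, so that for finite dimensional `V` this is `⋀ V* ⊗ ℂ`). -/
abbrev AltForms (V : Type*) [AddCommGroup V] [Module ℝ V] : Type _ :=
  ∀ k : ℕ, V [⋀^Fin k]→ₗ[ℝ] ℂ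

/-- Contraction of alternating forms with a vector, `ι_X ω = ω (X, ⋯)`. -/
def contractVec (V : Type*) [AddCommGroup V] [Module ℝ V] :
    V →ₗ[ℝ] Module.End ℂ (AltForms V) where
  toFun X :=
    { toFun := fun a k => (a (k + 1)).curryLeft X
      map_add' := fun a b => by funext k; ext v; simp
      map_smul' := fun c a => by funext k; ext v; simp }
  map_add' X Y := by ext a k v; simp
  map_smul' c X := by ext a k v; simp

section Forms

variable (F M : Type*) [NormedAddCommGroup F] [NormedSpace ℝ F]
  [TopologicalSpace M] [ChartedSpace F M]

/-- Smooth vector fields. -/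
def IsSmoothField [IsManifold 𝓘(ℝ, F) ∞ M] (X : ∀ m : M, TangentSpace 𝓘(ℝ, F) m) : Prop :=
  ContMDiff 𝓘(ℝ, F) 𝓘(ℝ, F).tangent ∞ fun m => (⟨m, X m⟩ : TangentBundle 𝓘(ℝ, F) M)

/-- `Ω(M)`: the space of smooth complex valued differential forms on `M`, of all degrees.
A form is smooth if its values on smooth vector fields are smooth functions. -/
def smoothForms [IsManifold 𝓘(ℝ, F) ∞ M] :
    Submodule ℂ (∀ m : M, AltForms (TangentSpace 𝓘(ℝ, F) m)) where
  carrier := {β | ∀ (k : ℕ) (X : Fin k → ∀ m : M, TangentSpace 𝓘(ℝ, F) m),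
    (∀ i, IsSmoothField F M (X i)) →
      ContMDiff 𝓘(ℝ, F) 𝓘(ℝ, ℂ) ∞ fun m => β m k fun i => X i m}
  add_mem' := by
    intro a b ha hb k X hX
    exact (ha k X hX).add (hb k X hX)
  zero_mem' := by
    intro k X hX
    exact contMDiff_const
  smul_mem' := by
    intro c a ha k X hX
    have hc : ContDiff ℝ ∞ fun z : ℂ => c * z := contDiff_const.mul contDiff_id
    exact hc.contMDiff.comp (ha k X hX)

end Forms

section Geometry

variable {N P Q A B C : Type*} [NormedAddCommGroup A] [NormedSpace ℝ A] [NormedAddCommGroup B]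
  [NormedSpace ℝ B] [NormedAddCommGroup C] [NormedSpace ℝ C] [TopologicalSpace N]
  [ChartedSpace A N] [TopologicalSpace P] [ChartedSpace B P] [TopologicalSpace Q]
  [ChartedSpace C Q] [IsManifold 𝓘(ℝ, A) ∞ N] [IsManifold 𝓘(ℝ, B) ∞ P] [IsManifold 𝓘(ℝ, C) ∞ Q]

theorem contMDiff_partial {f : N × P → Q}
    (hf : ContMDiff (𝓘(ℝ, A).prod 𝓘(ℝ, B)) 𝓘(ℝ, C) ∞ f) (p : P)
    (v : TangentSpace 𝓘(ℝ, B) p) :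
    ContMDiff 𝓘(ℝ, A) 𝓘(ℝ, C).tangent ∞ fun n =>
      (⟨f (n, p), mfderiv 𝓘(ℝ, B) 𝓘(ℝ, C) (fun q => f (n, q)) p v⟩ :
        TangentBundle 𝓘(ℝ, C) Q) := by
  let fg : N → TangentBundle 𝓘(ℝ, A) N := fun n => Bundle.TotalSpace.mk' A n 0
  have sfg : ContMDiff 𝓘(ℝ, A) 𝓘(ℝ, A).tangent ∞ fg := Bundle.contMDiff_zeroSection _ _
  let fv : N → TangentBundle 𝓘(ℝ, B) P := fun _ => Bundle.TotalSpace.mk' B p v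
  have sfv : ContMDiff 𝓘(ℝ, A) 𝓘(ℝ, B).tangent ∞ fv := contMDiff_const
  let F₁ : N → (TangentBundle 𝓘(ℝ, A) N × TangentBundle 𝓘(ℝ, B) P) := fun n => (fg n, fv n)
  have S₁ : ContMDiff 𝓘(ℝ, A) (𝓘(ℝ, A).tangent.prod 𝓘(ℝ, B).tangent) ∞ F₁ := sfg.prodMk sfv
  let F₂ := (equivTangentBundleProd 𝓘(ℝ, A) N 𝓘(ℝ, B) P).symm
  have S₂ : ContMDiff (𝓘(ℝ, A).tangent.prod 𝓘(ℝ, B).tangent)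
      (𝓘(ℝ, A).prod 𝓘(ℝ, B)).tangent ∞ F₂ := contMDiff_equivTangentBundleProd_symm
  have S₃ : ContMDiff (𝓘(ℝ, A).prod 𝓘(ℝ, B)).tangent 𝓘(ℝ, C).tangent ∞
      (tangentMap (𝓘(ℝ, A).prod 𝓘(ℝ, B)) 𝓘(ℝ, C) f) :=
    hf.contMDiff_tangentMap (by simp)
  have S := (S₃.comp S₂).comp S₁
  convert! S with n
  · simp only [Function.comp_apply, tangentMap, F₂, F₁, fg, fv]
    rw [mfderiv_prod_eq_add_apply (hf.mdifferentiable (by simp) _)]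
    exact ((congrArg (· + _) (map_zero _)).trans (zero_add _)).symm

end Geometry

section Action

variable (E G F M : Type*) [NormedAddCommGroup E] [NormedSpace ℝ E] [NormedAddCommGroup F]
  [NormedSpace ℝ F] [TopologicalSpace G] [ChartedSpace E G] [Group G] [LieGroup 𝓘(ℝ, E) ∞ G]
  [TopologicalSpace M] [ChartedSpace F M] [IsManifold 𝓘(ℝ, F) ∞ M]
  [MulAction G M] [ContMDiffSMul 𝓘(ℝ, E) 𝓘(ℝ, F) ∞ G M]

/-- The Lie algebra of `G`. -/
abbrev Lie : Type _ := GroupLieAlgebra 𝓘(ℝ, E) G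

variable {G} in
/-- The adjoint action of `g` on the Lie algebra. -/
def Ad (g : G) : Lie E G →ₗ[ℝ] Lie E G :=
  (mfderiv 𝓘(ℝ, E) 𝓘(ℝ, E) (fun h : G => g * h * g⁻¹) 1 : E →L[ℝ] E).toLinearMap

variable {M} in
/-- `ξ ↦ ξ_M (m)`: the fundamental vector fields, `ξ_M = d/dt exp(-tξ)^*` at `t = 0`. -/
def fundField (m : M) : Lie E G →ₗ[ℝ] TangentSpace 𝓘(ℝ, F) m :=
  -(mfderiv 𝓘(ℝ, E) 𝓘(ℝ, F) (fun g : G => g • m) 1 : E →L[ℝ] F).toLinearMap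

theorem isSmoothField_fundField (ξ : Lie E G) :
    IsSmoothField F M fun m => fundField E G F m ξ := by
  have hf : ContMDiff (𝓘(ℝ, F).prod 𝓘(ℝ, E)) 𝓘(ℝ, F) ∞ fun p : M × G => p.2 • p.1 :=
    (contMDiff_smul (I := 𝓘(ℝ, E)) (I' := 𝓘(ℝ, F)) (n := ∞) (G := G) (M := M)).comp
      (contMDiff_snd.prodMk contMDiff_fst)
  have h := contMDiff_partial hf (1 : G) (-ξ)
  refine (congrArg (ContMDiff _ _ _) (funext fun m => ?_)).mpr h
  have h1 : ∀ (x : M) (v : F), x = m →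
      (⟨m, v⟩ : TangentBundle 𝓘(ℝ, F) M) = ⟨x, v⟩ := by
    rintro x v rfl; rfl
  refine Eq.trans (h1 _ (fundField E G F m ξ) (one_smul G m)) ?_
  refine congrArg (fun v : F => (⟨(1 : G) • m, v⟩ : TangentBundle 𝓘(ℝ, F) M)) ?_
  exact (map_neg (mfderiv 𝓘(ℝ, E) 𝓘(ℝ, F) (fun g : G => g • m) 1 : E →L[ℝ] F) ξ).symm

variable {G M} in
/-- The tangent space at `m` mapped to the tangent space at `g • m` by the action of `g`. -/
def tangentAct (g : G) (m : M) : TangentSpace 𝓘(ℝ, F) m →ₗ[ℝ] TangentSpace 𝓘(ℝ, F) (g • m) :=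
  (mfderiv 𝓘(ℝ, F) 𝓘(ℝ, F) (fun x : M => g • x) m).toLinearMap

theorem isSmoothField_push (hg : ∀ g : G, ContMDiff 𝓘(ℝ, F) 𝓘(ℝ, F) ∞ fun x : M => g • x)
    (g : G) {X : ∀ m : M, TangentSpace 𝓘(ℝ, F) m}
    (hX : IsSmoothField F M X) :
    ∃ Y, IsSmoothField F M Y ∧ ∀ m, Y (g • m) = tangentAct F g m (X m) := by
  let Y : ∀ m : M, TangentSpace 𝓘(ℝ, F) m := fun m =>
    (mfderiv 𝓘(ℝ, F) 𝓘(ℝ, F) (fun x : M => g • x) (g⁻¹ • m) : F →L[ℝ] F) (X (g⁻¹ • m))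
  refine ⟨Y, ?_, ?_⟩
  · have h := (((hg g).contMDiff_tangentMap (m := ∞) (by simp)).comp hX).comp (hg g⁻¹)
    refine (congrArg (ContMDiff _ _ _) (funext fun m => ?_)).mpr h
    have h1 : ∀ (x : M) (v : F), x = m →
        (⟨m, v⟩ : TangentBundle 𝓘(ℝ, F) M) = ⟨x, v⟩ := by
      rintro x v rfl; rfl
    exact h1 _ (Y m) (smul_inv_smul g m)
  · intro m
    have h2 : ∀ x : M, x = m →
        (mfderiv 𝓘(ℝ, F) 𝓘(ℝ, F) (fun x : M => g • x) x : F →L[ℝ] F) (X x) =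
          (mfderiv 𝓘(ℝ, F) 𝓘(ℝ, F) (fun x : M => g • x) m : F →L[ℝ] F) (X m) := by
      rintro x rfl; rfl
    exact h2 _ (inv_smul_smul g m)

variable {G M} in
/-- The pull-back `g^* β` of a differential form by the action of `g`. -/
def pull (g : G) : Module.End ℂ (smoothForms F M) where
  toFun β := ⟨fun m k => ((β : ∀ m : M, AltForms (TangentSpace 𝓘(ℝ, F) m)) (g • m) k).compLinearMap
      (tangentAct F g m), by
    intro k X hX
    have hg : ∀ g : G, ContMDiff 𝓘(ℝ, F) 𝓘(ℝ, F) ∞ fun x : M => g • x := fun g =>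
      (contMDiff_smul (I := 𝓘(ℝ, E)) (I' := 𝓘(ℝ, F)) (n := ∞) (G := G) (M := M)).comp
        (contMDiff_const.prodMk contMDiff_id)
    choose Y hY hYX using fun i => isSmoothField_push G F M hg g (hX i)
    refine (congrArg (ContMDiff _ _ _) (funext fun m => ?_)).mpr ((β.2 k Y hY).comp (hg g))
    simp only [Function.comp_apply, AlternatingMap.compLinearMap_apply, hYX]⟩
  map_add' a b := by ext m k v; simp
  map_smul' c a := by ext m k v; simp

/-- The contractions `ι_ξ = ι(ξ_M)` on `Ω(M)`. -/
def iota : Lie E G →ₗ[ℝ] Module.End ℂ (smoothForms F M) where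
  toFun ξ :=
    { toFun := fun β => ⟨fun m => contractVec _ (fundField E G F m ξ) (β.1 m), by
        intro k X hX
        have h := β.2 (k + 1) (Fin.cons (fun m => fundField E G F m ξ) X) (by
          intro i
          refine Fin.cases ?_ (fun j => ?_) i
          · exact isSmoothField_fundField E G F M ξ
          · exact hX j)
        refine (congrArg (ContMDiff _ _ _) (funext fun m => ?_)).mpr h
        simp only [contractVec, LinearMap.coe_mk, AddHom.coe_mk, AlternatingMap.curryLeft_apply_apply]
        congr 1
        funext i
        refine Fin.cases ?_ (fun j => ?_) i <;> rfl⟩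
      map_add' := fun a b => by ext m k v; simp
      map_smul' := fun c a => by ext m k v; simp }
  map_add' X Y := by ext a m k v; simp
  map_smul' c X := by ext a m k v; simp

variable {M} in
/-- The bi-vector field on `M` induced by `r ∈ 𝔤_ℂ ⊗ 𝔤_ℂ`: if `r = ∑ r_ab e_a ⊗ e_b`, this is
`r_M = ∑ r_ab (e_a)_M ⊗ (e_b)_M`. -/
def inducedBivector (r : (ℂ ⊗[ℝ] Lie E G) ⊗[ℂ] (ℂ ⊗[ℝ] Lie E G)) (m : M) :
    (ℂ ⊗[ℝ] TangentSpace 𝓘(ℝ, F) m) ⊗[ℂ] (ℂ ⊗[ℝ] TangentSpace 𝓘(ℝ, F) m) :=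
  TensorProduct.map ((fundField E G F m).baseChange ℂ) ((fundField E G F m).baseChange ℂ) r

theorem contract_inducedBivector (r : (ℂ ⊗[ℝ] Lie E G) ⊗[ℂ] (ℂ ⊗[ℝ] Lie E G))
    (β : smoothForms F M) (m : M) :
    quadOp (contractVec _) (inducedBivector E G F r m) (β.1 m) =
      (quadOp (iota E G F M) r β).1 m := by
  have h1 : ∀ (x : ℂ ⊗[ℝ] Lie E G) (β : smoothForms F M),
      (contractVec (TangentSpace 𝓘(ℝ, F) m)).liftBaseChange ℂ
        ((fundField E G F m).baseChange ℂ x) (β.1 m) =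
      (((iota E G F M).liftBaseChange ℂ x) β).1 m := by
    intro x β
    induction x using TensorProduct.induction_on with
    | zero => simp
    | tmul c ξ => simp [iota]
    | add x y hx hy => simp [hx, hy]
  induction r using TensorProduct.induction_on with
  | zero => simp [inducedBivector]
  | tmul x y => simp [inducedBivector, quadOp, h1]
  | add x y hx hy =>
    have h2 : inducedBivector E G F (x + y) m =
      inducedBivector E G F x m + inducedBivector E G F y m := map_add _ _ _
    simp [h2, hx, hy]

/-- The operator `ι(r_M)` on `Ω(M)`: contraction, at each point, with the bi-vector field `r_M`,
where `ι(X ∧ Y) = ι(X) ι(Y)`. -/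
def iotaBivector (r : (ℂ ⊗[ℝ] Lie E G) ⊗[ℂ] (ℂ ⊗[ℝ] Lie E G)) :
    Module.End ℂ (smoothForms F M) where
  toFun β := ⟨fun m => quadOp (contractVec _) (inducedBivector E G F r m) (β.1 m), by
    have h : (fun m => quadOp (contractVec _) (inducedBivector E G F r m) (β.1 m)) =
        (quadOp (iota E G F M) r β).1 := funext (contract_inducedBivector E G F M r β)
    rw [h]
    exact (quadOp (iota E G F M) r β).2⟩
  map_add' a b := by ext m k v; simp
  map_smul' c a := by ext m k v; simp

end Action

/-! ### Forms with distributional coefficients -/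

section DistForms

variable (F M : Type*) [NormedAddCommGroup F] [NormedSpace ℝ F]
  [TopologicalSpace M] [ChartedSpace F M] [IsManifold 𝓘(ℝ, F) ∞ M]

variable {M} in
/-- The value of a differential form at the point `m`. -/
def evalAt (m : M) : smoothForms F M →ₗ[ℂ] AltForms (TangentSpace 𝓘(ℝ, F) m) :=
  LinearMap.proj m ∘ₗ (smoothForms F M).subtype

/-- Let `D` be a space of distributions, given as linear functionals on a space `𝒟` of test
functions. `distForms F M D` is the (completed) tensor product `D ⊗ Ω(M)`, that is the space of
`Ω(M)`-valued distributions: linear maps `u : 𝒟 → Ω(M)` such that for every `m ∈ M` and every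
linear functional `ℓ` on the space of alternating forms on `T_m M`, the functional
`φ ↦ ℓ (u(φ)_m)` belongs to `D`. (By the closed graph theorem such a `u` is automatically
continuous for the `C^∞` topology of `Ω(M)`.) For `v ∈ D` and `β ∈ Ω(M)`, the element `v ⊗ β` is
`φ ↦ v(φ) β`. -/
def distForms {𝒟 : Type*} [AddCommGroup 𝒟] [Module ℂ 𝒟] (D : Submodule ℂ (𝒟 →ₗ[ℂ] ℂ)) :
    Submodule ℂ (𝒟 →ₗ[ℂ] smoothForms F M) where
  carrier := {u | ∀ (m : M) (ℓ : AltForms (TangentSpace 𝓘(ℝ, F) m) →ₗ[ℂ] ℂ),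
    ℓ ∘ₗ evalAt F m ∘ₗ u ∈ D}
  add_mem' := by
    intro a b ha hb m ℓ
    have := D.add_mem (ha m ℓ) (hb m ℓ)
    simpa [LinearMap.comp_add] using this
  zero_mem' := by
    intro m ℓ
    simp
  smul_mem' := by
    intro c a ha m ℓ
    have := D.smul_mem c (ha m ℓ)
    simpa [LinearMap.comp_smul] using this

variable {F M}

/-- The coefficient `φ ↦ ℓ (u(φ)_m)` of a form with distributional coefficients. -/
def coeffAt {𝒟 : Type*} [AddCommGroup 𝒟] [Module ℂ 𝒟] {D : Submodule ℂ (𝒟 →ₗ[ℂ] ℂ)} (m : M)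
    (ℓ : AltForms (TangentSpace 𝓘(ℝ, F) m) →ₗ[ℂ] ℂ) (u : distForms F M D) : D :=
  ⟨ℓ ∘ₗ evalAt F m ∘ₗ u.1, u.2 m ℓ⟩

/-- `R = A ⊗ 1` as a map `D ⊗ Ω(M) → D' ⊗ Ω(M)`: `R` acts as `A` on all coefficients. -/
def IsTensorId {𝒟 𝒟' : Type*} [AddCommGroup 𝒟] [Module ℂ 𝒟] [AddCommGroup 𝒟'] [Module ℂ 𝒟']
    {D : Submodule ℂ (𝒟 →ₗ[ℂ] ℂ)} {D' : Submodule ℂ (𝒟' →ₗ[ℂ] ℂ)}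
    (A : D →ₗ[ℂ] D') (R : distForms F M D →ₗ[ℂ] distForms F M D') : Prop :=
  ∀ (u : distForms F M D) (m : M) (ℓ : AltForms (TangentSpace 𝓘(ℝ, F) m) →ₗ[ℂ] ℂ),
    coeffAt m ℓ (R u) = A (coeffAt m ℓ u)

/-- An operator on `Ω(M)` is fibrewise if it is given by operators on the spaces of alternating
forms on the tangent spaces. -/
def Fibrewise (N : Module.End ℂ (smoothForms F M)) : Prop :=
  ∃ e : ∀ m : M, Module.End ℂ (AltForms (TangentSpace 𝓘(ℝ, F) m)),
    ∀ β m, evalAt F m (N β) = e m (evalAt F m β)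

theorem Fibrewise.nilExp {N : Module.End ℂ (smoothForms F M)} (h : Fibrewise N) :
    Fibrewise (nilExp N) := by
  obtain ⟨e, he⟩ := h
  have hpow : ∀ (i : ℕ) β m, evalAt F m ((N ^ i) β) = (e m ^ i) (evalAt F m β) := by
    intro i
    induction i with
    | zero => intro β m; simp
    | succ n ih => intro β m; rw [pow_succ, pow_succ]; simp [ih, he]
  refine ⟨fun m => ∑ i ∈ Finset.range (nilpotencyClass N), ((i.factorial : ℂ)⁻¹) • e m ^ i, ?_⟩
  intro β m
  simp [WeilCartan.nilExp, hpow]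

theorem Fibrewise.smul {N : Module.End ℂ (smoothForms F M)} (h : Fibrewise N) (c : ℂ) :
    Fibrewise (c • N) := by
  obtain ⟨e, he⟩ := h
  exact ⟨fun m => c • e m, fun β m => by simp [he]⟩

/-- The operator `1 ⊗ N` on `D ⊗ Ω(M)`, for a fibrewise operator `N` on `Ω(M)`. -/
def postComp {𝒟 : Type*} [AddCommGroup 𝒟] [Module ℂ 𝒟] (D : Submodule ℂ (𝒟 →ₗ[ℂ] ℂ))
    (N : Module.End ℂ (smoothForms F M)) (hN : Fibrewise N) :
    Module.End ℂ (distForms F M D) where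
  toFun u := ⟨N ∘ₗ u.1, by
    obtain ⟨e, he⟩ := hN
    intro m ℓ
    have h := u.2 m (ℓ ∘ₗ e m)
    convert h using 1
    ext φ
    simp [he]⟩
  map_add' a b := by ext1; simp [LinearMap.comp_add]
  map_smul' c a := by ext1; simp [LinearMap.comp_smul]

end DistForms

section FibrewiseOps

variable (E G F M : Type*) [NormedAddCommGroup E] [NormedSpace ℝ E] [NormedAddCommGroup F]
  [NormedSpace ℝ F] [TopologicalSpace G] [ChartedSpace E G] [Group G] [LieGroup 𝓘(ℝ, E) ∞ G]
  [TopologicalSpace M] [ChartedSpace F M] [IsManifold 𝓘(ℝ, F) ∞ M]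
  [MulAction G M] [ContMDiffSMul 𝓘(ℝ, E) 𝓘(ℝ, F) ∞ G M]

theorem fibrewise_iota (ξ : Lie E G) : Fibrewise (iota E G F M ξ) :=
  ⟨fun m => contractVec _ (fundField E G F m ξ), fun _ _ => rfl⟩

theorem fibrewise_iotaBivector (r : (ℂ ⊗[ℝ] Lie E G) ⊗[ℂ] (ℂ ⊗[ℝ] Lie E G)) :
    Fibrewise (iotaBivector E G F M r) :=
  ⟨fun m => quadOp (contractVec _) (inducedBivector E G F r m), fun _ _ => rfl⟩

/-- The operator `exp(½ ι(r_M))` on `Ω(M)`. -/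
def expBivector (r : (ℂ ⊗[ℝ] Lie E G) ⊗[ℂ] (ℂ ⊗[ℝ] Lie E G)) :
    Module.End ℂ (smoothForms F M) :=
  nilExp ((1 / 2 : ℂ) • iotaBivector E G F M r)

theorem fibrewise_expBivector (r : (ℂ ⊗[ℝ] Lie E G) ⊗[ℂ] (ℂ ⊗[ℝ] Lie E G)) :
    Fibrewise (expBivector E G F M r) :=
  ((fibrewise_iotaBivector E G F M r).smul _).nilExp

end FibrewiseOps

/-! ### Distributions on a compact Lie group -/

section DistG

variable (E G : Type*) [NormedAddCommGroup E] [NormedSpace ℝ E]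
  [TopologicalSpace G] [ChartedSpace E G] [Group G] [LieGroup 𝓘(ℝ, E) ∞ G]

/-- `C^∞(G)`, complex valued. -/
def smoothFun : Submodule ℂ (G → ℂ) where
  carrier := {f | ContMDiff 𝓘(ℝ, E) 𝓘(ℝ, ℂ) ∞ f}
  add_mem' ha hb := ha.add hb
  zero_mem' := contMDiff_const
  smul_mem' := by
    intro c a ha
    have hc : ContDiff ℝ ∞ fun z : ℂ => c * z := contDiff_const.mul contDiff_id
    exact hc.contMDiff.comp ha

variable {G}

/-- The derivative of `f` along the left invariant vector field equal to `ξ` at the group unit. -/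
def leftDeriv (ξ : Lie E G) (f : G → ℂ) (g : G) : ℂ :=
  (mfderiv 𝓘(ℝ, E) 𝓘(ℝ, ℂ) f g : E →L[ℝ] ℂ) (mulInvariantVectorField ξ g)

theorem leftDeriv_smooth (ξ : Lie E G) {f : G → ℂ} (hf : ContMDiff 𝓘(ℝ, E) 𝓘(ℝ, ℂ) ∞ f) :
    ContMDiff 𝓘(ℝ, E) 𝓘(ℝ, ℂ) ∞ (leftDeriv E ξ f) := by
  have hm : ContMDiff (𝓘(ℝ, E).prod 𝓘(ℝ, E)) 𝓘(ℝ, E) ∞ fun p : G × G => p.1 * p.2 :=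
    contMDiff_mul 𝓘(ℝ, E) ∞
  have h := contMDiff_partial hm (1 : G) ξ
  have h2 := (hf.contMDiff_tangentMap (m := ∞) (by simp)).comp h
  have h3 := (contMDiff_snd_tangentBundle_modelSpace ℂ 𝓘(ℝ, ℂ) (n := ∞)).comp h2
  refine (congrArg (ContMDiff _ _ _) (funext fun g => ?_)).mpr h3
  have h1 : ∀ (x : G) (v : E), x = g →
      (mfderiv 𝓘(ℝ, E) 𝓘(ℝ, ℂ) f g : E →L[ℝ] ℂ) v =
        (mfderiv 𝓘(ℝ, E) 𝓘(ℝ, ℂ) f x : E →L[ℝ] ℂ) v := by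
    rintro x v rfl; rfl
  exact h1 _ _ (mul_one g)

/-- The iterated derivative along a word of left invariant vector fields. -/
def wordDeriv (w : List (Lie E G)) (f : G → ℂ) : G → ℂ := w.foldr (leftDeriv E) f

theorem contMDiff_conj (g : G) :
    ContMDiff 𝓘(ℝ, E) 𝓘(ℝ, E) ∞ fun h : G => g * h * g⁻¹ :=
  ((contMDiff_const.mul contMDiff_id).mul contMDiff_const)

theorem leftDeriv_conj (g : G) (ξ : Lie E G) {f : G → ℂ}
    (hf : ContMDiff 𝓘(ℝ, E) 𝓘(ℝ, ℂ) ∞ f) :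
    leftDeriv E ξ (fun h => f (g * h * g⁻¹)) =
      fun h => leftDeriv E (Ad E g ξ) f (g * h * g⁻¹) := by
  have hc := contMDiff_conj E g
  have hmul : ∀ h : G, ContMDiff 𝓘(ℝ, E) 𝓘(ℝ, E) ∞ fun x : G => h * x := fun h =>
    contMDiff_const.mul contMDiff_id
  funext h
  have e1 : mfderiv 𝓘(ℝ, E) 𝓘(ℝ, ℂ) (fun h => f (g * h * g⁻¹)) h =
      (mfderiv 𝓘(ℝ, E) 𝓘(ℝ, ℂ) f (g * h * g⁻¹)).comp
        (mfderiv 𝓘(ℝ, E) 𝓘(ℝ, E) (fun h : G => g * h * g⁻¹) h) :=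
    mfderiv_comp (I' := 𝓘(ℝ, E)) h (hf.mdifferentiable (by simp) _)
      (hc.mdifferentiable (by simp) _)
  have e2 : (mfderiv 𝓘(ℝ, E) 𝓘(ℝ, E) (fun x : G => g * (h * x) * g⁻¹) 1 : E →L[ℝ] E) =
      (mfderiv 𝓘(ℝ, E) 𝓘(ℝ, E) (fun h : G => g * h * g⁻¹) (h * 1) : E →L[ℝ] E).comp
        (mfderiv 𝓘(ℝ, E) 𝓘(ℝ, E) (fun x : G => h * x) 1 : E →L[ℝ] E) :=
    mfderiv_comp (I' := 𝓘(ℝ, E)) (g := fun h : G => g * h * g⁻¹) (1 : G)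
      (hc.mdifferentiable (by simp) _) ((hmul h).mdifferentiable (by simp) _)
  have e3 : (mfderiv 𝓘(ℝ, E) 𝓘(ℝ, E) (fun x : G => (g * h * g⁻¹) * (g * x * g⁻¹)) 1 : E →L[ℝ] E) =
      (mfderiv 𝓘(ℝ, E) 𝓘(ℝ, E) (fun x : G => (g * h * g⁻¹) * x) (g * 1 * g⁻¹) : E →L[ℝ] E).comp
        (mfderiv 𝓘(ℝ, E) 𝓘(ℝ, E) (fun h : G => g * h * g⁻¹) 1 : E →L[ℝ] E) :=
    mfderiv_comp (I' := 𝓘(ℝ, E)) (g := fun x : G => (g * h * g⁻¹) * x) (1 : G)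
      ((hmul _).mdifferentiable (by simp) _) (hc.mdifferentiable (by simp) _)
  have e4 : (fun x : G => g * (h * x) * g⁻¹) = fun x : G => (g * h * g⁻¹) * (g * x * g⁻¹) := by
    funext x; group
  rw [e4, e3] at e2
  rw [show g * 1 * g⁻¹ = 1 by simp, show h * 1 = h from mul_one h] at e2
  have e5 := congrArg (fun L : E →L[ℝ] E => L ξ) e2
  simp only [leftDeriv]
  refine (congrArg (fun L : E →L[ℝ] ℂ => L (mulInvariantVectorField ξ h)) e1).trans ?_
  exact congrArg (mfderiv 𝓘(ℝ, E) 𝓘(ℝ, ℂ) f (g * h * g⁻¹) : E →L[ℝ] ℂ) e5.symm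

theorem wordDeriv_conj (g : G) (w : List (Lie E G)) {f : G → ℂ}
    (hf : ContMDiff 𝓘(ℝ, E) 𝓘(ℝ, ℂ) ∞ f) :
    ContMDiff 𝓘(ℝ, E) 𝓘(ℝ, ℂ) ∞ (wordDeriv E (w.map (Ad E g)) f) ∧
    wordDeriv E w (fun h => f (g * h * g⁻¹)) =
      fun h => wordDeriv E (w.map (Ad E g)) f (g * h * g⁻¹) := by
  induction w with
  | nil => exact ⟨hf, rfl⟩
  | cons ξ w ih =>
    refine ⟨leftDeriv_smooth E _ ih.1, ?_⟩
    have : wordDeriv E (ξ :: w) (fun h => f (g * h * g⁻¹)) =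
      leftDeriv E ξ (wordDeriv E w (fun h => f (g * h * g⁻¹))) := rfl
    rw [this, ih.2, leftDeriv_conj E g ξ ih.1]
    rfl

variable (G)

/-- `𝓔'(G)`, for a compact Lie group `G`: linear functionals on `C^∞(G)` which are bounded on some
basic neighbourhood of zero in the `C^∞` topology. -/
def distG : Submodule ℂ (smoothFun E G →ₗ[ℂ] ℂ) where
  carrier := {u | ∃ (S : Set (List (Lie E G))) (C : ℝ), S.Finite ∧ ∀ φ : smoothFun E G,
    (∀ w ∈ S, ∀ g : G, ‖wordDeriv E w φ g‖ ≤ 1) → ‖u φ‖ ≤ C}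
  add_mem' := by
    rintro a b ⟨S, C, hS, h⟩ ⟨S', C', hS', h'⟩
    refine ⟨S ∪ S', C + C', hS.union hS', fun φ hφ => ?_⟩
    exact (norm_add_le _ _).trans (add_le_add (h φ fun w hw => hφ w (Or.inl hw))
      (h' φ fun w hw => hφ w (Or.inr hw)))
  zero_mem' := ⟨∅, 0, Set.finite_empty, fun φ _ => by simp⟩
  smul_mem' := by
    rintro c a ⟨S, C, hS, h⟩
    refine ⟨S, ‖c‖ * C, hS, fun φ hφ => ?_⟩
    simpa using mul_le_mul_of_nonneg_left (h φ hφ) (norm_nonneg c)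

variable {G}

/-- `φ ↦ φ ∘ Ad_g`, where `Ad_g h = g h g⁻¹`. -/
def conjFun (g : G) : Module.End ℂ (smoothFun E G) where
  toFun φ := ⟨fun h => φ.1 (g * h * g⁻¹), φ.2.comp (contMDiff_conj E g)⟩
  map_add' _ _ := rfl
  map_smul' _ _ := rfl

theorem distG_conj (g : G) {u : smoothFun E G →ₗ[ℂ] ℂ} (hu : u ∈ distG E G) :
    u ∘ₗ conjFun E g ∈ distG E G := by
  obtain ⟨S, C, hS, h⟩ := hu
  refine ⟨(fun w => w.map (Ad E g)) '' S, C, hS.image _, fun φ hφ => h _ ?_⟩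
  intro w hw x
  have e : wordDeriv E w (conjFun E g φ : G → ℂ) =
      fun h => wordDeriv E (w.map (Ad E g)) φ (g * h * g⁻¹) := (wordDeriv_conj E g w φ.2).2
  rw [e]
  exact hφ _ ⟨w, hw, rfl⟩ _

end DistG

section ActDist

variable (E G F M : Type*) [NormedAddCommGroup E] [NormedSpace ℝ E] [NormedAddCommGroup F]
  [NormedSpace ℝ F] [TopologicalSpace G] [ChartedSpace E G] [Group G] [LieGroup 𝓘(ℝ, E) ∞ G]
  [TopologicalSpace M] [ChartedSpace F M] [IsManifold 𝓘(ℝ, F) ∞ M]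
  [MulAction G M] [ContMDiffSMul 𝓘(ℝ, E) 𝓘(ℝ, F) ∞ G M]

theorem pull_evalAt (g : G) (m : M) :
    ∃ e : AltForms (TangentSpace 𝓘(ℝ, F) (g • m)) →ₗ[ℂ] AltForms (TangentSpace 𝓘(ℝ, F) m),
      ∀ β, evalAt F m (pull E F g β) = e (evalAt F (g • m) β) :=
  ⟨{ toFun := fun a k => (a k).compLinearMap (tangentAct F g m)
     map_add' := fun a b => by ext k v; simp
     map_smul' := fun c a => by ext k v; simp }, fun _ => rfl⟩

variable {G} in
/-- The action of `g ∈ G` on `𝓔'(G) ⊗ Ω(M)`, by push-forward under conjugation on `𝓔'(G)` and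
by `(g⁻¹)^*` on `Ω(M)`. -/
def actDistForms (g : G) : Module.End ℂ (distForms F M (distG E G)) where
  toFun u := ⟨pull E F g⁻¹ ∘ₗ u.1 ∘ₗ conjFun E g, by
    intro m ℓ
    obtain ⟨e, he⟩ := pull_evalAt E G F M g⁻¹ m
    have h := distG_conj E g (u.2 (g⁻¹ • m) (ℓ ∘ₗ e))
    convert h using 1
    ext φ
    simp [he]⟩
  map_add' a b := by ext1; simp [LinearMap.comp_add, LinearMap.add_comp]
  map_smul' c a := by ext1; simp [LinearMap.comp_smul, LinearMap.smul_comp]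

end ActDist

/-! ### Distributions on the torus `ℝ^r / ℤ^r` -/

section DistT

/-- The inclusion of `ℤ^r` in `ℝ^r`. It is used for the integral lattice in the Lie algebra of
`T = ℝ^r / ℤ^r` and for the weight lattice in the dual of the Lie algebra. -/
def toReal {r : ℕ} (ν : Fin r → ℤ) : Fin r → ℝ := fun i => ν i

variable (r : ℕ)

/-- `C^∞(T)` for `T = ℝ^r / ℤ^r`: smooth complex valued `ℤ^r`-periodic functions on `ℝ^r`. -/
def periodicFun : Submodule ℂ ((Fin r → ℝ) → ℂ) where
  carrier := {f | ContDiff ℝ ∞ f ∧ ∀ (x : Fin r → ℝ) (n : Fin r → ℤ), f (x + toReal n) = f x}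
  add_mem' ha hb := ⟨ha.1.add hb.1, fun x n => by simp [ha.2, hb.2]⟩
  zero_mem' := ⟨contDiff_const, fun _ _ => rfl⟩
  smul_mem' c a ha := ⟨contDiff_const.mul ha.1, fun x n => by simp [ha.2]⟩

/-- `𝓔'(T)` for `T = ℝ^r / ℤ^r`: linear functionals on `C^∞(T)` which are bounded on some basic
neighbourhood of zero in the `C^∞` topology. -/
def distT : Submodule ℂ (periodicFun r →ₗ[ℂ] ℂ) where
  carrier := {u | ∃ (k : ℕ) (C : ℝ), ∀ φ : periodicFun r,
    (∀ j ≤ k, ∀ x, ‖iteratedFDeriv ℝ j (φ : (Fin r → ℝ) → ℂ) x‖ ≤ 1) → ‖u φ‖ ≤ C}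
  add_mem' := by
    rintro a b ⟨k, C, h⟩ ⟨k', C', h'⟩
    refine ⟨max k k', C + C', fun φ hφ => ?_⟩
    exact (norm_add_le _ _).trans (add_le_add
      (h φ fun j hj => hφ j (hj.trans (le_max_left _ _)))
      (h' φ fun j hj => hφ j (hj.trans (le_max_right _ _))))
  zero_mem' := ⟨0, 0, fun φ _ => by simp⟩
  smul_mem' := by
    rintro c a ⟨k, C, h⟩
    refine ⟨k, ‖c‖ * C, fun φ hφ => ?_⟩
    simpa using mul_le_mul_of_nonneg_left (h φ hφ) (norm_nonneg c)

variable {r}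

/-- The pairing of `ν ∈ ℝ^r` with `x ∈ ℝ^r`. -/
def dot (ν x : Fin r → ℝ) : ℝ := ∑ i, ν i * x i

/-- The character `t^ν`, `ν ∈ ℤ^r`, of the torus: `t^ν (x) = exp (2πi ⟨ν, x⟩)`. -/
def character (ν : Fin r → ℤ) : periodicFun r :=
  ⟨fun x => Complex.exp (2 * Real.pi * Complex.I * (dot (toReal ν) x : ℝ)), by
    refine ⟨?_, fun x n => ?_⟩
    · have h1 : ContDiff ℝ ∞ fun x : Fin r → ℝ => dot (toReal ν) x := by unfold dot; fun_prop
      have h2 : ContDiff ℝ ∞ fun x : Fin r → ℝ => ((dot (toReal ν) x : ℝ) : ℂ) :=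
        Complex.ofRealCLM.contDiff.comp h1
      fun_prop
    · refine Complex.exp_eq_exp_iff_exists_int.2 ⟨∑ i, ν i * n i, ?_⟩
      simp only [dot, toReal, Pi.add_apply, mul_add, Finset.sum_add_distrib]
      push_cast
      ring⟩

/-- The Hardy space of distributions on `T` all of whose Fourier coefficients outside of `S`
vanish. -/
def hardy (S : Set (Fin r → ℤ)) : Submodule ℂ (periodicFun r →ₗ[ℂ] ℂ) where
  carrier := {v | v ∈ distT r ∧ ∀ ν ∉ S, v (character ν) = 0}
  add_mem' ha hb := ⟨(distT r).add_mem ha.1 hb.1, fun ν hν => by simp [ha.2 ν hν, hb.2 ν hν]⟩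
  zero_mem' := ⟨(distT r).zero_mem, fun _ _ => rfl⟩
  smul_mem' c a ha := ⟨(distT r).smul_mem c ha.1, fun ν hν => by simp [ha.2 ν hν]⟩

end DistT

/-! ### Maximal tori, roots, weights and the classical r-matrix -/

section Structure

variable (E G : Type*) [NormedAddCommGroup E] [NormedSpace ℝ E]
  [TopologicalSpace G] [ChartedSpace E G] [Group G] [LieGroup 𝓘(ℝ, E) ∞ G]

/-- `G` is (isomorphic to) a product of a simply connected group `K` and a torus. -/
def IsSimplyConnectedTimesTorus (G : Type*) [TopologicalSpace G] [Group G] : Prop :=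
  ∃ (K : Subgroup G) (d : ℕ), SimplyConnectedSpace K ∧ Nonempty (G ≃ₜ* K × (Fin d → Circle))

/-- Invariant inner products on the Lie algebra of `G`. -/
structure InvariantInnerProduct where
  form : LinearMap.BilinForm ℝ (Lie E G)
  symm : ∀ x y, form x y = form y x
  pos : ∀ x, x ≠ 0 → 0 < form x x
  invariant : ∀ (g : G) (x y : Lie E G), form (Ad E g x) (Ad E g y) = form x y

/-- A maximal torus `T` of `G`, of dimension `rank`. It is presented as the image of a smooth
homomorphism `par` from `ℝ^rank` to `G` with kernel `ℤ^rank` (the composition of the exponential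
map of `T` with an isomorphism `(ℝ^rank, ℤ^rank) ≅ (𝔱, Λ)`, where `Λ` is the integral lattice), so
that `T ≅ ℝ^rank / ℤ^rank`; and it is maximal among closed connected abelian subgroups. -/
structure MaximalTorus where
  rank : ℕ
  par : (Fin rank → ℝ) → G
  smooth : ContMDiff 𝓘(ℝ, Fin rank → ℝ) 𝓘(ℝ, E) ∞ par
  map_add : ∀ x y, par (x + y) = par x * par y
  kernel : ∀ x, par x = 1 ↔ ∃ n : Fin rank → ℤ, x = toReal n
  maximal : ∀ H : Subgroup G, IsClosed (H : Set G) → IsConnected (H : Set G) →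
    (∀ a ∈ H, ∀ b ∈ H, a * b = b * a) → Set.range par ⊆ H → (H : Set G) ⊆ Set.range par

variable {E G}

/-- The derivative at `0` of `ℝ^rank → T ⊆ G`. -/
def MaximalTorus.dpar (T : MaximalTorus E G) : (Fin T.rank → ℝ) →ₗ[ℝ] Lie E G :=
  (mfderiv 𝓘(ℝ, Fin T.rank → ℝ) 𝓘(ℝ, E) T.par 0 : (Fin T.rank → ℝ) →L[ℝ] E).toLinearMap

/-- The Lie algebra `𝔱 ⊆ 𝔤` of `T`. -/
def MaximalTorus.lie (T : MaximalTorus E G) : Submodule ℝ (Lie E G) := LinearMap.range T.dpar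

/-- `e ∈ 𝔤_ℂ` lies in the `α`-weight space: `Ad_t e = t^α e` for `t ∈ T`. -/
def MaximalTorus.IsWeightVector (T : MaximalTorus E G) (α : Fin T.rank → ℤ)
    (e : ℂ ⊗[ℝ] Lie E G) : Prop :=
  ∀ x, (Ad E (T.par x)).baseChange ℂ e = (character α).1 x • e

/-- The set of roots. -/
def MaximalTorus.roots (T : MaximalTorus E G) : Set (Fin T.rank → ℤ) :=
  {α | α ≠ 0 ∧ ∃ e, e ≠ 0 ∧ T.IsWeightVector α e}

/-- `ξ₀` lies in the interior of a Weyl chamber. -/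
def MaximalTorus.IsRegular (T : MaximalTorus E G) (ξ₀ : Fin T.rank → ℝ) : Prop :=
  ∀ α ∈ T.roots, dot (toReal α) ξ₀ ≠ 0

/-- The positive roots with respect to the Weyl chamber containing the regular element `ξ₀`. -/
def MaximalTorus.posRoots (T : MaximalTorus E G) (ξ₀ : Fin T.rank → ℝ) :
    Set (Fin T.rank → ℤ) :=
  {α | α ∈ T.roots ∧ 0 < dot (toReal α) ξ₀}

/-- The half-sum `ρ` of positive roots. -/
def MaximalTorus.rho (T : MaximalTorus E G) (ξ₀ : Fin T.rank → ℝ) : Fin T.rank → ℝ :=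
  (1 / 2 : ℝ) • ∑ᶠ α ∈ T.posRoots ξ₀, toReal α

/-- `Λ^*_+`: the weight `λ` is dominant, that is, its inner product with every positive root `α` is
non-negative. Here `h` is the element of `𝔱` corresponding to `α` under the identification
`𝔱 ≅ 𝔱^*` given by the inner product. -/
def MaximalTorus.IsDominant (T : MaximalTorus E G) (B : InvariantInnerProduct E G)
    (ξ₀ : Fin T.rank → ℝ) (μ : Fin T.rank → ℤ) : Prop :=
  ∀ α ∈ T.posRoots ξ₀, ∀ h : Fin T.rank → ℝ,
    (∀ y, B.form (T.dpar h) (T.dpar y) = dot (toReal α) y) → 0 ≤ dot (toReal μ) h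

/-- The set `ρ + Λ^*_+` of weights. -/
def MaximalTorus.hardySpectrum (T : MaximalTorus E G) (B : InvariantInnerProduct E G)
    (ξ₀ : Fin T.rank → ℝ) : Set (Fin T.rank → ℤ) :=
  {ν | ∃ μ, T.IsDominant B ξ₀ μ ∧ toReal ν = T.rho ξ₀ + toReal μ}

/-- `𝓔'(T)^-`, the negative Hardy space. -/
abbrev MaximalTorus.distMinus (T : MaximalTorus E G) (B : InvariantInnerProduct E G)
    (ξ₀ : Fin T.rank → ℝ) : Submodule ℂ (periodicFun T.rank →ₗ[ℂ] ℂ) :=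
  hardy (T.hardySpectrum B ξ₀)

/-- The infinitesimal action on a vector `v` of the complexified Lie algebra, for a finite
dimensional representation `π` of `G`. -/
def infAction {n : ℕ} (π : Representation ℂ G (EuclideanSpace ℂ (Fin n)))
    (v : EuclideanSpace ℂ (Fin n)) : (ℂ ⊗[ℝ] Lie E G) →ₗ[ℂ] EuclideanSpace ℂ (Fin n) :=
  let d : E →L[ℝ] EuclideanSpace ℂ (Fin n) :=
    mfderiv 𝓘(ℝ, E) 𝓘(ℝ, EuclideanSpace ℂ (Fin n)) (fun g : G => π g v) 1
  let d' : Lie E G →ₗ[ℝ] EuclideanSpace ℂ (Fin n) := d.toLinearMap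
  d'.liftBaseChange ℂ

/-- `Δ(g) = (v, g · v)`, where `v` is a highest weight vector of unit length in the (unitary)
irreducible representation of `G` of highest weight `μ`. -/
def MaximalTorus.IsSpherical (T : MaximalTorus E G) (ξ₀ : Fin T.rank → ℝ)
    (μ : Fin T.rank → ℤ) (Δ : smoothFun E G) : Prop :=
  ∃ (n : ℕ) (π : Representation ℂ G (EuclideanSpace ℂ (Fin n))) (v : EuclideanSpace ℂ (Fin n)),
    π.IsIrreducible ∧
    (∀ w, ContMDiff 𝓘(ℝ, E) 𝓘(ℝ, EuclideanSpace ℂ (Fin n)) ∞ fun g => π g w) ∧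
    (∀ g w w', inner ℂ (π g w) (π g w') = inner ℂ w w') ∧
    ‖v‖ = 1 ∧
    (∀ α ∈ T.posRoots ξ₀, ∀ e, T.IsWeightVector α e → infAction π v e = 0) ∧
    (∀ x, π (T.par x) v = (character μ).1 x • v) ∧
    ∀ g, Δ.1 g = inner ℂ v (π g v)

open Classical in
/-- The function `Δ_μ ∈ C^∞(G)`, for `μ` a dominant weight. -/
def MaximalTorus.spherical (T : MaximalTorus E G) (ξ₀ : Fin T.rank → ℝ)
    (μ : Fin T.rank → ℤ) : smoothFun E G :=
  if h : ∃ Δ, T.IsSpherical ξ₀ μ Δ then h.choose else 0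

/-- The defining property of `r_G^T : 𝓔'(G) → 𝓔'(T)^-`, namely
`⟨r_G^T(u), t^(μ + ρ)⟩ = ⟨u, Δ_μ⟩` for all dominant weights `μ`. (Distributions on `T` are
determined by their Fourier coefficients, and those of elements of `𝓔'(T)^-` vanish outside of
`ρ + Λ^*_+`, so that this determines `r_G^T`.) -/
def MaximalTorus.IsRestrictionMap (T : MaximalTorus E G) (B : InvariantInnerProduct E G)
    (ξ₀ : Fin T.rank → ℝ) (rGT : distG E G →ₗ[ℂ] T.distMinus B ξ₀) : Prop :=
  ∀ (u : distG E G) (μ ν : Fin T.rank → ℤ), T.IsDominant B ξ₀ μ →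
    toReal ν = toReal μ + T.rho ξ₀ → (rGT u).1 (character ν) = u.1 (T.spherical ξ₀ μ)

/-- `e_α ∈ 𝔤_ℂ`, for positive roots `α`, are root vectors, normalized by `e_α · e_{-α} = 1` where
`e_{-α}` is the complex conjugate of `e_α`. -/
def MaximalTorus.IsRootBasis (T : MaximalTorus E G) (B : InvariantInnerProduct E G)
    (ξ₀ : Fin T.rank → ℝ) (e : (Fin T.rank → ℤ) → ℂ ⊗[ℝ] Lie E G) : Prop :=
  ∀ α ∈ T.posRoots ξ₀, T.IsWeightVector α (e α) ∧
    LinearMap.BilinForm.baseChange ℂ B.form (e α) (conjC _ (e α)) = 1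

/-- The classical r-matrix `r = ∑ e_α ∧ e_{-α} = ½ ∑ (e_α ⊗ e_{-α} - e_{-α} ⊗ e_α)`, where the
sums are over positive roots. -/
def MaximalTorus.rMatrix (T : MaximalTorus E G) (ξ₀ : Fin T.rank → ℝ)
    (e : (Fin T.rank → ℤ) → ℂ ⊗[ℝ] Lie E G) : (ℂ ⊗[ℝ] Lie E G) ⊗[ℂ] (ℂ ⊗[ℝ] Lie E G) :=
  (1 / 2 : ℂ) • ∑ᶠ α ∈ T.posRoots ξ₀,
    (e α ⊗ₜ[ℂ] conjC _ (e α) - conjC _ (e α) ⊗ₜ[ℂ] e α)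

end Structure

/-! ### Clifford algebras -/

section Clifford

variable {V : Type*} [AddCommGroup V] [Module ℝ V]

/-- The quadratic form `ξ ↦ ½ ξ · ξ`. The corresponding Clifford algebra has the relations
`2 ξ ξ = ξ · ξ`. -/
def halfForm (B : LinearMap.BilinForm ℝ V) : QuadraticForm ℝ V :=
  (1 / 2 : ℝ) • LinearMap.BilinMap.toQuadraticMap B

/-- The complexified Clifford algebra `Cl(V)_ℂ`. -/
abbrev ClC (B : LinearMap.BilinForm ℝ V) : Type _ := ℂ ⊗[ℝ] CliffordAlgebra (halfForm B)

/-- The contractions `ι_ξ = ad(x_ξ)` on `Cl(V)_ℂ`, where `ad` is the super-commutator: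
`ad(x) y = x y - (-1)^|y| y x`. -/
def clIota (B : LinearMap.BilinForm ℝ V) : V →ₗ[ℝ] Module.End ℂ (ClC B) where
  toFun ξ := (LinearMap.mulLeft ℝ (CliffordAlgebra.ι (halfForm B) ξ) -
    LinearMap.mulRight ℝ (CliffordAlgebra.ι (halfForm B) ξ) ∘ₗ
      CliffordAlgebra.involute.toLinearMap).baseChange ℂ
  map_add' x y := by
    ext a
    simp [add_mul, mul_add, TensorProduct.tmul_add]
    abel
  map_smul' c x := by
    ext a
    simp [smul_sub]

/-- The parity operator `(-1)^|y|` on `Cl(V)_ℂ`. -/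
def clParity (B : LinearMap.BilinForm ℝ V) : Module.End ℂ (ClC B) :=
  CliffordAlgebra.involute.toLinearMap.baseChange ℂ

/-- The symbol map `Cl(V) ≅ ⋀ V`. -/
def symbol (B : LinearMap.BilinForm ℝ V) :
    CliffordAlgebra (halfForm B) ≃ₗ[ℝ] ExteriorAlgebra ℝ V :=
  CliffordAlgebra.equivExterior (halfForm B)

/-- The horizontal projection `Cl(V)_ℂ → ℂ`: the degree zero component of the symbol. -/
def clHor (B : LinearMap.BilinForm ℝ V) : ClC B →ₗ[ℂ] ℂ :=
  (Algebra.linearMap ℝ ℂ ∘ₗ ExteriorAlgebra.algebraMapInv.toLinearMap ∘ₗ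
    (symbol B).toLinearMap).liftBaseChange ℂ

end Clifford

/-! ### Weil models, Cartan models and the restriction map -/

section Models

variable (E G F M : Type*) [NormedAddCommGroup E] [NormedSpace ℝ E] [NormedAddCommGroup F]
  [NormedSpace ℝ F] [TopologicalSpace G] [ChartedSpace E G] [Group G] [LieGroup 𝓘(ℝ, E) ∞ G]
  [TopologicalSpace M] [ChartedSpace F M] [IsManifold 𝓘(ℝ, F) ∞ M]
  [MulAction G M] [ContMDiffSMul 𝓘(ℝ, E) 𝓘(ℝ, F) ∞ G M]

variable {E G} in
/-- The adjoint action on `Cl(𝔤)_ℂ`. -/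
def clAd (B : InvariantInnerProduct E G) (g : G) : Module.End ℂ (ClC B.form) :=
  (CliffordAlgebra.map
    { Ad E g with
      map_app' := fun x => by
        simp only [halfForm, smul_apply, LinearMap.BilinMap.toQuadraticMap_apply]
        exact congrArg _ (B.invariant g x x) :
      (halfForm B.form) →qᵢ (halfForm B.form) }).toLinearMap.baseChange ℂ

variable {E G} in
/-- `𝔤 = 𝔱 ⊕ 𝔱^⊥`. -/
theorem isCompl_lie [FiniteDimensional ℝ E] (B : InvariantInnerProduct E G)
    (T : MaximalTorus E G) : IsCompl T.lie (B.form.orthogonal T.lie) := by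
  have : FiniteDimensional ℝ (Lie E G) := inferInstanceAs (FiniteDimensional ℝ E)
  have hs : B.form.IsRefl := fun x y h => by rw [B.symm, h]
  refine (LinearMap.BilinForm.isCompl_orthogonal_iff_disjoint hs).2 ?_
  refine Submodule.disjoint_def.2 fun x hx hx' => ?_
  by_contra h0
  exact (B.pos x h0).ne' (hx' x hx)

variable {E G} in
/-- The orthogonal projection `p_G^T : Cl(𝔤)_ℂ → Cl(𝔱)_ℂ` defined by the decomposition
`Cl(𝔤) = Cl(𝔱) ⊗ Cl(𝔱^⊥)`. Under the symbol maps, it is the map `⋀ 𝔤 → ⋀ 𝔱` induced by the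
orthogonal projection `𝔤 → 𝔱`. -/
def clProj [FiniteDimensional ℝ E] (B : InvariantInnerProduct E G) (T : MaximalTorus E G) :
    ClC B.form →ₗ[ℂ] ClC (B.form.restrict T.lie) :=
  ((symbol (B.form.restrict T.lie)).symm.toLinearMap ∘ₗ
    (ExteriorAlgebra.map (T.lie.projectionOnto _ (isCompl_lie B T))).toLinearMap ∘ₗ
      (symbol B.form).toLinearMap).baseChange ℂ

variable {E G} in
/-- The twist `𝒯 = exp (½ r_ab ι_a ι_b)` on `Cl(𝔤)_ℂ`. -/
def clTwist (B : InvariantInnerProduct E G)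
    (r : (ℂ ⊗[ℝ] Lie E G) ⊗[ℂ] (ℂ ⊗[ℝ] Lie E G)) : Module.End ℂ (ClC B.form) :=
  nilExp ((1 / 2 : ℂ) • quadOp (clIota B.form) r)

/-- The Weil model tensor product `(D ⊗ Cl(V)_ℂ) ⊗ Ω(M)`, where `D` is a space of distributions. -/
abbrev WeilForms {V : Type*} [AddCommGroup V] [Module ℝ V] (B : LinearMap.BilinForm ℝ V)
    {𝒟 : Type*} [AddCommGroup 𝒟] [Module ℂ 𝒟] (D : Submodule ℂ (𝒟 →ₗ[ℂ] ℂ)) : Type _ :=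
  ClC B ⊗[ℂ] distForms F M D

/-- The map `P_hor ⊗ 1` from the Weil model to the Cartan model. -/
def pHor {V : Type*} [AddCommGroup V] [Module ℝ V] (B : LinearMap.BilinForm ℝ V)
    {𝒟 : Type*} [AddCommGroup 𝒟] [Module ℂ 𝒟] (D : Submodule ℂ (𝒟 →ₗ[ℂ] ℂ)) :
    WeilForms F M B D →ₗ[ℂ] distForms F M D :=
  (TensorProduct.lid ℂ (distForms F M D)).toLinearMap ∘ₗ LinearMap.rTensor (distForms F M D) (clHor B)

/-- The contraction `ι_ξ ⊗ 1 + 1 ⊗ ι_ξ'` on the (`ℤ₂`-graded) tensor product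
`(D ⊗ Cl(V)_ℂ) ⊗ Ω(M)`, where `ξ ∈ V` and `ξ' ∈ 𝔤`. -/
def weilIota {V : Type*} [AddCommGroup V] [Module ℝ V] (B : LinearMap.BilinForm ℝ V)
    {𝒟 : Type*} [AddCommGroup 𝒟] [Module ℂ 𝒟] (D : Submodule ℂ (𝒟 →ₗ[ℂ] ℂ))
    (ξ : V) (ξ' : Lie E G) : Module.End ℂ (WeilForms F M B D) :=
  TensorProduct.map (clIota B ξ) LinearMap.id +
    TensorProduct.map (clParity B) (postComp D (iota E G F M ξ') (fibrewise_iota E G F M ξ'))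

variable {E G}

/-- The basic subspace of `Ŵ_G ⊗ Ω(M)`, where `Ŵ_G = 𝓔'(G) ⊗ Cl(𝔤)_ℂ`: the horizontal and
`G`-invariant elements. -/
def weilBasicG (B : InvariantInnerProduct E G) :
    Submodule ℂ (WeilForms F M B.form (distG E G)) :=
  (⨅ ξ : Lie E G, LinearMap.ker (weilIota E G F M B.form (distG E G) ξ ξ)) ⊓
  ⨅ g : G, LinearMap.eqLocus (TensorProduct.map (clAd B g) (actDistForms E F M g)) LinearMap.id

/-- The Cartan model `Ĉ_G(M) = (𝓔'(G) ⊗ Ω(M))^G`. -/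
def cartanG (E G : Type*) [NormedAddCommGroup E] [NormedSpace ℝ E] [TopologicalSpace G]
    [ChartedSpace E G] [Group G] [LieGroup 𝓘(ℝ, E) ∞ G] [MulAction G M]
    [ContMDiffSMul 𝓘(ℝ, E) 𝓘(ℝ, F) ∞ G M] : Submodule ℂ (distForms F M (distG E G)) :=
  ⨅ g : G, LinearMap.eqLocus (actDistForms E F M g) LinearMap.id

/-- The action of `x ∈ ℝ^rank` (that is, of the element `t = T.par x` of `T`) on
`𝓔'(T)^- ⊗ Ω(M)`. Since `T` is abelian, `T` acts trivially on `𝓔'(T)^-`. -/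
def actHardyForms (T : MaximalTorus E G) (B : InvariantInnerProduct E G) (ξ₀ : Fin T.rank → ℝ)
    (x : Fin T.rank → ℝ) : Module.End ℂ (distForms F M (T.distMinus B ξ₀)) :=
  { toFun := fun u => ⟨pull E F (T.par x)⁻¹ ∘ₗ u.1, by
      intro m ℓ
      obtain ⟨e, he⟩ := pull_evalAt E G F M (T.par x)⁻¹ m
      have h := u.2 ((T.par x)⁻¹ • m) (ℓ ∘ₗ e)
      convert h using 1
      ext φ
      simp [he]⟩
    map_add' := fun a b => by ext1; simp [LinearMap.comp_add]
    map_smul' := fun c a => by ext1; simp [LinearMap.comp_smul] }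

/-- The basic subspace of `Ŵ_T^- ⊗ Ω(M)`, where `Ŵ_T^- = 𝓔'(T)^- ⊗ Cl(𝔱)_ℂ`: the horizontal and
`T`-invariant elements. Since `T` is abelian, `T` acts trivially on `Cl(𝔱)_ℂ`. -/
def weilBasicT (T : MaximalTorus E G) (B : InvariantInnerProduct E G) (ξ₀ : Fin T.rank → ℝ) :
    Submodule ℂ (WeilForms F M (B.form.restrict T.lie) (T.distMinus B ξ₀)) :=
  (⨅ ξ : T.lie, LinearMap.ker
    (weilIota E G F M (B.form.restrict T.lie) (T.distMinus B ξ₀) ξ (ξ : Lie E G))) ⊓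
  ⨅ x : Fin T.rank → ℝ,
    LinearMap.eqLocus (TensorProduct.map LinearMap.id (actHardyForms F M T B ξ₀ x)) LinearMap.id

/-- The Cartan model `Ĉ_T^-(M) = 𝓔'(T)^- ⊗ Ω(M)^T`. -/
def cartanT (T : MaximalTorus E G) (B : InvariantInnerProduct E G) (ξ₀ : Fin T.rank → ℝ) :
    Submodule ℂ (distForms F M (T.distMinus B ξ₀)) :=
  ⨅ x : Fin T.rank → ℝ, LinearMap.eqLocus (actHardyForms F M T B ξ₀ x) LinearMap.id

end Models

end

end WeilCartan

open WeilCartan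

/-! The algebraic half trades operators on the Clifford factor for operators on forms. On a
horizontal element `w` the contraction ι_ξ of Cl(𝔤) acts as minus parity times ι(ξ_M). Two such
exchanges produce cancelling signs, so ι_ξ ι_η ⊗ 1 and 1 ⊗ ι_ξ ι_η agree on `w`
(`quadOp_horizontal`), and so do the exponentials (`nilExp_horizontal`). Hence the twist exp(½ r_ab
ι_a ι_b) on Cl(𝔤) turns into exp(½ ι(r_M)) on forms. The remaining projection to Cl(𝔱) commutes with
parity and with contractions by 𝔱, and it keeps the degree zero part of the symbol
(`map_twist_basicTensor`). Invariance under T survives because r is T-invariant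
(`rMatrix_invariant`).

The horizontal projections are isomorphisms because contractions and exterior multiplications
satisfy the canonical anticommutation relations: the joint kernel of the contractions is a
complement of the span of the exterior products, and modulo that span only the degree zero part is
left (`horTensor_bijective`).

The analytic half is the existence of r_G^T. It is the transpose of Ψ(φ) = ∑ φ̂(ν) Δ_{ν-ρ}
(`exists_testMap`), so that r_G^T ⊗ 1 on form-valued distributions is simply precomposition with Ψ.
Fourier coefficients of smooth functions decay rapidly, so convergence in C^∞(G) follows once every
derivative of Δ_μ grows at most polynomially in μ. These derivatives are matrix coefficients of
products of operators dπ(ξ). By Schur's lemma the Casimir operator is a scalar, so dπ(ξ) is bounded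
by the values of dπ on the highest weight vector v alone (`sum_norm_infRep_sq`). There, positive
root vectors act by zero, 𝔱 acts through μ, and a negative root vector x satisfies ‖x v‖² = -⟨v,
[x̄, x] v⟩ with [x̄, x] ∈ 𝔱_ℂ; every case is linear in μ (`MaximalTorus.IsRegular.hasLinearGrowth`).
The structure theory behind this is proved directly: 𝔱 is its own centralizer
(`MaximalTorus.mem_lie_of_fixed`), and 𝔤_ℂ is spanned by weight vectors
(`MaximalTorus.span_weightVectors`). -/

namespace WeilCartan

noncomputable section

set_option linter.unusedSectionVars false

/-! ### Exponentials of nilpotent operators -/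

section NilExp

variable {V W : Type*} [AddCommGroup V] [Module ℂ V] [AddCommGroup W] [Module ℂ W]

/-- Powers beyond the nilpotency class vanish, so any later cutoff gives the same sum. Two
exponentials can thus be compared with a common number of terms. -/
theorem nilExp_eq_sum {N : Module.End ℂ V} {m : ℕ} (h : N ^ m = 0) :
    nilExp N = ∑ i ∈ Finset.range m, ((i.factorial : ℂ)⁻¹) • N ^ i := by
  have hle : nilpotencyClass N ≤ m := Nat.sInf_le h
  refine Finset.sum_subset (Finset.range_mono hle) fun i _ hi => ?_
  have h1 : nilpotencyClass N ≤ i := by simpa using hi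
  rw [pow_eq_zero_of_le h1 (pow_nilpotencyClass ⟨m, h⟩), smul_zero]

/-- If `N x` and `N' (S x)` correspond under `S`, so do the exponentials. -/
theorem nilExp_intertwine {N : Module.End ℂ V} {N' : Module.End ℂ W} (hN : IsNilpotent N)
    (hN' : IsNilpotent N') (S : V →ₗ[ℂ] W) (h : S ∘ₗ N = N' ∘ₗ S) :
    S ∘ₗ nilExp N = nilExp N' ∘ₗ S := by
  obtain ⟨m, hm⟩ := hN
  obtain ⟨m', hm'⟩ := hN'
  rw [nilExp_eq_sum (pow_eq_zero_of_le (le_max_left m m') hm),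
    nilExp_eq_sum (pow_eq_zero_of_le (le_max_right m m') hm')]
  have hp : ∀ i x, S ((N ^ i) x) = (N' ^ i) (S x) := by
    intro i
    induction i with
    | zero => intro x; rfl
    | succ n ih =>
      intro x
      rw [pow_succ, pow_succ, Module.End.mul_apply, Module.End.mul_apply, ih]
      exact congrArg _ (LinearMap.congr_fun h x)
  ext x
  simp [hp]

end NilExp

/-! ### Quadratic expressions in a linear family of operators -/

section QuadOp

/-- Real linear families of operators on a complex vector space. -/
abbrev OpFamily (𝔞 V : Type*) [AddCommGroup 𝔞] [Module ℝ 𝔞] [AddCommGroup V] [Module ℂ V] : Type _ :=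
  𝔞 →ₗ[ℝ] Module.End ℂ V

variable {𝔞 𝔟 V W : Type*} [AddCommGroup 𝔞] [Module ℝ 𝔞] [AddCommGroup 𝔟] [Module ℝ 𝔟]
  [AddCommGroup V] [Module ℂ V] [AddCommGroup W] [Module ℂ W]

theorem quadOp_tmul (J : 𝔞 →ₗ[ℝ] Module.End ℂ V) (c d : ℂ) (x y : 𝔞) :
    quadOp J ((c ⊗ₜ[ℝ] x) ⊗ₜ[ℂ] (d ⊗ₜ[ℝ] y)) = (c * d) • (J x * J y) := by
  simp [quadOp, smul_smul, mul_comm]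

/-- A property of `𝔞_ℂ ⊗ 𝔞_ℂ` which is additive and holds for pure tensors holds everywhere. -/
theorem tensor_sq_induction {p : ((ℂ ⊗[ℝ] 𝔞) ⊗[ℂ] (ℂ ⊗[ℝ] 𝔞)) → Prop} (h0 : p 0)
    (ht : ∀ (c d : ℂ) (x y : 𝔞), p ((c ⊗ₜ[ℝ] x) ⊗ₜ[ℂ] (d ⊗ₜ[ℝ] y)))
    (ha : ∀ a b, p a → p b → p (a + b)) (r) : p r := by
  induction r using TensorProduct.induction_on with
  | zero => exact h0
  | add x y hx hy => exact ha _ _ hx hy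
  | tmul x y =>
    induction x using TensorProduct.induction_on with
    | zero => simpa using h0
    | add x x' hx hx' => rw [TensorProduct.add_tmul]; exact ha _ _ hx hx'
    | tmul c x =>
      induction y using TensorProduct.induction_on with
      | zero => simpa using h0
      | add y y' hy hy' => rw [TensorProduct.tmul_add]; exact ha _ _ hy hy'
      | tmul d y => exact ht c d x y

/-- Used with `f = Ad g` for the adjoint action, and with `f = id` for maps compatible with each
single operator. -/
theorem quadOp_intertwine {J : 𝔞 →ₗ[ℝ] Module.End ℂ V} {J' : 𝔟 →ₗ[ℝ] Module.End ℂ W}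
    (f : 𝔞 →ₗ[ℝ] 𝔟) (S : V →ₗ[ℂ] W) (h : ∀ x v, S (J x v) = J' (f x) (S v)) (r) :
    S ∘ₗ quadOp J r =
      quadOp J' (TensorProduct.map (f.baseChange ℂ) (f.baseChange ℂ) r) ∘ₗ S := by
  induction r using tensor_sq_induction with
  | h0 => simp
  | ht c d x y =>
    ext v
    simp [quadOp_tmul, h]
  | ha a b ha hb => rw [map_add, map_add, map_add, LinearMap.comp_add, LinearMap.add_comp, ha, hb]

/-- The two signs cancel; this is why an operator anticommuting with the family commutes with
quadratic expressions in it. -/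
theorem quadOp_neg (J : 𝔞 →ₗ[ℝ] Module.End ℂ V) (r) : quadOp (-J) r = quadOp J r := by
  induction r using tensor_sq_induction with
  | h0 => simp
  | ht c d x y => simp [quadOp_tmul]
  | ha a b ha hb => rw [map_add, map_add, ha, hb]

theorem tensor_map_id (r : (ℂ ⊗[ℝ] 𝔞) ⊗[ℂ] (ℂ ⊗[ℝ] 𝔞)) :
    TensorProduct.map ((LinearMap.id : 𝔞 →ₗ[ℝ] 𝔞).baseChange ℂ)
      ((LinearMap.id : 𝔞 →ₗ[ℝ] 𝔞).baseChange ℂ) r = r := by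
  rw [LinearMap.baseChange_id, TensorProduct.map_id]; rfl

/-- An operator which anticommutes with all `J x` commutes with `quadOp J r`. -/
theorem quadOp_anticomm {J : 𝔞 →ₗ[ℝ] Module.End ℂ V} {J' : 𝔞 →ₗ[ℝ] Module.End ℂ W}
    (S : V →ₗ[ℂ] W) (h : ∀ x v, S (J x v) = -J' x (S v)) (r) :
    S ∘ₗ quadOp J r = quadOp J' r ∘ₗ S := by
  have := quadOp_intertwine (J := J) (J' := -J') LinearMap.id S (by simpa using h) r
  rwa [quadOp_neg, tensor_map_id] at this

/-- Polarization of the square. -/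
theorem anticomm_of_sq_zero {J : 𝔞 →ₗ[ℝ] Module.End ℂ V} (hJ : ∀ x v, J x (J x v) = 0) (x y v) :
    J x (J y v) = -J y (J x v) := by
  have h := hJ (x + y) v
  simp only [map_add, LinearMap.add_apply, hJ, zero_add, add_zero] at h
  exact eq_neg_of_add_eq_zero_right h

/-- A square-zero family extends to the exterior algebra of 𝔞, so a product of more than dim 𝔞 of
its operators is the image of a wedge of linearly dependent vectors, which is zero. -/
theorem isNilpotent_quadOp [FiniteDimensional ℝ 𝔞] (J : 𝔞 →ₗ[ℝ] Module.End ℂ V)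
    (hJ : ∀ x v, J x (J x v) = 0) (r) : IsNilpotent (quadOp J r) := by
  let S : Submodule ℂ (Module.End ℂ V) := Submodule.span ℂ (Set.range J)
  have h2 : quadOp J r ∈ S ^ 2 := by
    induction r using tensor_sq_induction with
    | h0 => simp
    | ht c d x y =>
      rw [quadOp_tmul, pow_two]
      exact Submodule.smul_mem _ _ (Submodule.mul_mem_mul (Submodule.subset_span ⟨x, rfl⟩)
        (Submodule.subset_span ⟨y, rfl⟩))
    | ha a b ha hb => rw [map_add]; exact Submodule.add_mem _ ha hb
  let n := Module.finrank ℝ 𝔞 + 1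
  let L : ExteriorAlgebra ℝ 𝔞 →ₐ[ℝ] Module.End ℂ V :=
    ExteriorAlgebra.lift ℝ ⟨J, fun x => by ext v; exact hJ x v⟩
  have h0 : S ^ n = ⊥ := by
    rw [Submodule.span_pow, Submodule.span_eq_bot]
    intro a ha
    obtain ⟨f, rfl⟩ := Set.mem_pow.1 ha
    choose g hg using fun i => (f i).2
    have h1 : (List.ofFn fun i => (f i : Module.End ℂ V)).prod =
        L (ExteriorAlgebra.ιMulti ℝ n g) := by
      rw [ExteriorAlgebra.ιMulti_apply, map_list_prod, List.map_ofFn]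
      congr 2
      funext i
      simp [L, hg]
    rw [h1, AlternatingMap.map_linearDependent, map_zero]
    intro hli
    have := hli.fintype_card_le_finrank
    simp [n] at this
  refine ⟨n, ?_⟩
  -- The n-th power lies in S^(2n) = (S^n)^2, and S^n is already zero.
  have h3 : quadOp J r ^ n ∈ (S ^ 2) ^ n := Submodule.pow_mem_pow _ h2 n
  rw [← pow_mul, mul_comm, pow_mul, h0] at h3
  have h4 : (⊥ : Submodule ℂ (Module.End ℂ V)) ^ 2 = ⊥ := by rw [pow_two]; simp
  rw [h4] at h3
  exact (Submodule.mem_bot ℂ).1 h3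

theorem nilExp_quadOp_intertwine [FiniteDimensional ℝ 𝔞] {J : OpFamily 𝔞 V} {J' : OpFamily 𝔞 W}
    (hJ : ∀ x v, J x (J x v) = 0) (hJ' : ∀ x v, J' x (J' x v) = 0) (S : V →ₗ[ℂ] W)
    (h : ∀ x v, S (J x v) = J' x (S v)) (r) (v : V) :
    S (nilExp ((1 / 2 : ℂ) • quadOp J r) v) = nilExp ((1 / 2 : ℂ) • quadOp J' r) (S v) := by
  have h1 := quadOp_intertwine (J := J) (J' := J') LinearMap.id S h r
  rw [tensor_map_id] at h1
  exact LinearMap.congr_fun (nilExp_intertwine ((isNilpotent_quadOp J hJ r).smul _)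
    ((isNilpotent_quadOp J' hJ' r).smul _) S (by rw [LinearMap.comp_smul, LinearMap.smul_comp, h1])) v

end QuadOp

/-! ### Canonical anticommutation relations -/

section CAR

variable {I W : Type*} [Fintype I] [DecidableEq I] [AddCommGroup W] [Module ℂ W]

/-- For operators `i a`, `t a` satisfying the canonical anticommutation relations, there is a
projection onto the joint kernel of the `i a` along the sum of the images of the `t a`. -/
theorem exists_car_projection (i t : I → Module.End ℂ W)
    (hii : ∀ a b w, i a (i b w) = -i b (i a w)) (htt : ∀ a b w, t a (t b w) = -t b (t a w))
    (hit : ∀ a b w, i a (t b w) = (if a = b then w else 0) - t b (i a w)) :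
    ∃ P : Module.End ℂ W, (∀ a w, i a (P w) = 0) ∧ (∀ w, (∀ a, i a w = 0) → P w = w) ∧
      (∀ a w, P (t a w) = 0) ∧
      ∀ w, P w - w ∈ ⨆ a, LinearMap.range (t a) := by
  have hii0 : ∀ a w, i a (i a w) = 0 := fun a w => by
    have := hii a a w
    rwa [eq_neg_iff_add_eq_zero, ← two_smul ℂ, smul_eq_zero_iff_right two_ne_zero] at this
  have htt0 : ∀ a w, t a (t a w) = 0 := fun a w => by
    have := htt a a w
    rwa [eq_neg_iff_add_eq_zero, ← two_smul ℂ, smul_eq_zero_iff_right two_ne_zero] at this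
  -- The indices are treated one at a time. The added clause, that P commutes with the `t a` not yet
  -- treated, keeps the induction going.
  suffices H : ∀ s : Finset I, ∃ P : Module.End ℂ W, (∀ a ∈ s, ∀ w, i a (P w) = 0) ∧
      (∀ w, (∀ a ∈ s, i a w = 0) → P w = w) ∧ (∀ a ∈ s, ∀ w, P (t a w) = 0) ∧
      (∀ a ∉ s, ∀ w, P (t a w) = t a (P w)) ∧
      ∀ w, P w - w ∈ ⨆ a, LinearMap.range (t a) by
    obtain ⟨P, h1, h2, h3, -, h4⟩ := H Finset.univ
    exact ⟨P, fun a => h1 a (Finset.mem_univ _), fun w hw => h2 w fun a _ => hw a,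
      fun a => h3 a (Finset.mem_univ _), h4⟩
  intro s
  induction s using Finset.induction_on with
  | empty => exact ⟨1, by simp, by simp, by simp, by simp, by simp⟩
  | insert a s ha ih =>
    obtain ⟨P, h1, h2, h3, h4, h5⟩ := ih
    -- Since i t + t i = 1 with i² = t² = 0, the product i t is the projection onto the kernel of i
    -- along the range of t.
    refine ⟨i a * t a * P, ?_, ?_, ?_, ?_, ?_⟩
    · intro b hb w
      simp only [Module.End.mul_apply]
      rcases Finset.mem_insert.1 hb with rfl | hb
      · rw [hii0]
      · have hab : b ≠ a := fun h => ha (h ▸ hb)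
        rw [hii, hit, if_neg hab, h1 b hb]
        simp
    · intro w hw
      simp only [Module.End.mul_apply]
      rw [h2 w fun b hb => hw b (Finset.mem_insert_of_mem hb), hit, hw a (Finset.mem_insert_self _ _)]
      simp
    · intro b hb w
      simp only [Module.End.mul_apply]
      by_cases hbs : b ∈ s
      · rw [h3 b hbs]; simp
      · obtain rfl : b = a := (Finset.mem_insert.1 hb).resolve_right hbs
        rw [h4 b hbs, htt0]; simp
    · intro b hb w
      rw [Finset.mem_insert, not_or] at hb
      simp only [Module.End.mul_apply]
      rw [h4 b hb.2, htt a b, map_neg, hit, if_neg (Ne.symm hb.1)]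
      simp
    · intro w
      simp only [Module.End.mul_apply]
      rw [hit, if_pos rfl]
      have e : P w - t a (i a (P w)) - w = (P w - w) - t a (i a (P w)) := by abel
      rw [e]
      exact Submodule.sub_mem _ (h5 w)
        (Submodule.mem_iSup_of_mem a (LinearMap.mem_range_self _ _))

end CAR

/-! ### Contraction and exterior multiplication on the Clifford algebra -/

section CliffordOps

variable {V : Type*} [AddCommGroup V] [Module ℝ V] {B : LinearMap.BilinForm ℝ V}

/-- The contraction operator on the (real) Clifford algebra. -/
def clContract (B : LinearMap.BilinForm ℝ V) (ξ : V) :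
    Module.End ℝ (CliffordAlgebra (halfForm B)) :=
  LinearMap.mulLeft ℝ (CliffordAlgebra.ι (halfForm B) ξ) -
    LinearMap.mulRight ℝ (CliffordAlgebra.ι (halfForm B) ξ) ∘ₗ
      CliffordAlgebra.involute.toLinearMap

theorem clContract_apply (ξ : V) (y : CliffordAlgebra (halfForm B)) :
    clContract B ξ y = CliffordAlgebra.ι (halfForm B) ξ * y -
      CliffordAlgebra.involute y * CliffordAlgebra.ι (halfForm B) ξ := rfl

theorem ι_mul_ι_add (hB : ∀ x y, B x y = B y x) (x y : V) :
    CliffordAlgebra.ι (halfForm B) x * CliffordAlgebra.ι (halfForm B) y +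
      CliffordAlgebra.ι (halfForm B) y * CliffordAlgebra.ι (halfForm B) x =
      algebraMap ℝ _ (B x y) := by
  rw [CliffordAlgebra.ι_mul_ι_add_swap]
  congr 1
  simp only [halfForm, QuadraticMap.polar, smul_apply,
    LinearMap.BilinMap.toQuadraticMap_apply, map_add, LinearMap.add_apply, hB y x, smul_eq_mul]
  ring

/-- The relations 2ξξ = ξ·ξ make the anticommutator of two generators exactly their inner product,
without a factor 2. So the super-commutator with ξ obeys the recursion that characterizes
contraction with the functional `B ξ`. -/
theorem clContract_eq (hB : ∀ x y, B x y = B y x) (ξ : V) (y : CliffordAlgebra (halfForm B)) :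
    clContract B ξ y = CliffordAlgebra.contractLeft (B ξ) y := by
  induction y using CliffordAlgebra.left_induction with
  | algebraMap r =>
    rw [clContract_apply, CliffordAlgebra.contractLeft_algebraMap, AlgHom.commutes,
      Algebra.commutes, sub_self]
  | add x y hx hy => rw [map_add, map_add, hx, hy]
  | ι_mul z a hz =>
    rw [CliffordAlgebra.contractLeft_ι_mul, ← hz, clContract_apply, clContract_apply, map_mul,
      CliffordAlgebra.involute_ι, Algebra.smul_def, ← ι_mul_ι_add hB]
    noncomm_ring

/-- Exterior multiplication, on the (real) Clifford algebra. -/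
def clWedge (B : LinearMap.BilinForm ℝ V) (ξ : V) :
    Module.End ℝ (CliffordAlgebra (halfForm B)) :=
  LinearMap.mulLeft ℝ (CliffordAlgebra.ι (halfForm B) ξ) - (1 / 2 : ℝ) • clContract B ξ

theorem clWedge_apply (ξ : V) (y : CliffordAlgebra (halfForm B)) :
    clWedge B ξ y = CliffordAlgebra.ι (halfForm B) ξ * y - (1 / 2 : ℝ) • clContract B ξ y := rfl

theorem involute_clContract (ξ : V) (y : CliffordAlgebra (halfForm B)) :
    CliffordAlgebra.involute (clContract B ξ y) = -clContract B ξ (CliffordAlgebra.involute y) := by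
  simp only [clContract_apply, map_sub, map_mul, CliffordAlgebra.involute_ι]
  noncomm_ring

theorem involute_clWedge (ξ : V) (y : CliffordAlgebra (halfForm B)) :
    CliffordAlgebra.involute (clWedge B ξ y) = -clWedge B ξ (CliffordAlgebra.involute y) := by
  simp only [clWedge_apply, map_sub, map_mul, CliffordAlgebra.involute_ι, map_smul,
    involute_clContract, smul_neg, neg_mul]
  abel

theorem clContract_sq (hB : ∀ x y, B x y = B y x) (ξ : V) (y : CliffordAlgebra (halfForm B)) :
    clContract B ξ (clContract B ξ y) = 0 := by
  rw [clContract_eq hB, clContract_eq hB, CliffordAlgebra.contractLeft_contractLeft]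

theorem clContract_comm (hB : ∀ x y, B x y = B y x) (ξ η : V)
    (y : CliffordAlgebra (halfForm B)) :
    clContract B ξ (clContract B η y) = -clContract B η (clContract B ξ y) := by
  simp only [clContract_eq hB]
  exact CliffordAlgebra.contractLeft_comm _ _ _

theorem clContract_ι_mul (hB : ∀ x y, B x y = B y x) (ξ η : V)
    (y : CliffordAlgebra (halfForm B)) :
    clContract B ξ (CliffordAlgebra.ι (halfForm B) η * y) =
      B ξ η • y - CliffordAlgebra.ι (halfForm B) η * clContract B ξ y := by
  simp only [clContract_eq hB]
  exact CliffordAlgebra.contractLeft_ι_mul _ _ _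

theorem clContract_clWedge (hB : ∀ x y, B x y = B y x) (ξ η : V)
    (y : CliffordAlgebra (halfForm B)) :
    clContract B ξ (clWedge B η y) = B ξ η • y - clWedge B η (clContract B ξ y) := by
  rw [clWedge_apply, clWedge_apply, map_sub, map_smul, clContract_ι_mul hB, clContract_comm hB ξ η]
  module

/-- Under the symbol map, Clifford multiplication by ξ is exterior multiplication plus half the
contraction. This explains the correction term with factor ½ in `clWedge`. -/
theorem symbol_clWedge (hB : ∀ x y, B x y = B y x) (ξ : V) (y : CliffordAlgebra (halfForm B)) :
    symbol B (clWedge B ξ y) = ExteriorAlgebra.ι ℝ ξ * symbol B y := by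
  have h1 : ∀ z, symbol B (CliffordAlgebra.ι (halfForm B) ξ * z) =
      ExteriorAlgebra.ι ℝ ξ * symbol B z -
        CliffordAlgebra.contractLeft
          (QuadraticMap.associated (R := ℝ) (M := V) (-(halfForm B)) ξ) (symbol B z) :=
    fun z => CliffordAlgebra.changeForm_ι_mul CliffordAlgebra.changeForm.associated_neg_proof ξ z
  have h2 : ∀ d z, symbol B (CliffordAlgebra.contractLeft d z) =
      CliffordAlgebra.contractLeft d (symbol B z) :=
    fun d z => CliffordAlgebra.changeForm_contractLeft CliffordAlgebra.changeForm.associated_neg_proof d z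
  have h3 : QuadraticMap.associated (R := ℝ) (M := V) (-(halfForm B)) ξ = -((1 / 2 : ℝ) • B ξ) := by
    ext η
    simp [QuadraticMap.associated_apply, halfForm, hB η ξ]
    ring
  rw [clWedge_apply, map_sub, map_smul, h1, clContract_eq hB, h2, h3, map_neg, map_smul,
    LinearMap.neg_apply, LinearMap.smul_apply]
  abel

theorem clWedge_comm (hB : ∀ x y, B x y = B y x) (ξ η : V) (y : CliffordAlgebra (halfForm B)) :
    clWedge B ξ (clWedge B η y) = -clWedge B η (clWedge B ξ y) := by
  apply (symbol B).injective
  rw [map_neg, symbol_clWedge hB, symbol_clWedge hB, symbol_clWedge hB, symbol_clWedge hB,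
    ← mul_assoc, ← mul_assoc, eq_neg_iff_add_eq_zero, ← add_mul,
    ExteriorAlgebra.ι_add_mul_swap, zero_mul]

/-- The degree zero part of the symbol, on the (real) Clifford algebra. -/
def clDegZero (B : LinearMap.BilinForm ℝ V) : CliffordAlgebra (halfForm B) →ₗ[ℝ] ℝ :=
  ExteriorAlgebra.algebraMapInv.toLinearMap ∘ₗ (symbol B).toLinearMap

theorem clDegZero_clWedge (hB : ∀ x y, B x y = B y x) (ξ : V)
    (y : CliffordAlgebra (halfForm B)) : clDegZero B (clWedge B ξ y) = 0 := by
  have : clDegZero B (clWedge B ξ y) = ExteriorAlgebra.algebraMapInv (symbol B (clWedge B ξ y)) :=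
    rfl
  rw [this, symbol_clWedge hB, map_mul]
  simp [ExteriorAlgebra.algebraMapInv]

theorem symbol_one : symbol B 1 = 1 :=
  CliffordAlgebra.changeForm_one CliffordAlgebra.changeForm.associated_neg_proof

theorem clDegZero_one : clDegZero B 1 = 1 := by
  change ExteriorAlgebra.algebraMapInv (symbol B 1) = 1
  rw [symbol_one, map_one]

/-- Through the symbol this says that the exterior algebra is the scalars plus the ideal generated
by V; by linearity the basis vectors suffice as left factors. -/
theorem sub_clDegZero_mem (hB : ∀ x y, B x y = B y x) {I : Type*} [Fintype I]
    (b : Module.Basis I ℝ V) (y : CliffordAlgebra (halfForm B)) :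
    y - clDegZero B y • (1 : CliffordAlgebra (halfForm B)) ∈
      ⨆ a, LinearMap.range (clWedge B (b a)) := by
  obtain ⟨x, rfl⟩ := (symbol B).symm.surjective y
  induction x using CliffordAlgebra.left_induction with
  | algebraMap r =>
    have : (symbol B).symm (algebraMap ℝ _ r) = r • 1 := by
      rw [Algebra.algebraMap_eq_smul_one, map_smul, LinearEquiv.symm_apply_eq _ |>.2 symbol_one.symm]
    change (symbol B).symm (algebraMap ℝ _ r) - clDegZero B ((symbol B).symm (algebraMap ℝ _ r)) • 1 ∈ _
    rw [this, map_smul, clDegZero_one]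
    simp
  | add x y hx hy =>
    rw [map_add, map_add, add_smul, add_sub_add_comm]
    exact Submodule.add_mem _ hx hy
  | ι_mul z a hz =>
    have h1 : (symbol B).symm (CliffordAlgebra.ι 0 a * z) = clWedge B a ((symbol B).symm z) := by
      rw [LinearEquiv.symm_apply_eq, symbol_clWedge hB, LinearEquiv.apply_symm_apply]
    rw [h1, clDegZero_clWedge hB, zero_smul, sub_zero, ← b.sum_repr a]
    have h2 : clWedge B (∑ i, b.repr a i • b i) ((symbol B).symm z) =
        ∑ i, clWedge B (b i) (b.repr a i • (symbol B).symm z) := by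
      apply (symbol B).injective
      simp only [symbol_clWedge hB, map_sum, map_smul, Finset.sum_mul, smul_mul_assoc]
    rw [h2]
    exact Submodule.sum_mem _ fun i _ => Submodule.mem_iSup_of_mem i (LinearMap.mem_range_self _ _)

end CliffordOps

/-! ### Horizontal elements of the Weil model -/

section WeilModel

variable {V : Type*} [AddCommGroup V] [Module ℝ V] {B : LinearMap.BilinForm ℝ V}
  {X Y : Type*} [AddCommGroup X] [Module ℂ X] [AddCommGroup Y] [Module ℂ Y]

/-- An identity between complex linear maps on `ℂ ⊗ A` can be checked on real elements. -/
theorem complexify_induction {A : Type*} [AddCommGroup A] [Module ℝ A] {Z : Type*}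
    [AddCommGroup Z] [Module ℂ Z] {f g : (ℂ ⊗[ℝ] A) →ₗ[ℂ] Z}
    (h : ∀ a, f (1 ⊗ₜ a) = g (1 ⊗ₜ a)) : f = g := by
  ext a
  exact h a

theorem clIota_tmul (ξ : V) (c : ℂ) (y : CliffordAlgebra (halfForm B)) :
    clIota B ξ (c ⊗ₜ y) = c ⊗ₜ clContract B ξ y := rfl

theorem clParity_tmul (c : ℂ) (y : CliffordAlgebra (halfForm B)) :
    clParity B (c ⊗ₜ y) = c ⊗ₜ CliffordAlgebra.involute y := rfl

theorem clIota_sq (hB : ∀ x y, B x y = B y x) (ξ : V) (y : ClC B) :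
    clIota B ξ (clIota B ξ y) = 0 := by
  refine LinearMap.congr_fun (f := clIota B ξ ∘ₗ clIota B ξ) (g := 0)
    (complexify_induction fun a => ?_) y
  simp [clIota_tmul, clContract_sq hB]

theorem clIota_comm (hB : ∀ x y, B x y = B y x) (ξ η : V) (y : ClC B) :
    clIota B ξ (clIota B η y) = -clIota B η (clIota B ξ y) :=
  anticomm_of_sq_zero (clIota_sq hB) ξ η y

theorem clParity_clIota (ξ : V) (y : ClC B) :
    clParity B (clIota B ξ y) = -clIota B ξ (clParity B y) := by
  refine LinearMap.congr_fun (f := clParity B ∘ₗ clIota B ξ) (g := -(clIota B ξ ∘ₗ clParity B))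
    (complexify_induction fun a => ?_) y
  simp [clIota_tmul, clParity_tmul, involute_clContract, TensorProduct.tmul_neg]

theorem clParity_clParity (y : ClC B) : clParity B (clParity B y) = y := by
  refine LinearMap.congr_fun (f := clParity B ∘ₗ clParity B) (g := LinearMap.id)
    (complexify_induction fun a => ?_) y
  simp [clParity_tmul]

theorem clHor_tmul (c : ℂ) (y : CliffordAlgebra (halfForm B)) :
    clHor B (c ⊗ₜ y) = c * clDegZero B y := by
  simp [clHor, clDegZero]

variable (B) in
/-- Exterior multiplication on `Cl(V)_ℂ ⊗ X`. -/
def wedgeTensor (X : Type*) [AddCommGroup X] [Module ℂ X] (ξ : V) : Module.End ℂ (ClC B ⊗[ℂ] X) :=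
  TensorProduct.map ((clWedge B ξ).baseChange ℂ) LinearMap.id

/-- The contraction on the graded tensor product `Cl(V)_ℂ ⊗ X`. -/
def iotaTensor (B : LinearMap.BilinForm ℝ V) (J : V →ₗ[ℝ] Module.End ℂ X) (ξ : V) :
    Module.End ℂ (ClC B ⊗[ℂ] X) :=
  TensorProduct.map (clIota B ξ) LinearMap.id + TensorProduct.map (clParity B) (J ξ)

/-- The degree zero component `Cl(V)_ℂ ⊗ X → X`. -/
def horTensor (B : LinearMap.BilinForm ℝ V) (X : Type*) [AddCommGroup X] [Module ℂ X] :
    ClC B ⊗[ℂ] X →ₗ[ℂ] X :=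
  (TensorProduct.lid ℂ X).toLinearMap ∘ₗ LinearMap.rTensor X (clHor B)

theorem iotaTensor_tmul (J : V →ₗ[ℝ] Module.End ℂ X) (ξ : V) (y : ClC B) (x : X) :
    iotaTensor B J ξ (y ⊗ₜ x) = clIota B ξ y ⊗ₜ x + clParity B y ⊗ₜ J ξ x := rfl

theorem horTensor_tmul (y : ClC B) (x : X) : horTensor B X (y ⊗ₜ x) = clHor B y • x := rfl

/-- Parity anticommutes with the Clifford contractions, so the mixed terms cancel in pairs. -/
theorem iotaTensor_comm (hB : ∀ x y, B x y = B y x) {J : V →ₗ[ℝ] Module.End ℂ X}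
    (hJ : ∀ ξ x, J ξ (J ξ x) = 0) (ξ η : V) (w : ClC B ⊗[ℂ] X) :
    iotaTensor B J ξ (iotaTensor B J η w) = -iotaTensor B J η (iotaTensor B J ξ w) := by
  induction w using TensorProduct.induction_on with
  | zero => simp
  | add w w' hw hw' => simp only [map_add, hw, hw', neg_add]
  | tmul y x =>
    simp only [iotaTensor_tmul, map_add, clParity_clIota, clParity_clParity, clIota_comm hB ξ η,
      anticomm_of_sq_zero hJ ξ η, TensorProduct.neg_tmul, TensorProduct.tmul_neg]
    abel

theorem wedgeTensor_comm (hB : ∀ x y, B x y = B y x) (ξ η : V) (w : ClC B ⊗[ℂ] X) :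
    wedgeTensor B X ξ (wedgeTensor B X η w) = -wedgeTensor B X η (wedgeTensor B X ξ w) := by
  have h : ∀ y : ClC B, (clWedge B ξ).baseChange ℂ ((clWedge B η).baseChange ℂ y) =
      -(clWedge B η).baseChange ℂ ((clWedge B ξ).baseChange ℂ y) := fun y =>
    LinearMap.congr_fun (f := (clWedge B ξ).baseChange ℂ ∘ₗ (clWedge B η).baseChange ℂ)
      (g := -((clWedge B η).baseChange ℂ ∘ₗ (clWedge B ξ).baseChange ℂ))
      (complexify_induction fun a => by
        simp [clWedge_comm hB ξ η, TensorProduct.tmul_neg]) y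
  induction w using TensorProduct.induction_on with
  | zero => simp
  | add w w' hw hw' => simp only [map_add, hw, hw', neg_add]
  | tmul y x => simp only [wedgeTensor, TensorProduct.map_tmul, h, TensorProduct.neg_tmul]

/-- The inner product comes from the Clifford summand only: in the other summand parity merely
anticommutes with exterior multiplication. -/
theorem iotaTensor_wedgeTensor (hB : ∀ x y, B x y = B y x) (J : V →ₗ[ℝ] Module.End ℂ X) (ξ η : V)
    (w : ClC B ⊗[ℂ] X) :
    iotaTensor B J ξ (wedgeTensor B X η w) =
      B ξ η • w - wedgeTensor B X η (iotaTensor B J ξ w) := by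
  have h1 : ∀ y : ClC B, clIota B ξ ((clWedge B η).baseChange ℂ y) =
      (B ξ η : ℂ) • y - (clWedge B η).baseChange ℂ (clIota B ξ y) := fun y =>
    LinearMap.congr_fun (f := clIota B ξ ∘ₗ (clWedge B η).baseChange ℂ)
      (g := (B ξ η : ℂ) • LinearMap.id - (clWedge B η).baseChange ℂ ∘ₗ clIota B ξ)
      (complexify_induction fun a => by
        simp [clIota_tmul, clContract_clWedge hB, TensorProduct.tmul_sub, TensorProduct.smul_tmul']) y
  have h2 : ∀ y : ClC B, clParity B ((clWedge B η).baseChange ℂ y) =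
      -(clWedge B η).baseChange ℂ (clParity B y) := fun y =>
    LinearMap.congr_fun (f := clParity B ∘ₗ (clWedge B η).baseChange ℂ)
      (g := -((clWedge B η).baseChange ℂ ∘ₗ clParity B))
      (complexify_induction fun a => by
        simp [clParity_tmul, involute_clWedge, TensorProduct.tmul_neg]) y
  induction w using TensorProduct.induction_on with
  | zero => simp
  | add w w' hw hw' => simp only [map_add, hw, hw', smul_add]; abel
  | tmul y x =>
    have e : B ξ η • (y ⊗ₜ[ℂ] x) = ((B ξ η : ℂ) • y) ⊗ₜ[ℂ] x := by
      rw [TensorProduct.smul_tmul']; congr 1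
    simp only [wedgeTensor, TensorProduct.map_tmul, iotaTensor_tmul, h1, h2, LinearMap.id_apply,
      TensorProduct.neg_tmul, TensorProduct.sub_tmul, map_add, e]
    abel

theorem horTensor_wedgeTensor (hB : ∀ x y, B x y = B y x) (ξ : V) (w : ClC B ⊗[ℂ] X) :
    horTensor B X (wedgeTensor B X ξ w) = 0 := by
  have h : ∀ y : ClC B, clHor B ((clWedge B ξ).baseChange ℂ y) = 0 := fun y =>
    LinearMap.congr_fun (f := clHor B ∘ₗ (clWedge B ξ).baseChange ℂ) (g := 0)
      (complexify_induction fun a => by simp [clHor_tmul, clDegZero_clWedge hB]) y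
  induction w using TensorProduct.induction_on with
  | zero => simp
  | add w w' hw hw' => rw [map_add, map_add, hw, hw', add_zero]
  | tmul y x => simp only [wedgeTensor, TensorProduct.map_tmul, horTensor_tmul, h, zero_smul]

theorem horTensor_one_tmul (x : X) : horTensor B X (1 ⊗ₜ x) = x := by
  rw [horTensor_tmul, Algebra.TensorProduct.one_def, clHor_tmul, clDegZero_one]
  simp

theorem sub_horTensor_mem (hB : ∀ x y, B x y = B y x) {I : Type*} [Fintype I]
    (b : Module.Basis I ℝ V) (w : ClC B ⊗[ℂ] X) :
    w - 1 ⊗ₜ horTensor B X w ∈ ⨆ a, LinearMap.range (wedgeTensor B X (b a)) := by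
  induction w using TensorProduct.induction_on with
  | zero => simp
  | add w w' hw hw' =>
    rw [map_add, TensorProduct.tmul_add, add_sub_add_comm]
    exact Submodule.add_mem _ hw hw'
  | tmul y x =>
    induction y using TensorProduct.induction_on with
    | zero => simp
    | add y y' hy hy' =>
      rw [TensorProduct.add_tmul, map_add, TensorProduct.tmul_add, add_sub_add_comm]
      exact Submodule.add_mem _ hy hy'
    | tmul c y =>
      have e : (c ⊗ₜ[ℝ] y) ⊗ₜ[ℂ] x - 1 ⊗ₜ[ℂ] horTensor B X ((c ⊗ₜ[ℝ] y) ⊗ₜ[ℂ] x) =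
          (c ⊗ₜ[ℝ] (y - clDegZero B y • (1 : CliffordAlgebra (halfForm B)))) ⊗ₜ[ℂ] x := by
        have e1 : c ⊗ₜ[ℝ] (clDegZero B y • (1 : CliffordAlgebra (halfForm B))) =
            (c * clDegZero B y) • (1 : ClC B) := by
          rw [← TensorProduct.smul_tmul, Algebra.TensorProduct.one_def, TensorProduct.smul_tmul']
          simp [mul_comm]
        rw [horTensor_tmul, clHor_tmul, TensorProduct.tmul_sub, TensorProduct.sub_tmul, e1,
          TensorProduct.smul_tmul]
      rw [e]
      have h := sub_clDegZero_mem hB b y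
      refine Submodule.iSup_induction (fun a => LinearMap.range (clWedge B (b a)))
        (motive := fun z => (c ⊗ₜ[ℝ] z) ⊗ₜ[ℂ] x ∈
          ⨆ a, LinearMap.range (wedgeTensor B X (b a))) h ?_ ?_ ?_
      · rintro a _ ⟨z, rfl⟩
        exact Submodule.mem_iSup_of_mem a ⟨(c ⊗ₜ[ℝ] z) ⊗ₜ[ℂ] x, rfl⟩
      · simp
      · intro z z' hz hz'
        rw [TensorProduct.tmul_add, TensorProduct.add_tmul]
        exact Submodule.add_mem _ hz hz'

/-- The horizontal subspace of `Cl(V)_ℂ ⊗ X`. -/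
def horizontal (B : LinearMap.BilinForm ℝ V) (J : V →ₗ[ℝ] Module.End ℂ X) :
    Submodule ℂ (ClC B ⊗[ℂ] X) := ⨅ ξ, LinearMap.ker (iotaTensor B J ξ)

theorem mem_horizontal {J : V →ₗ[ℝ] Module.End ℂ X} {w : ClC B ⊗[ℂ] X} :
    w ∈ horizontal B J ↔ ∀ ξ, iotaTensor B J ξ w = 0 := by
  simp [horizontal]

theorem exists_orthonormal_basis [FiniteDimensional ℝ V] (hB : ∀ x y, B x y = B y x)
    (hpos : ∀ x, x ≠ 0 → 0 < B x x) :
    ∃ b : Module.Basis (Fin (Module.finrank ℝ V)) ℝ V,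
      ∀ i j, B (b i) (b j) = if i = j then 1 else 0 := by
  obtain ⟨v, hv⟩ := LinearMap.BilinForm.exists_orthogonal_basis (B := B) ⟨fun x y => hB x y⟩
  have hp : ∀ i, 0 < B (v i) (v i) := fun i => hpos _ (v.ne_zero i)
  let c : Fin (Module.finrank ℝ V) → ℝˣ := fun i =>
    Units.mk0 (Real.sqrt (B (v i) (v i)))⁻¹ (inv_ne_zero (Real.sqrt_pos.2 (hp i)).ne')
  refine ⟨v.unitsSMul c, fun i j => ?_⟩
  rw [Module.Basis.unitsSMul_apply, Module.Basis.unitsSMul_apply]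
  simp only [c, Units.smul_mk0, map_smul, LinearMap.smul_apply, smul_eq_mul]
  split_ifs with h
  · subst h
    have h1 := Real.mul_self_sqrt (hp i).le
    have h2 := (Real.sqrt_pos.2 (hp i)).ne'
    field_simp
    nlinarith
  · have : B (v i) (v j) = 0 := hv h
    rw [this]; simp

/-- The degree zero component is an isomorphism from the horizontal subspace to `X`. -/
theorem horTensor_bijective [FiniteDimensional ℝ V] (hB : ∀ x y, B x y = B y x)
    (hpos : ∀ x, x ≠ 0 → 0 < B x x) {J : V →ₗ[ℝ] Module.End ℂ X} (hJ : ∀ ξ x, J ξ (J ξ x) = 0) :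
    Function.Bijective (horTensor B X ∘ₗ (horizontal B J).subtype) := by
  classical
  obtain ⟨b, hb⟩ := exists_orthonormal_basis hB hpos
  obtain ⟨P, h1, h2, h3, h4⟩ := exists_car_projection (fun a => iotaTensor B J (b a))
    (fun a => wedgeTensor B X (b a)) (fun a c w => iotaTensor_comm hB hJ _ _ w)
    (fun a c w => wedgeTensor_comm hB _ _ w) (fun a c w => by
      rw [iotaTensor_wedgeTensor hB, hb]; split_ifs <;> simp)
  have hP : ∀ w ∈ ⨆ a, LinearMap.range (wedgeTensor B X (b a)), P w = 0 := by
    intro w hw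
    have : (⨆ a, LinearMap.range (wedgeTensor B X (b a))) ≤ LinearMap.ker P :=
      iSup_le fun a => by rintro _ ⟨z, rfl⟩; exact h3 a z
    exact this hw
  have hH : ∀ w ∈ ⨆ a, LinearMap.range (wedgeTensor B X (b a)), horTensor B X w = 0 := by
    intro w hw
    have : (⨆ a, LinearMap.range (wedgeTensor B X (b a))) ≤ LinearMap.ker (horTensor B X) :=
      iSup_le fun a => by rintro _ ⟨z, rfl⟩; exact horTensor_wedgeTensor hB _ z
    exact this hw
  -- The total contraction is linear in ξ, so horizontality can be tested on the basis, as the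
  -- projection P requires.
  have hlin : ∀ w, (∀ a, iotaTensor B J (b a) w = 0) → w ∈ horizontal B J := by
    intro w hw
    rw [mem_horizontal]
    let L : V →ₗ[ℝ] ClC B ⊗[ℂ] X :=
      { toFun := fun ξ => iotaTensor B J ξ w
        map_add' := fun x y => by
          simp only [iotaTensor, map_add, TensorProduct.map_add_left, TensorProduct.map_add_right,
            LinearMap.add_apply]
          abel
        map_smul' := fun c x => by
          have e1 : ∀ (f g : Module.End ℂ (ClC B)) (h k : Module.End ℂ X) (c : ℝ),
              TensorProduct.map (c • f) h w + TensorProduct.map g (c • k) w =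
                c • (TensorProduct.map f h w + TensorProduct.map g k w) := by
            intro f g h k c
            have e2 : c • f = (c : ℂ) • f := rfl
            have e3 : c • k = (c : ℂ) • k := rfl
            rw [e2, e3, TensorProduct.map_smul_left, TensorProduct.map_smul_right, smul_add]
            rfl
          simp only [iotaTensor, map_smul, LinearMap.add_apply, e1, RingHom.id_apply] }
    have : L = 0 := b.ext hw
    exact fun ξ => LinearMap.congr_fun this ξ
  constructor
  · refine (injective_iff_map_eq_zero _).2 ?_
    rintro ⟨w, hw⟩ h0
    have h0' : horTensor B X w = 0 := h0
    -- Without a degree zero part, w lies in the sum of the ranges, where P vanishes; being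
    -- horizontal, it is also fixed by P.
    have h5 := sub_horTensor_mem hB b w
    rw [h0', TensorProduct.tmul_zero, sub_zero] at h5
    have h6 := hP w h5
    rw [h2 w fun a => mem_horizontal.1 hw (b a)] at h6
    exact Subtype.ext h6
  · intro x
    -- P alters 1 ⊗ x only by elements of the ranges of exterior multiplications, which have no
    -- degree zero part.
    refine ⟨⟨P (1 ⊗ₜ x), hlin _ fun a => h1 a _⟩, ?_⟩
    have h5 := hH _ (h4 (1 ⊗ₜ x))
    rw [map_sub, horTensor_one_tmul, sub_eq_zero] at h5
    exact h5

/-- On horizontal elements, quadratic expressions in the contractions on the two factors agree. -/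
theorem quadOp_horizontal {J : V →ₗ[ℝ] Module.End ℂ X}
    (hJ : ∀ ξ x, J ξ (J ξ x) = 0) (r) {w : ClC B ⊗[ℂ] X} (hw : w ∈ horizontal B J) :
    TensorProduct.map (quadOp (clIota B) r) LinearMap.id w =
      TensorProduct.map LinearMap.id (quadOp J r) w := by
  have h0 := mem_horizontal.1 hw
  have h1 : ∀ ξ, TensorProduct.map (clIota B ξ) LinearMap.id w =
      -TensorProduct.map (clParity B) (J ξ) w := fun ξ => eq_neg_of_add_eq_zero_left (h0 ξ)
  have h2 : ∀ ξ η, TensorProduct.map (clIota B ξ * clIota B η) LinearMap.id w =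
      TensorProduct.map LinearMap.id (J ξ * J η) w := by
    intro ξ η
    have e1 : TensorProduct.map (clIota B ξ * clIota B η) LinearMap.id w =
        TensorProduct.map (clIota B ξ) LinearMap.id
          (TensorProduct.map (clIota B η) (LinearMap.id : X →ₗ[ℂ] X) w) := by
      rw [← LinearMap.comp_apply, ← TensorProduct.map_comp]; rfl
    have e2 : ∀ z : ClC B ⊗[ℂ] X, TensorProduct.map (clIota B ξ) LinearMap.id
          (TensorProduct.map (clParity B) (J η) z) =
        -TensorProduct.map (clParity B) (J η) (TensorProduct.map (clIota B ξ) LinearMap.id z) := by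
      intro z
      induction z using TensorProduct.induction_on with
      | zero => simp
      | add z z' hz hz' => simp only [map_add, hz, hz', neg_add]
      | tmul y x =>
        simp only [TensorProduct.map_tmul, clParity_clIota, TensorProduct.neg_tmul,
          LinearMap.id_apply, neg_neg]
    have e3 : ∀ z : ClC B ⊗[ℂ] X, TensorProduct.map (clParity B) (J η)
          (TensorProduct.map (clParity B) (J ξ) z) =
        -TensorProduct.map LinearMap.id (J ξ * J η) z := by
      intro z
      induction z using TensorProduct.induction_on with
      | zero => simp
      | add z z' hz hz' => simp only [map_add, hz, hz', neg_add]
      | tmul y x =>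
        simp only [TensorProduct.map_tmul, clParity_clParity, anticomm_of_sq_zero hJ η ξ,
          TensorProduct.tmul_neg, LinearMap.id_apply, Module.End.mul_apply]
    -- With ε for parity, on w: (ι_ξ⊗1)(ι_η⊗1) = -(ι_ξ⊗1)(ε⊗J_η) = (ε⊗J_η)(ι_ξ⊗1) = -(ε⊗J_η)(ε⊗J_ξ)
    -- = -(1⊗J_η J_ξ) = 1⊗J_ξ J_η.
    rw [e1, h1 η, map_neg, e2, h1 ξ, map_neg, e3, neg_neg, neg_neg]
  induction r using tensor_sq_induction with
  | h0 => simp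
  | ht c d x y =>
    have e : quadOp (clIota B) ((c ⊗ₜ[ℝ] x) ⊗ₜ[ℂ] (d ⊗ₜ[ℝ] y)) =
        (c * d) • (clIota B x * clIota B y) := quadOp_tmul (V := ClC B) (clIota B) c d x y
    rw [e, quadOp_tmul, TensorProduct.map_smul_left, TensorProduct.map_smul_right,
      LinearMap.smul_apply, LinearMap.smul_apply, h2]
  | ha a b ha hb =>
    rw [map_add, map_add, TensorProduct.map_add_left, TensorProduct.map_add_right,
      LinearMap.add_apply, LinearMap.add_apply, ha, hb]

/-- This allows `quadOp_horizontal` to be iterated: quadratic expressions commute with the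
contractions, so they do not lead out of the horizontal subspace. -/
theorem horizontal_map
    {J : V →ₗ[ℝ] Module.End ℂ X} {N : Module.End ℂ X} (hN : ∀ ξ x, J ξ (N x) = N (J ξ x))
    {w : ClC B ⊗[ℂ] X} (hw : w ∈ horizontal B J) :
    TensorProduct.map LinearMap.id N w ∈ horizontal B J := by
  rw [mem_horizontal] at hw ⊢
  intro ξ
  have : ∀ z : ClC B ⊗[ℂ] X, iotaTensor B J ξ (TensorProduct.map LinearMap.id N z) =
      TensorProduct.map LinearMap.id N (iotaTensor B J ξ z) := by
    intro z
    induction z using TensorProduct.induction_on with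
    | zero => simp
    | add z z' hz hz' => simp only [map_add, hz, hz']
    | tmul y x => simp only [TensorProduct.map_tmul, iotaTensor_tmul, map_add, hN, LinearMap.id_apply]
  rw [this, hw, map_zero]

/-- On horizontal elements, the exponentials of quadratic expressions in the contractions on the
two factors agree. -/
theorem nilExp_horizontal [FiniteDimensional ℝ V] (hB : ∀ x y, B x y = B y x)
    {J : V →ₗ[ℝ] Module.End ℂ X} (hJ : ∀ ξ x, J ξ (J ξ x) = 0) (r) {w : ClC B ⊗[ℂ] X}
    (hw : w ∈ horizontal B J) :
    TensorProduct.map (nilExp ((1 / 2 : ℂ) • quadOp (clIota B) r)) LinearMap.id w =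
      TensorProduct.map LinearMap.id (nilExp ((1 / 2 : ℂ) • quadOp J r)) w := by
  obtain ⟨m, hm⟩ := isNilpotent_quadOp (clIota B) (clIota_sq hB) r
  obtain ⟨m', hm'⟩ := isNilpotent_quadOp J hJ r
  set n := max m m'
  have e1 : ((1 / 2 : ℂ) • quadOp (clIota B) r) ^ n = 0 := by
    rw [smul_pow, pow_eq_zero_of_le (le_max_left _ _) hm, smul_zero]
  have e2 : ((1 / 2 : ℂ) • quadOp J r) ^ n = 0 := by
    rw [smul_pow, pow_eq_zero_of_le (le_max_right _ _) hm', smul_zero]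
  have hcomm : ∀ ξ x, J ξ (quadOp J r x) = quadOp J r (J ξ x) := fun ξ x =>
    LinearMap.congr_fun (quadOp_anticomm (J := J) (J' := J) (J ξ)
      (fun η v => anticomm_of_sq_zero hJ ξ η v) r) x
  have hp : ∀ i : ℕ, ∀ w ∈ horizontal B J,
      TensorProduct.map (((1 / 2 : ℂ) • quadOp (clIota B) r) ^ i) LinearMap.id w =
        TensorProduct.map LinearMap.id (((1 / 2 : ℂ) • quadOp J r) ^ i) w := by
    intro i
    induction i with
    | zero => intro w _; rfl
    | succ n ih =>
      intro w hw
      have a1 : TensorProduct.map (((1 / 2 : ℂ) • quadOp (clIota B) r) ^ (n + 1)) LinearMap.id w =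
          TensorProduct.map (((1 / 2 : ℂ) • quadOp (clIota B) r) ^ n) LinearMap.id
            (TensorProduct.map ((1 / 2 : ℂ) • quadOp (clIota B) r) (LinearMap.id : X →ₗ[ℂ] X) w) := by
        rw [← LinearMap.comp_apply, ← TensorProduct.map_comp, pow_succ]; rfl
      have a2 : TensorProduct.map LinearMap.id (((1 / 2 : ℂ) • quadOp J r) ^ (n + 1)) w =
          TensorProduct.map LinearMap.id (((1 / 2 : ℂ) • quadOp J r) ^ n)
            (TensorProduct.map (LinearMap.id : ClC B →ₗ[ℂ] ClC B)
              ((1 / 2 : ℂ) • quadOp J r) w) := by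
        rw [← LinearMap.comp_apply, ← TensorProduct.map_comp, pow_succ]; rfl
      have a3 : TensorProduct.map ((1 / 2 : ℂ) • quadOp (clIota B) r) (LinearMap.id : X →ₗ[ℂ] X) w =
          TensorProduct.map (LinearMap.id : ClC B →ₗ[ℂ] ClC B) ((1 / 2 : ℂ) • quadOp J r) w := by
        rw [TensorProduct.map_smul_left, TensorProduct.map_smul_right, LinearMap.smul_apply,
          LinearMap.smul_apply, quadOp_horizontal hJ r hw]
      -- The induction hypothesis is used for the image of w under the quadratic operator on the
      -- second factor, which must be shown horizontal again.
      rw [a1, a2, a3, ih]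
      refine horizontal_map (fun ξ x => ?_) hw
      simp [hcomm]
  rw [nilExp_eq_sum e1, nilExp_eq_sum e2]
  have s1 : ∀ (f : ℕ → Module.End ℂ (ClC B)) (s : Finset ℕ),
      TensorProduct.map (∑ i ∈ s, f i) LinearMap.id w =
        ∑ i ∈ s, TensorProduct.map (f i) (LinearMap.id : X →ₗ[ℂ] X) w := by
    intro f s
    induction s using Finset.induction_on with
    | empty => simp
    | insert a s ha ih =>
      rw [Finset.sum_insert ha, Finset.sum_insert ha, TensorProduct.map_add_left,
        LinearMap.add_apply, ih]
  have s2 : ∀ (f : ℕ → Module.End ℂ X) (s : Finset ℕ),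
      TensorProduct.map LinearMap.id (∑ i ∈ s, f i) w =
        ∑ i ∈ s, TensorProduct.map (LinearMap.id : ClC B →ₗ[ℂ] ClC B) (f i) w := by
    intro f s
    induction s using Finset.induction_on with
    | empty => simp
    | insert a s ha ih =>
      rw [Finset.sum_insert ha, Finset.sum_insert ha, TensorProduct.map_add_right,
        LinearMap.add_apply, ih]
  rw [s1, s2]
  refine Finset.sum_congr rfl fun i _ => ?_
  rw [TensorProduct.map_smul_left, TensorProduct.map_smul_right, LinearMap.smul_apply,
    LinearMap.smul_apply, hp i w hw]

end WeilModel

/-! ### Equivariance of the fundamental vector fields -/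

section AdjointAction

variable {E G F M : Type*} [NormedAddCommGroup E] [NormedSpace ℝ E] [NormedAddCommGroup F]
  [NormedSpace ℝ F] [TopologicalSpace G] [ChartedSpace E G] [Group G] [LieGroup 𝓘(ℝ, E) ∞ G]
  [TopologicalSpace M] [ChartedSpace F M] [IsManifold 𝓘(ℝ, F) ∞ M]
  [MulAction G M] [ContMDiffSMul 𝓘(ℝ, E) 𝓘(ℝ, F) ∞ G M]

theorem Ad_mul (g h : G) (ξ : Lie E G) : Ad E (g * h) ξ = Ad E g (Ad E h ξ) := by
  have e : (mfderiv 𝓘(ℝ, E) 𝓘(ℝ, E) ((fun x : G => g * x * g⁻¹) ∘ fun x : G => h * x * h⁻¹) 1 :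
        E →L[ℝ] E) =
      (mfderiv 𝓘(ℝ, E) 𝓘(ℝ, E) (fun x : G => g * x * g⁻¹) (h * 1 * h⁻¹) : E →L[ℝ] E).comp
        (mfderiv 𝓘(ℝ, E) 𝓘(ℝ, E) (fun x : G => h * x * h⁻¹) 1 : E →L[ℝ] E) :=
    mfderiv_comp (I' := 𝓘(ℝ, E)) (1 : G) ((contMDiff_conj E g).mdifferentiable (by simp) _)
      ((contMDiff_conj E h).mdifferentiable (by simp) _)
  have e2 : ((fun x : G => g * x * g⁻¹) ∘ fun x : G => h * x * h⁻¹) =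
      fun x : G => (g * h) * x * (g * h)⁻¹ := by
    funext x; simp [mul_assoc]
  rw [e2, show h * 1 * h⁻¹ = 1 by simp] at e
  exact congrArg (fun L : E →L[ℝ] E => L ξ) e

theorem Ad_one (ξ : Lie E G) : Ad E (1 : G) ξ = ξ := by
  have e : (fun x : G => 1 * x * (1 : G)⁻¹) = id := by funext x; simp
  have e2 : (mfderiv 𝓘(ℝ, E) 𝓘(ℝ, E) (fun x : G => 1 * x * (1 : G)⁻¹) 1 : E →L[ℝ] E) =
      ContinuousLinearMap.id ℝ E := by
    rw [e]; exact mfderiv_id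
  exact congrArg (fun L : E →L[ℝ] E => L ξ) e2

theorem Ad_inv_Ad (g : G) (ξ : Lie E G) : Ad E g⁻¹ (Ad E g ξ) = ξ := by
  rw [← Ad_mul, inv_mul_cancel, Ad_one]

theorem Ad_Ad_inv (g : G) (ξ : Lie E G) : Ad E g (Ad E g⁻¹ ξ) = ξ := by
  rw [← Ad_mul, mul_inv_cancel, Ad_one]

theorem contMDiff_act (E : Type*) {G F M : Type*} [NormedAddCommGroup E] [NormedSpace ℝ E]
    [NormedAddCommGroup F] [NormedSpace ℝ F] [TopologicalSpace G] [ChartedSpace E G] [Group G]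
    [LieGroup 𝓘(ℝ, E) ∞ G] [TopologicalSpace M] [ChartedSpace F M] [IsManifold 𝓘(ℝ, F) ∞ M]
    [MulAction G M] [ContMDiffSMul 𝓘(ℝ, E) 𝓘(ℝ, F) ∞ G M] (g : G) :
    ContMDiff 𝓘(ℝ, F) 𝓘(ℝ, F) ∞ fun x : M => g • x :=
  (contMDiff_smul (I := 𝓘(ℝ, E)) (I' := 𝓘(ℝ, F)) (n := ∞) (G := G) (M := M)).comp
    (contMDiff_const.prodMk contMDiff_id)

theorem contMDiff_orbit (m : M) : ContMDiff 𝓘(ℝ, E) 𝓘(ℝ, F) ∞ fun g : G => g • m :=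
  (contMDiff_smul (I := 𝓘(ℝ, E)) (I' := 𝓘(ℝ, F)) (n := ∞) (G := G) (M := M)).comp
    (contMDiff_id.prodMk contMDiff_const)

/-- The derivative at h = 1 of g • (h • m) = (g h g⁻¹) • (g • m). -/
theorem tangentAct_fundField (g : G) (m : M) (ξ : Lie E G) :
    tangentAct F g m (fundField E G F m ξ) = fundField E G F (g • m) (Ad E g ξ) := by
  have e1 : (mfderiv 𝓘(ℝ, E) 𝓘(ℝ, F) ((fun x : M => g • x) ∘ fun h : G => h • m) 1 : E →L[ℝ] F) =
      (mfderiv 𝓘(ℝ, F) 𝓘(ℝ, F) (fun x : M => g • x) ((1 : G) • m) : F →L[ℝ] F).comp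
        (mfderiv 𝓘(ℝ, E) 𝓘(ℝ, F) (fun h : G => h • m) 1 : E →L[ℝ] F) :=
    mfderiv_comp (I' := 𝓘(ℝ, F)) (1 : G)
      ((contMDiff_act E g).mdifferentiable (by simp) _)
      ((contMDiff_orbit m).mdifferentiable (by simp) _)
  have e2 : (mfderiv 𝓘(ℝ, E) 𝓘(ℝ, F) ((fun h : G => h • (g • m)) ∘ fun h : G => g * h * g⁻¹) 1 :
        E →L[ℝ] F) =
      (mfderiv 𝓘(ℝ, E) 𝓘(ℝ, F) (fun h : G => h • (g • m)) (g * 1 * g⁻¹) : E →L[ℝ] F).comp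
        (mfderiv 𝓘(ℝ, E) 𝓘(ℝ, E) (fun h : G => g * h * g⁻¹) 1 : E →L[ℝ] E) :=
    mfderiv_comp (I' := 𝓘(ℝ, E)) (1 : G)
      ((contMDiff_orbit (g • m)).mdifferentiable (by simp) _)
      ((contMDiff_conj E g).mdifferentiable (by simp) _)
  have e3 : ((fun h : G => h • (g • m)) ∘ fun h : G => g * h * g⁻¹) =
      (fun x : M => g • x) ∘ fun h : G => h • m := by
    funext h; simp [smul_smul]
  rw [e3, e1, show g * 1 * g⁻¹ = 1 by simp, one_smul] at e2
  have e4 := congrArg (fun L : E →L[ℝ] F => -(L ξ)) e2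
  refine Eq.trans ?_ e4
  exact map_neg (mfderiv 𝓘(ℝ, F) 𝓘(ℝ, F) (fun x : M => g • x) m : F →L[ℝ] F) _

theorem iota_pull (g : G) (ξ : Lie E G) (β : smoothForms F M) :
    iota E G F M ξ (pull E F g β) = pull E F g (iota E G F M (Ad E g ξ) β) := by
  ext m k v
  change (β.1 (g • m) (k + 1)) (fun i => tangentAct F g m
      (Matrix.vecCons (fundField E G F m ξ) v i)) =
    (β.1 (g • m) (k + 1)) (Matrix.vecCons (fundField E G F (g • m) (Ad E g ξ))
      fun i => tangentAct F g m (v i))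
  congr 1
  funext i
  refine Fin.cases ?_ (fun j => ?_) i
  · exact tangentAct_fundField g m ξ
  · rfl

theorem iota_sq (ξ : Lie E G) (β : smoothForms F M) : iota E G F M ξ (iota E G F M ξ β) = 0 := by
  ext m k v
  change (β.1 m (k + 1 + 1)) (Matrix.vecCons (fundField E G F m ξ)
    (Matrix.vecCons (fundField E G F m ξ) v)) = 0
  exact (β.1 m (k + 1 + 1)).map_eq_zero_of_eq _ (i := 0) (j := 1) rfl (by simp)

end AdjointAction

/-! ### Contractions on forms with distributional coefficients -/

section DistIota

variable {E G F M : Type*} [NormedAddCommGroup E] [NormedSpace ℝ E] [NormedAddCommGroup F]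
  [NormedSpace ℝ F] [TopologicalSpace G] [ChartedSpace E G] [Group G] [LieGroup 𝓘(ℝ, E) ∞ G]
  [TopologicalSpace M] [ChartedSpace F M] [IsManifold 𝓘(ℝ, F) ∞ M]
  [MulAction G M] [ContMDiffSMul 𝓘(ℝ, E) 𝓘(ℝ, F) ∞ G M]
  {𝒟 : Type*} [AddCommGroup 𝒟] [Module ℂ 𝒟]

/-- The additive group structure on forms with distributional coefficients. -/
abbrev distFormsAddCommGroup (D : Submodule ℂ (𝒟 →ₗ[ℂ] ℂ)) : AddCommGroup (distForms F M D) :=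
  Module.addCommMonoidToAddCommGroup ℂ

attribute [local instance] distFormsAddCommGroup

set_option synthInstance.maxHeartbeats 200000 in
variable (E G F M) in
/-- The contractions on forms with distributional coefficients. -/
def distIota (D : Submodule ℂ (𝒟 →ₗ[ℂ] ℂ)) : OpFamily (Lie E G) (distForms F M D) where
  toFun ξ := postComp D (iota E G F M ξ) (fibrewise_iota E G F M ξ)
  map_add' ξ η := by
    refine LinearMap.ext fun u => Subtype.ext (LinearMap.ext fun φ => ?_)
    exact LinearMap.congr_fun ((iota E G F M).map_add ξ η) (u.1 φ)
  map_smul' c ξ := by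
    refine LinearMap.ext fun u => Subtype.ext (LinearMap.ext fun φ => ?_)
    exact LinearMap.congr_fun ((iota E G F M).map_smul c ξ) (u.1 φ)

variable {D : Submodule ℂ (𝒟 →ₗ[ℂ] ℂ)}

theorem distForms_ext {u v : distForms F M D} (h : ∀ φ, u.1 φ = v.1 φ) : u = v :=
  Subtype.ext (LinearMap.ext h)

theorem distIota_sq (ξ : Lie E G) (u : distForms F M D) :
    distIota E G F M D ξ (distIota E G F M D ξ u) = 0 :=
  distForms_ext fun φ => iota_sq ξ (u.1 φ)

variable (E G F M) in
/-- The contractions on differential forms. -/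
def iotaFam : OpFamily (Lie E G) (smoothForms F M) := iota E G F M

theorem iotaBivector_eq (r) : iotaBivector E G F M r = quadOp (iotaFam E G F M) r :=
  LinearMap.ext fun β => Subtype.ext (funext (contract_inducedBivector E G F M r β))

variable (F M) in
/-- Evaluation of a form with distributional coefficients on a test function. -/
def evalTest (D : Submodule ℂ (𝒟 →ₗ[ℂ] ℂ)) (φ : 𝒟) : distForms F M D →ₗ[ℂ] smoothForms F M where
  toFun u := u.1 φ
  map_add' _ _ := rfl
  map_smul' _ _ := rfl

/-- Evaluation on a test function intertwines the contractions, hence the exponentials, even if the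
two finite sums stop at different nilpotency classes. -/
theorem nilExp_distIota [FiniteDimensional ℝ E] (r) (u : distForms F M D) (φ : 𝒟) :
    (nilExp ((1 / 2 : ℂ) • quadOp (distIota E G F M D) r) u).1 φ =
      expBivector E G F M r (u.1 φ) := by
  have : FiniteDimensional ℝ (Lie E G) := inferInstanceAs (FiniteDimensional ℝ E)
  rw [expBivector, iotaBivector_eq]
  exact nilExp_quadOp_intertwine (J := distIota E G F M D) (J' := iotaFam E G F M) distIota_sq
    iota_sq (evalTest F M D φ) (fun ξ u => rfl) r u

theorem act_distIota (g : G) (ξ : Lie E G) (u : distForms F M (distG E G)) :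
    distIota E G F M _ (Ad E g ξ) (actDistForms E F M g u) =
      actDistForms E F M g (distIota E G F M _ ξ u) := by
  refine distForms_ext fun φ => ?_
  change iota E G F M (Ad E g ξ) (pull E F g⁻¹ (u.1 (conjFun E g φ))) =
    pull E F g⁻¹ (iota E G F M ξ (u.1 (conjFun E g φ)))
  rw [iota_pull, Ad_inv_Ad]

end DistIota

/-! ### Isometries and the adjoint action on the Clifford algebra -/

section CliffordFunctoriality

variable {V : Type*} [AddCommGroup V] [Module ℝ V] {B : LinearMap.BilinForm ℝ V}

theorem map_clContract (f : halfForm B →qᵢ halfForm B) (ξ : V)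
    (y : CliffordAlgebra (halfForm B)) :
    CliffordAlgebra.map f (clContract B ξ y) = clContract B (f ξ) (CliffordAlgebra.map f y) := by
  have h : CliffordAlgebra.map f (CliffordAlgebra.involute y) =
      CliffordAlgebra.involute (CliffordAlgebra.map f y) := by
    have : (CliffordAlgebra.map f).comp CliffordAlgebra.involute =
        CliffordAlgebra.involute.comp (CliffordAlgebra.map f) := by
      ext x; simp
    exact DFunLike.congr_fun this y
  rw [clContract_apply, clContract_apply, map_sub, map_mul, map_mul, h,
    CliffordAlgebra.map_apply_ι]

theorem map_clWedge (f : halfForm B →qᵢ halfForm B) (ξ : V) (y : CliffordAlgebra (halfForm B)) :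
    CliffordAlgebra.map f (clWedge B ξ y) = clWedge B (f ξ) (CliffordAlgebra.map f y) := by
  rw [clWedge_apply, clWedge_apply, map_sub, map_mul, map_smul, map_clContract,
    CliffordAlgebra.map_apply_ι]

/-- An isometry fixes 1 and carries exterior products to exterior products, so it respects the
splitting of `sub_clDegZero_mem`. -/
theorem clDegZero_map [FiniteDimensional ℝ V] (hB : ∀ x y, B x y = B y x)
    (f : halfForm B →qᵢ halfForm B) (y : CliffordAlgebra (halfForm B)) :
    clDegZero B (CliffordAlgebra.map f y) = clDegZero B y := by
  have h := sub_clDegZero_mem hB (Module.finBasis ℝ V) y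
  have h2 : clDegZero B (CliffordAlgebra.map f (y - clDegZero B y • 1)) = 0 := by
    refine Submodule.iSup_induction _
      (motive := fun z => clDegZero B (CliffordAlgebra.map f z) = 0) h ?_ (by simp) ?_
    · rintro a _ ⟨z, rfl⟩
      rw [map_clWedge, clDegZero_clWedge hB]
    · intro z z' hz hz'
      rw [map_add, map_add, hz, hz', add_zero]
  rwa [map_sub, map_smul, map_one, map_sub, map_smul, clDegZero_one, smul_eq_mul, mul_one,
    sub_eq_zero] at h2

end CliffordFunctoriality

section ClAd

variable {E G : Type*} [NormedAddCommGroup E] [NormedSpace ℝ E]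
  [TopologicalSpace G] [ChartedSpace E G] [Group G] [LieGroup 𝓘(ℝ, E) ∞ G]
  (B : InvariantInnerProduct E G)

/-- The adjoint action as an isometry. -/
def adIsometry (g : G) : halfForm B.form →qᵢ halfForm B.form :=
  { Ad E g with
    map_app' := fun x => by
      simp only [halfForm, smul_apply, LinearMap.BilinMap.toQuadraticMap_apply]
      exact congrArg _ (B.invariant g x x) }

theorem clAd_tmul (g : G) (c : ℂ) (y : CliffordAlgebra (halfForm B.form)) :
    clAd B g (c ⊗ₜ y) = c ⊗ₜ CliffordAlgebra.map (adIsometry B g) y := rfl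

theorem clAd_clIota (g : G) (ξ : Lie E G) (y : ClC B.form) :
    clAd B g (clIota B.form ξ y) = clIota B.form (Ad E g ξ) (clAd B g y) := by
  refine LinearMap.congr_fun (f := clAd B g ∘ₗ clIota B.form ξ)
    (g := clIota B.form (Ad E g ξ) ∘ₗ clAd B g) (complexify_induction fun a => ?_) y
  simp only [LinearMap.comp_apply, clIota_tmul, clAd_tmul, map_clContract]
  rfl

theorem clAd_clParity (g : G) (y : ClC B.form) :
    clAd B g (clParity B.form y) = clParity B.form (clAd B g y) := by
  refine LinearMap.congr_fun (f := clAd B g ∘ₗ clParity B.form)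
    (g := clParity B.form ∘ₗ clAd B g) (complexify_induction fun a => ?_) y
  simp only [LinearMap.comp_apply, clParity_tmul, clAd_tmul]
  congr 1
  have : (CliffordAlgebra.map (adIsometry B g)).comp CliffordAlgebra.involute =
      CliffordAlgebra.involute.comp (CliffordAlgebra.map (adIsometry B g)) := by
    ext x; simp
  exact DFunLike.congr_fun this a

theorem clHor_clAd [FiniteDimensional ℝ E] (g : G) (y : ClC B.form) :
    clHor B.form (clAd B g y) = clHor B.form y := by
  have : FiniteDimensional ℝ (Lie E G) := inferInstanceAs (FiniteDimensional ℝ E)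
  refine LinearMap.congr_fun (f := clHor B.form ∘ₗ clAd B g)
    (g := clHor B.form) (complexify_induction fun a => ?_) y
  simp only [LinearMap.comp_apply, clAd_tmul, clHor_tmul, clDegZero_map B.symm]

end ClAd

/-- If `h` maps the subspace `H` isomorphically onto `X`, and intertwines operators `a i` preserving
`H` with operators `b i`, then it maps the invariants in `H` isomorphically onto the invariants
in `X`. -/
theorem exists_invariants_equiv {W X I : Type*} [AddCommMonoid W] [Module ℂ W] [AddCommMonoid X]
    [Module ℂ X] (H : Submodule ℂ W) (h : W →ₗ[ℂ] X)
    (hbij : Function.Bijective (h ∘ₗ H.subtype)) (a : I → Module.End ℂ W) (b : I → Module.End ℂ X)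
    (hH : ∀ i, ∀ w ∈ H, a i w ∈ H) (hab : ∀ i w, h (a i w) = b i (h w)) :
    ∃ P : ↥(H ⊓ ⨅ i, LinearMap.eqLocus (a i) LinearMap.id) ≃ₗ[ℂ]
      ↥(⨅ i, LinearMap.eqLocus (b i) LinearMap.id), ∀ w, (P w : X) = h w := by
  let f : ↥(H ⊓ ⨅ i, LinearMap.eqLocus (a i) LinearMap.id) →ₗ[ℂ]
      ↥(⨅ i, LinearMap.eqLocus (b i) LinearMap.id) :=
    (h ∘ₗ Submodule.subtype _).codRestrict _ (by
      rintro ⟨w, hw⟩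
      rw [Submodule.mem_iInf]
      intro i
      have h1 : a i w = w := (Submodule.mem_iInf _).1 hw.2 i
      change b i (h w) = h w
      rw [← hab, h1])
  refine ⟨LinearEquiv.ofBijective f ⟨?_, ?_⟩, fun w => rfl⟩
  · rintro ⟨w, hw⟩ ⟨w', hw'⟩ hww
    have h1 : h w = h w' := congrArg Subtype.val hww
    have h2 := @hbij.1 ⟨w, hw.1⟩ ⟨w', hw'.1⟩ h1
    exact Subtype.ext (Subtype.mk.inj h2)
  · rintro ⟨x, hx⟩
    obtain ⟨⟨w, hw⟩, hwx⟩ := hbij.2 x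
    have hwx' : h w = x := hwx
    refine ⟨⟨w, hw, ?_⟩, Subtype.ext hwx⟩
    rw [SetLike.mem_coe, Submodule.mem_iInf]
    intro i
    have h1 : b i x = x := (Submodule.mem_iInf _).1 hx i
    -- Both `a i w` and `w` lie in H and have the same image, so injectivity on H forces invariance.
    have h2 : h (a i w) = h w := by rw [hab, hwx', h1]
    have h3 := @hbij.1 ⟨a i w, hH i w hw⟩ ⟨w, hw⟩ h2
    exact congrArg Subtype.val h3

/-! ### Naturality of the symbol map -/

section Symbol

variable {V : Type*} [AddCommGroup V] [Module ℝ V] {B : LinearMap.BilinForm ℝ V}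

theorem symbol_clContract (hB : ∀ x y, B x y = B y x) (ξ : V)
    (y : CliffordAlgebra (halfForm B)) :
    symbol B (clContract B ξ y) = CliffordAlgebra.contractLeft (B ξ) (symbol B y) := by
  rw [clContract_eq hB]
  exact CliffordAlgebra.changeForm_contractLeft CliffordAlgebra.changeForm.associated_neg_proof _ y

/-- Induction by exterior rather than Clifford products, suited to maps that are defined through the
symbol. -/
theorem symbol_induction (hB : ∀ x y, B x y = B y x)
    {p : CliffordAlgebra (halfForm B) → Prop} (h1 : ∀ r : ℝ, p (r • 1))
    (hadd : ∀ x y, p x → p y → p (x + y)) (hw : ∀ ξ y, p y → p (clWedge B ξ y))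
    (y : CliffordAlgebra (halfForm B)) : p y := by
  obtain ⟨x, rfl⟩ := (symbol B).symm.surjective y
  induction x using CliffordAlgebra.left_induction with
  | algebraMap r =>
    have : (symbol B).symm (algebraMap ℝ _ r) = r • 1 := by
      rw [Algebra.algebraMap_eq_smul_one, map_smul, LinearEquiv.symm_apply_eq _ |>.2 symbol_one.symm]
    exact this ▸ h1 r
  | add x y hx hy => rw [map_add]; exact hadd _ _ hx hy
  | ι_mul z a hz =>
    have : (symbol B).symm (CliffordAlgebra.ι 0 a * z) = clWedge B a ((symbol B).symm z) := by
      rw [LinearEquiv.symm_apply_eq, symbol_clWedge hB, LinearEquiv.apply_symm_apply]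
    rw [this]; exact hw _ _ hz

theorem symbol_involute (hB : ∀ x y, B x y = B y x) (y : CliffordAlgebra (halfForm B)) :
    symbol B (CliffordAlgebra.involute y) = CliffordAlgebra.involute (symbol B y) := by
  induction y using symbol_induction hB with
  | h1 r => simp [symbol_one]
  | hadd x y hx hy => simp only [map_add, hx, hy]
  | hw ξ y hy =>
    rw [involute_clWedge, map_neg, symbol_clWedge hB, symbol_clWedge hB, hy, map_mul]
    have : CliffordAlgebra.involute (ExteriorAlgebra.ι ℝ ξ) = -ExteriorAlgebra.ι ℝ ξ :=
      CliffordAlgebra.involute_ι ξ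
    rw [this, neg_mul]

theorem symbol_map (hB : ∀ x y, B x y = B y x) (f : halfForm B →qᵢ halfForm B)
    (y : CliffordAlgebra (halfForm B)) :
    symbol B (CliffordAlgebra.map f y) = ExteriorAlgebra.map f.toLinearMap (symbol B y) := by
  induction y using symbol_induction hB with
  | h1 r => simp [symbol_one]
  | hadd x y hx hy => simp only [map_add, hx, hy]
  | hw ξ y hy =>
    rw [map_clWedge, symbol_clWedge hB, symbol_clWedge hB, hy, map_mul, ExteriorAlgebra.map_apply_ι]
    rfl

/-- Both sides obey the same recursion under left multiplication by a vector. It is applied to the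
orthogonal projection onto 𝔱. -/
theorem exteriorMap_contractLeft {V' : Type*} [AddCommGroup V'] [Module ℝ V'] (f : V →ₗ[ℝ] V')
    (d : Module.Dual ℝ V') (x : ExteriorAlgebra ℝ V) :
    ExteriorAlgebra.map f (CliffordAlgebra.contractLeft (d ∘ₗ f) x) =
      CliffordAlgebra.contractLeft d (ExteriorAlgebra.map f x) := by
  induction x using CliffordAlgebra.left_induction with
  | algebraMap r =>
    have : ExteriorAlgebra.map f (algebraMap ℝ (ExteriorAlgebra ℝ V) r) =
      algebraMap ℝ (ExteriorAlgebra ℝ V') r := AlgHom.commutes _ _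
    rw [CliffordAlgebra.contractLeft_algebraMap, map_zero]
    refine Eq.trans ?_ (congrArg (CliffordAlgebra.contractLeft d) this.symm)
    exact (CliffordAlgebra.contractLeft_algebraMap _ d r).symm
  | add x y hx hy => simp only [map_add, hx, hy]
  | ι_mul z a hz =>
    have h1 : ExteriorAlgebra.map f (CliffordAlgebra.ι 0 a * z) =
        CliffordAlgebra.ι 0 (f a) * ExteriorAlgebra.map f z := by
      rw [map_mul]; congr 1; exact ExteriorAlgebra.map_apply_ι f a
    have h2 : ∀ z, ExteriorAlgebra.map f (CliffordAlgebra.ι 0 a * z) =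
        CliffordAlgebra.ι 0 (f a) * ExteriorAlgebra.map f z := by
      intro z; rw [map_mul]; congr 1; exact ExteriorAlgebra.map_apply_ι f a
    rw [h1, CliffordAlgebra.contractLeft_ι_mul, CliffordAlgebra.contractLeft_ι_mul, map_sub,
      map_smul, h2, hz]
    rfl

theorem exteriorMap_involute {V' : Type*} [AddCommGroup V'] [Module ℝ V'] (f : V →ₗ[ℝ] V')
    (x : ExteriorAlgebra ℝ V) :
    ExteriorAlgebra.map f (CliffordAlgebra.involute x) =
      CliffordAlgebra.involute (ExteriorAlgebra.map f x) := by
  have : (ExteriorAlgebra.map f).comp CliffordAlgebra.involute =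
      CliffordAlgebra.involute.comp (ExteriorAlgebra.map f) := by
    apply ExteriorAlgebra.hom_ext
    ext v
    have h1 : CliffordAlgebra.involute (ExteriorAlgebra.ι ℝ v) = -ExteriorAlgebra.ι ℝ v :=
      CliffordAlgebra.involute_ι v
    have h2 : CliffordAlgebra.involute (ExteriorAlgebra.ι ℝ (f v)) = -ExteriorAlgebra.ι ℝ (f v) :=
      CliffordAlgebra.involute_ι (f v)
    simp [h1, h2]
  exact DFunLike.congr_fun this x

end Symbol

/-! ### Basic elements and twisted maps in abstract form -/

section AbstractModels

variable {V V' : Type*} [AddCommGroup V] [Module ℝ V] [FiniteDimensional ℝ V] [AddCommGroup V']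
  [Module ℝ V'] {B : LinearMap.BilinForm ℝ V} {B' : LinearMap.BilinForm ℝ V'}
  {X X' : Type*} [AddCommGroup X] [Module ℂ X] [AddCommGroup X'] [Module ℂ X']

/-- The basic subspace of `Cl(V)_ℂ ⊗ X`, for operators `a₁ i`, `a₂ i` on the factors. -/
def basicTensor (B : LinearMap.BilinForm ℝ V) (J : OpFamily V X) {I : Type*}
    (a₁ : I → Module.End ℂ (ClC B)) (a₂ : I → Module.End ℂ X) : Submodule ℂ (ClC B ⊗[ℂ] X) :=
  horizontal B J ⊓ ⨅ i, LinearMap.eqLocus (TensorProduct.map (a₁ i) (a₂ i)) LinearMap.id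

/-- The assumption `hι` says that each symmetry permutes the contractions, so it preserves
horizontality. For G the permutation is ξ ↦ Ad g⁻¹ ξ; for T it is trivial. -/
theorem exists_basicTensor_equiv (hB : ∀ x y, B x y = B y x) (hpos : ∀ x, x ≠ 0 → 0 < B x x)
    (J : OpFamily V X) (hJ : ∀ ξ x, J ξ (J ξ x) = 0) {I : Type*}
    (a₁ : I → Module.End ℂ (ClC B)) (a₂ : I → Module.End ℂ X)
    (hι : ∀ i ξ, ∃ η, (∀ y, clIota B ξ (a₁ i y) = a₁ i (clIota B η y)) ∧
      ∀ x, J ξ (a₂ i x) = a₂ i (J η x))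
    (hε : ∀ i y, a₁ i (clParity B y) = clParity B (a₁ i y))
    (hh : ∀ i y, clHor B (a₁ i y) = clHor B y) :
    ∃ P : basicTensor B J a₁ a₂ ≃ₗ[ℂ] ↥(⨅ i, LinearMap.eqLocus (a₂ i) LinearMap.id),
      ∀ w, (P w : X) = horTensor B X w := by
  refine exists_invariants_equiv (horizontal B J) (horTensor B X) (horTensor_bijective hB hpos hJ)
    (fun i => TensorProduct.map (a₁ i) (a₂ i)) a₂ ?_ ?_
  · intro i w hw
    rw [mem_horizontal] at hw ⊢
    intro ξ
    obtain ⟨η, h1, h2⟩ := hι i ξ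
    have h : ∀ z, iotaTensor B J ξ (TensorProduct.map (a₁ i) (a₂ i) z) =
        TensorProduct.map (a₁ i) (a₂ i) (iotaTensor B J η z) := by
      intro z
      induction z using TensorProduct.induction_on with
      | zero => simp
      | add z z' hz hz' => simp only [map_add, hz, hz']
      | tmul y x =>
        rw [TensorProduct.map_tmul, iotaTensor_tmul, iotaTensor_tmul, map_add,
          TensorProduct.map_tmul, TensorProduct.map_tmul, h1, hε, h2]
    rw [h, hw, map_zero]
  · intro i w
    induction w using TensorProduct.induction_on with
    | zero => simp
    | add z z' hz hz' => simp only [map_add, hz, hz']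
    | tmul y x => rw [TensorProduct.map_tmul, horTensor_tmul, horTensor_tmul, hh, map_smul]

/-- A map `p ∘ exp (½ r_ab ι_a ι_b) ⊗ S` takes basic elements to basic elements, and corresponds
to `S ∘ exp (½ r_ab ι_a ι_b)` under the projections to the degree zero components. -/
theorem map_twist_basicTensor (hB : ∀ x y, B x y = B y x)
    (J : OpFamily V X) (hJ : ∀ ξ x, J ξ (J ξ x) = 0) (J' : OpFamily V' X') (j : V' → V) (r)
    (q : ClC B →ₗ[ℂ] ClC B) (hq : q = nilExp ((1 / 2 : ℂ) • quadOp (clIota B) r))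
    (p : ClC B →ₗ[ℂ] ClC B') (S : X →ₗ[ℂ] X') (S₀ : X →ₗ[ℂ] X')
    (hS₀ : ∀ x, S (nilExp ((1 / 2 : ℂ) • quadOp J r) x) = S₀ x)
    (hqι : ∀ ξ y, clIota B ξ (q y) = q (clIota B ξ y))
    (hqε : ∀ y, clParity B (q y) = q (clParity B y))
    (hpι : ∀ ξ y, p (clIota B (j ξ) y) = clIota B' ξ (p y))
    (hpε : ∀ y, p (clParity B y) = clParity B' (p y))
    (hph : ∀ y, clHor B' (p y) = clHor B y) (hS : ∀ ξ x, S (J (j ξ) x) = J' ξ (S x))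
    {I I' : Type*} (k : I' → I) (a₁ : I → Module.End ℂ (ClC B)) (a₂ : I → Module.End ℂ X)
    (b : I' → Module.End ℂ X') (ha₁ : ∀ i y, p (q (a₁ (k i) y)) = p (q y))
    (ha₂ : ∀ i x, S (a₂ (k i) x) = b i (S x)) :
    (∀ w : basicTensor B J a₁ a₂, TensorProduct.map (p ∘ₗ q) S w ∈
      basicTensor B' J' (fun _ => LinearMap.id) b) ∧
    ∀ w : basicTensor B J a₁ a₂, horTensor B' X' (TensorProduct.map (p ∘ₗ q) S w) =
      S₀ (horTensor B X w) := by
  set K := TensorProduct.map (p ∘ₗ q) S with hKdef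
  have hK : ∀ y u, K (y ⊗ₜ u) = p (q y) ⊗ₜ S u := fun y u => rfl
  have hKι : ∀ (ξ : V') w, iotaTensor B' J' ξ (K w) = K (iotaTensor B J (j ξ) w) := by
    intro ξ w
    induction w using TensorProduct.induction_on with
    | zero => simp
    | add z z' hz hz' => simp only [map_add, hz, hz']
    | tmul y u =>
      rw [iotaTensor_tmul, map_add, hK, hK, hK, iotaTensor_tmul, ← hqι, ← hqε, hpι, hpε, hS]
  have hKT : ∀ i w, TensorProduct.map LinearMap.id (b i) (K w) =
      K (TensorProduct.map (a₁ (k i)) (a₂ (k i)) w) := by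
    intro i w
    induction w using TensorProduct.induction_on with
    | zero => simp
    | add z z' hz hz' => simp only [map_add, hz, hz']
    | tmul y u => rw [hK, TensorProduct.map_tmul, TensorProduct.map_tmul, hK, ha₁, ha₂]; rfl
  refine ⟨?_, ?_⟩
  · rintro ⟨w, hw⟩
    refine ⟨mem_horizontal.2 fun ξ => ?_, (Submodule.mem_iInf _).2 fun i => ?_⟩
    · rw [hKι, mem_horizontal.1 hw.1, map_zero]
    · have h4 : TensorProduct.map (a₁ (k i)) (a₂ (k i)) w = w :=
        (Submodule.mem_iInf _).1 hw.2 (k i)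
      change TensorProduct.map LinearMap.id (b i) (K w) = K w
      rw [hKT, h4]
  · rintro ⟨w, hw⟩
    have hor1 : ∀ z, horTensor B' X' (K z) =
        S (horTensor B X (TensorProduct.map q LinearMap.id z)) := by
      intro z
      induction z using TensorProduct.induction_on with
      | zero => simp
      | add z z' hz hz' => simp only [map_add, hz, hz']
      | tmul y u =>
        rw [hK, TensorProduct.map_tmul, horTensor_tmul, horTensor_tmul, hph, map_smul]
        rfl
    have hor2 : ∀ (N : Module.End ℂ X) z,
        horTensor B X (TensorProduct.map LinearMap.id N z) = N (horTensor B X z) := by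
      intro N z
      induction z using TensorProduct.induction_on with
      | zero => simp
      | add z z' hz hz' => simp only [map_add, hz, hz']
      | tmul y u => rw [TensorProduct.map_tmul, horTensor_tmul, horTensor_tmul, map_smul]; rfl
    -- The twist moves to the second factor by horizontality with respect to all of V, before
    -- anything is projected; taking degree zero parts then leaves the exponential on X.
    rw [hor1, hq, nilExp_horizontal hB hJ r hw.1, hor2, hS₀]

end AbstractModels

/-! ### The orthogonal projection from 𝔤 to 𝔱 -/

section Projection

variable {E G : Type*} [NormedAddCommGroup E] [NormedSpace ℝ E] [FiniteDimensional ℝ E]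
  [TopologicalSpace G] [ChartedSpace E G] [Group G] [LieGroup 𝓘(ℝ, E) ∞ G]
  (B : InvariantInnerProduct E G) (T : MaximalTorus E G)

theorem restrict_symm (x y : T.lie) :
    (B.form.restrict T.lie) x y = (B.form.restrict T.lie) y x := B.symm x y

theorem restrict_pos (x : T.lie) (hx : x ≠ 0) : 0 < (B.form.restrict T.lie) x x :=
  B.pos x fun h => hx (Subtype.ext h)

/-- The orthogonal projection onto the Lie algebra of the maximal torus. -/
def lieProj : Lie E G →ₗ[ℝ] T.lie := T.lie.projectionOnto _ (isCompl_lie B T)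

theorem form_lieProj (s : T.lie) (x : Lie E G) : B.form s (lieProj B T x) = B.form s x := by
  have h : x - lieProj B T x ∈ B.form.orthogonal T.lie := by
    have h1 : lieProj B T (x - lieProj B T x) = 0 := by
      rw [map_sub, sub_eq_zero]
      exact (Submodule.projectionOnto_apply_left (isCompl_lie B T) _).symm
    exact (Submodule.projectionOnto_apply_eq_zero_iff (isCompl_lie B T)).1 h1
  have h2 : B.form s (x - lieProj B T x) = 0 := h s s.2
  rw [map_sub, sub_eq_zero] at h2
  exact h2.symm

theorem clProj_tmul (c : ℂ) (y : CliffordAlgebra (halfForm B.form)) :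
    clProj B T (c ⊗ₜ y) = c ⊗ₜ (symbol (B.form.restrict T.lie)).symm
      (ExteriorAlgebra.map (lieProj B T) (symbol B.form y)) := rfl

/-- For ξ ∈ 𝔱 the functional ⟨ξ, ·⟩ factors through the orthogonal projection, so naturality of the
contraction applies. -/
theorem clProj_clIota (ξ : T.lie) (y : ClC B.form) :
    clProj B T (clIota B.form ξ y) = clIota (B.form.restrict T.lie) ξ (clProj B T y) := by
  refine LinearMap.congr_fun (f := clProj B T ∘ₗ clIota B.form ξ)
    (g := clIota (B.form.restrict T.lie) ξ ∘ₗ clProj B T) (complexify_induction fun a => ?_) y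
  simp only [LinearMap.comp_apply, clIota_tmul, clProj_tmul]
  congr 1
  rw [LinearEquiv.symm_apply_eq, symbol_clContract (restrict_symm B T),
    LinearEquiv.apply_symm_apply, symbol_clContract B.symm, ← exteriorMap_contractLeft]
  congr 3
  ext x
  exact (form_lieProj B T ξ x).symm

theorem clProj_clParity (y : ClC B.form) :
    clProj B T (clParity B.form y) = clParity (B.form.restrict T.lie) (clProj B T y) := by
  refine LinearMap.congr_fun (f := clProj B T ∘ₗ clParity B.form)
    (g := clParity (B.form.restrict T.lie) ∘ₗ clProj B T) (complexify_induction fun a => ?_) y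
  simp only [LinearMap.comp_apply, clParity_tmul, clProj_tmul]
  congr 1
  rw [LinearEquiv.symm_apply_eq, symbol_involute (restrict_symm B T),
    LinearEquiv.apply_symm_apply, symbol_involute B.symm, exteriorMap_involute]

theorem clHor_clProj (y : ClC B.form) :
    clHor (B.form.restrict T.lie) (clProj B T y) = clHor B.form y := by
  refine LinearMap.congr_fun (f := clHor (B.form.restrict T.lie) ∘ₗ clProj B T)
    (g := clHor B.form) (complexify_induction fun a => ?_) y
  simp only [LinearMap.comp_apply, clProj_tmul, clHor_tmul]
  congr 2
  change ExteriorAlgebra.algebraMapInv (symbol (B.form.restrict T.lie)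
    ((symbol (B.form.restrict T.lie)).symm _)) = ExteriorAlgebra.algebraMapInv (symbol B.form a)
  rw [LinearEquiv.apply_symm_apply]
  have : ExteriorAlgebra.algebraMapInv.comp (ExteriorAlgebra.map (lieProj B T)) =
      ExteriorAlgebra.algebraMapInv := by
    apply ExteriorAlgebra.hom_ext
    ext v
    simp [ExteriorAlgebra.algebraMapInv]
  exact DFunLike.congr_fun this _

variable {T} in
theorem Ad_par_dpar (x y : Fin T.rank → ℝ) : Ad E (T.par x) (T.dpar y) = T.dpar y := by
  have h0 : T.par 0 = 1 := (T.kernel 0).2 ⟨0, by ext i; simp [toReal]⟩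
  have e : (mfderiv 𝓘(ℝ, Fin T.rank → ℝ) 𝓘(ℝ, E) ((fun h : G => T.par x * h * (T.par x)⁻¹) ∘ T.par)
        0 : (Fin T.rank → ℝ) →L[ℝ] E) =
      (mfderiv 𝓘(ℝ, E) 𝓘(ℝ, E) (fun h : G => T.par x * h * (T.par x)⁻¹) (T.par 0) : E →L[ℝ] E).comp
        (mfderiv 𝓘(ℝ, Fin T.rank → ℝ) 𝓘(ℝ, E) T.par 0 : (Fin T.rank → ℝ) →L[ℝ] E) :=
    mfderiv_comp (I' := 𝓘(ℝ, E)) (0 : Fin T.rank → ℝ)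
      ((contMDiff_conj E (T.par x)).mdifferentiable (by simp) _)
      (T.smooth.mdifferentiable (by simp) _)
  have e2 : ((fun h : G => T.par x * h * (T.par x)⁻¹) ∘ T.par) = T.par := by
    funext z
    change T.par x * T.par z * (T.par x)⁻¹ = T.par z
    rw [← T.map_add, add_comm, T.map_add, mul_inv_cancel_right]
  rw [e2, h0] at e
  exact (congrArg (fun L : (Fin T.rank → ℝ) →L[ℝ] E => L y) e).symm

variable {T} in
theorem Ad_par_lie (x : Fin T.rank → ℝ) (ξ : T.lie) : Ad E (T.par x) ξ = ξ := by
  obtain ⟨ξ, y, rfl⟩ := ξ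
  exact Ad_par_dpar x y

/-- Ad t is orthogonal and fixes 𝔱 pointwise, hence the inner products with 𝔱 do not change. -/
theorem lieProj_Ad (x : Fin T.rank → ℝ) (ξ : Lie E G) :
    lieProj B T (Ad E (T.par x) ξ) = lieProj B T ξ := by
  set d := lieProj B T (Ad E (T.par x) ξ) - lieProj B T ξ with hd
  have h1 : ∀ s : T.lie, B.form s d = 0 := by
    intro s
    have h2 : (d : Lie E G) = (lieProj B T (Ad E (T.par x) ξ) : Lie E G) - lieProj B T ξ := rfl
    rw [h2, map_sub, form_lieProj, form_lieProj, sub_eq_zero]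
    conv_lhs => rw [← Ad_par_lie x s]
    exact B.invariant _ _ _
  by_contra hne
  have h3 : (d : Lie E G) ≠ 0 := fun h => hne (sub_eq_zero.1 (Subtype.ext h))
  exact (B.pos _ h3).ne' (h1 d)

theorem clProj_clAd (x : Fin T.rank → ℝ) (y : ClC B.form) :
    clProj B T (clAd B (T.par x) y) = clProj B T y := by
  refine LinearMap.congr_fun (f := clProj B T ∘ₗ clAd B (T.par x))
    (g := clProj B T) (complexify_induction fun a => ?_) y
  simp only [LinearMap.comp_apply, clAd_tmul, clProj_tmul, symbol_map B.symm]
  congr 2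
  have : (ExteriorAlgebra.map (lieProj B T)).comp
      (ExteriorAlgebra.map (adIsometry B (T.par x)).toLinearMap) =
        ExteriorAlgebra.map (lieProj B T) := by
    rw [ExteriorAlgebra.map_comp_map]
    congr 1
    ext ξ
    exact congrArg Subtype.val (lieProj_Ad B T x ξ)
  exact DFunLike.congr_fun this _

end Projection

/-! ### The twist by the classical r-matrix -/

section Twist

variable {E G : Type*} [NormedAddCommGroup E] [NormedSpace ℝ E] [FiniteDimensional ℝ E]
  [TopologicalSpace G] [ChartedSpace E G] [Group G] [LieGroup 𝓘(ℝ, E) ∞ G]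
  (B : InvariantInnerProduct E G)

/-- The contractions on the complexified Clifford algebra of the Lie algebra. -/
def clIotaFam : OpFamily (Lie E G) (ClC B.form) := clIota B.form

theorem clTwist_comm (r) (S : Module.End ℂ (ClC B.form))
    (h : S ∘ₗ quadOp (clIotaFam B) r = quadOp (clIotaFam B) r ∘ₗ S) (y : ClC B.form) :
    S (clTwist B r y) = clTwist B r (S y) := by
  have : FiniteDimensional ℝ (Lie E G) := inferInstanceAs (FiniteDimensional ℝ E)
  have hn : IsNilpotent ((1 / 2 : ℂ) • quadOp (clIotaFam B) r) :=
    (isNilpotent_quadOp (clIotaFam B) (clIota_sq B.symm) r).smul _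
  exact LinearMap.congr_fun (nilExp_intertwine hn hn S
    (by rw [LinearMap.comp_smul, LinearMap.smul_comp, h])) y

theorem clTwist_clIota (r) (ξ : Lie E G) (y : ClC B.form) :
    clIota B.form ξ (clTwist B r y) = clTwist B r (clIota B.form ξ y) :=
  clTwist_comm B r _ (quadOp_anticomm (J := clIotaFam B) (J' := clIotaFam B) _
    (fun η v => clIota_comm B.symm ξ η v) r) y

theorem clTwist_clParity (r) (y : ClC B.form) :
    clParity B.form (clTwist B r y) = clTwist B r (clParity B.form y) :=
  clTwist_comm B r _ (quadOp_anticomm (J := clIotaFam B) (J' := clIotaFam B) _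
    (fun η v => clParity_clIota η v) r) y

theorem clTwist_clAd (r) (g : G)
    (hr : TensorProduct.map ((Ad E g).baseChange ℂ) ((Ad E g).baseChange ℂ) r = r)
    (y : ClC B.form) :
    clAd B g (clTwist B r y) = clTwist B r (clAd B g y) := by
  have h := quadOp_intertwine (J := clIotaFam B) (J' := clIotaFam B) (Ad E g) (clAd B g)
    (fun η v => clAd_clIota B g η v) r
  rw [hr] at h
  exact clTwist_comm B r _ h y

theorem conjC_smul {𝔞 : Type*} [AddCommGroup 𝔞] [Module ℝ 𝔞] (c : ℂ) (x : ℂ ⊗[ℝ] 𝔞) :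
    conjC 𝔞 (c • x) = (starRingEnd ℂ) c • conjC 𝔞 x := by
  induction x using TensorProduct.induction_on with
  | zero => simp
  | add x y hx hy => rw [smul_add, map_add, map_add, smul_add, hx, hy]
  | tmul d x => simp [conjC, TensorProduct.smul_tmul']

theorem conjC_baseChange {𝔞 : Type*} [AddCommGroup 𝔞] [Module ℝ 𝔞] (f : 𝔞 →ₗ[ℝ] 𝔞)
    (x : ℂ ⊗[ℝ] 𝔞) : conjC 𝔞 (f.baseChange ℂ x) = f.baseChange ℂ (conjC 𝔞 x) := by
  induction x using TensorProduct.induction_on with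
  | zero => simp
  | add x y hx hy => rw [map_add, map_add, map_add, map_add, hx, hy]
  | tmul d x => simp [conjC]

theorem character_mul_conj {r : ℕ} (ν : Fin r → ℤ) (x : Fin r → ℝ) :
    (character ν).1 x * (starRingEnd ℂ) ((character ν).1 x) = 1 := by
  have h : (character ν).1 x = Complex.exp (((2 * Real.pi * dot (toReal ν) x : ℝ) : ℂ) * Complex.I) := by
    change Complex.exp _ = _
    congr 1
    push_cast
    ring
  rw [h, Complex.mul_conj, Complex.normSq_eq_norm_sq, Complex.norm_exp_ofReal_mul_I]
  simp

/-- The root vector and its conjugate have opposite weights, so each of their tensor products has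
weight zero. -/
theorem rMatrix_invariant (T : MaximalTorus E G) (ξ₀ : Fin T.rank → ℝ)
    (e : (Fin T.rank → ℤ) → ℂ ⊗[ℝ] Lie E G) (he : T.IsRootBasis B ξ₀ e) (x : Fin T.rank → ℝ) :
    TensorProduct.map ((Ad E (T.par x)).baseChange ℂ) ((Ad E (T.par x)).baseChange ℂ)
      (T.rMatrix ξ₀ e) = T.rMatrix ξ₀ e := by
  rw [MaximalTorus.rMatrix, map_smul]
  congr 1
  refine finsum_mem_induction
    (fun z => TensorProduct.map ((Ad E (T.par x)).baseChange ℂ) ((Ad E (T.par x)).baseChange ℂ) z = z)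
    (by simp) (fun a b ha hb => by rw [map_add, ha, hb]) fun α hα => ?_
  have h1 := (he α hα).1 x
  have h2 : (Ad E (T.par x)).baseChange ℂ (conjC _ (e α)) =
      (starRingEnd ℂ) ((character α).1 x) • conjC _ (e α) := by
    rw [← conjC_baseChange, h1, conjC_smul]
  rw [map_sub, TensorProduct.map_tmul, TensorProduct.map_tmul, h1, h2, TensorProduct.smul_tmul_smul,
    TensorProduct.smul_tmul_smul, character_mul_conj, mul_comm, character_mul_conj, one_smul,
    one_smul]

end Twist

/-! ### Weil and Cartan models for G and T -/

section Models

variable {E G F M : Type*} [NormedAddCommGroup E] [NormedSpace ℝ E] [FiniteDimensional ℝ E]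
  [NormedAddCommGroup F]
  [NormedSpace ℝ F] [TopologicalSpace G] [ChartedSpace E G] [Group G] [LieGroup 𝓘(ℝ, E) ∞ G]
  [TopologicalSpace M] [ChartedSpace F M] [IsManifold 𝓘(ℝ, F) ∞ M]
  [MulAction G M] [ContMDiffSMul 𝓘(ℝ, E) 𝓘(ℝ, F) ∞ G M]
  (B : InvariantInnerProduct E G) (T : MaximalTorus E G) (ξ₀ : Fin T.rank → ℝ)

section

attribute [local instance] distFormsAddCommGroup

variable (F M) in
/-- The contractions with elements of the Lie algebra of the maximal torus. -/
def torusIota : OpFamily T.lie (distForms F M (T.distMinus B ξ₀)) :=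
  distIota E G F M (T.distMinus B ξ₀) ∘ₗ T.lie.subtype

theorem torusIota_sq (ξ : T.lie) (u : distForms F M (T.distMinus B ξ₀)) :
    torusIota F M B T ξ₀ ξ (torusIota F M B T ξ₀ ξ u) = 0 := distIota_sq (ξ : Lie E G) u

theorem hardy_torusIota (x : Fin T.rank → ℝ) (ξ : T.lie)
    (u : distForms F M (T.distMinus B ξ₀)) :
    torusIota F M B T ξ₀ ξ (actHardyForms F M T B ξ₀ x u) =
      actHardyForms F M T B ξ₀ x (torusIota F M B T ξ₀ ξ u) := by
  refine distForms_ext fun φ => ?_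
  change iota E G F M ξ (pull E F (T.par x)⁻¹ (u.1 φ)) =
    pull E F (T.par x)⁻¹ (iota E G F M ξ (u.1 φ))
  have h : Ad E (T.par x)⁻¹ (ξ : Lie E G) = ξ := by
    conv_lhs => rw [← Ad_par_lie x ξ]
    exact Ad_inv_Ad _ _
  rw [iota_pull, h]

end

theorem exists_equivG : ∃ P : weilBasicG F M B ≃ₗ[ℂ] cartanG F M E G,
    ∀ w : weilBasicG F M B,
      (P w : distForms F M (distG E G)) = pHor F M B.form (distG E G) w := by
  have : FiniteDimensional ℝ (Lie E G) := inferInstanceAs (FiniteDimensional ℝ E)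
  let := distFormsAddCommGroup (F := F) (M := M) (distG E G)
  have hι : ∀ (g : G) (ξ : Lie E G), ∃ η,
      (∀ y, clIota B.form ξ (clAd B g y) = clAd B g (clIota B.form η y)) ∧
      ∀ u, distIota E G F M (distG E G) ξ (actDistForms E F M g u) =
        actDistForms E F M g (distIota E G F M (distG E G) η u) := by
    intro g ξ
    refine ⟨Ad E g⁻¹ ξ, fun y => ?_, fun u => ?_⟩
    · rw [clAd_clIota, Ad_Ad_inv]
    · rw [← act_distIota, Ad_Ad_inv]
  exact exists_basicTensor_equiv (X := distForms F M (distG E G)) (I := G) B.symm B.pos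
    (distIota E G F M (distG E G)) distIota_sq (clAd B) (actDistForms E F M) hι
    (clAd_clParity B) (clHor_clAd B)

theorem exists_equivT : ∃ P : weilBasicT F M T B ξ₀ ≃ₗ[ℂ] cartanT F M T B ξ₀,
    ∀ w : weilBasicT F M T B ξ₀, (P w : distForms F M (T.distMinus B ξ₀)) =
      pHor F M (B.form.restrict T.lie) (T.distMinus B ξ₀) w := by
  have : FiniteDimensional ℝ (Lie E G) := inferInstanceAs (FiniteDimensional ℝ E)
  let := distFormsAddCommGroup (F := F) (M := M) (T.distMinus B ξ₀)
  exact exists_basicTensor_equiv (X := distForms F M (T.distMinus B ξ₀)) (I := Fin T.rank → ℝ)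
    (restrict_symm B T) (restrict_pos B T) (torusIota F M B T ξ₀) (torusIota_sq B T ξ₀)
    (fun _ => LinearMap.id) (actHardyForms F M T B ξ₀)
    (fun x ξ => ⟨ξ, fun _ => rfl, hardy_torusIota B T ξ₀ x ξ⟩) (fun _ _ => rfl) (fun _ _ => rfl)

/-- A map of test functions induces a map between forms with distributional coefficients. -/
def distFormsTranspose {𝒟 𝒟' : Type*} [AddCommGroup 𝒟] [Module ℂ 𝒟] [AddCommGroup 𝒟'] [Module ℂ 𝒟']
    {D : Submodule ℂ (𝒟 →ₗ[ℂ] ℂ)} {D' : Submodule ℂ (𝒟' →ₗ[ℂ] ℂ)} (Ψ : 𝒟' →ₗ[ℂ] 𝒟)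
    (hΨ : ∀ v ∈ D, v ∘ₗ Ψ ∈ D') : distForms F M D →ₗ[ℂ] distForms F M D' where
  toFun u := ⟨u.1 ∘ₗ Ψ, fun m ℓ => hΨ _ (u.2 m ℓ)⟩
  map_add' _ _ := rfl
  map_smul' _ _ := rfl

/-- By `h3` the conjugation action of T on 𝓔'(G) becomes trivial after precomposition with Ψ; only
the action on Ω(M) is left, as on the torus side. -/
theorem map_twist (e : (Fin T.rank → ℤ) → ℂ ⊗[ℝ] Lie E G)
    (he : T.IsRootBasis B ξ₀ e) (Ψ : periodicFun T.rank →ₗ[ℂ] smoothFun E G)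
    (h1 : ∀ v ∈ distG E G, v ∘ₗ Ψ ∈ T.distMinus B ξ₀)
    (h3 : ∀ x φ, conjFun E (T.par x) (Ψ φ) = Ψ φ) :
    (∀ w : weilBasicG F M B,
      TensorProduct.map (clProj B T ∘ₗ clTwist B (T.rMatrix ξ₀ e)) (distFormsTranspose Ψ h1)
        (w : WeilForms F M B.form (distG E G)) ∈ weilBasicT F M T B ξ₀) ∧
    ∀ w : weilBasicG F M B, pHor F M (B.form.restrict T.lie) (T.distMinus B ξ₀)
      (TensorProduct.map (clProj B T ∘ₗ clTwist B (T.rMatrix ξ₀ e)) (distFormsTranspose Ψ h1)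
        (w : WeilForms F M B.form (distG E G))) =
      postComp (T.distMinus B ξ₀) (expBivector E G F M (T.rMatrix ξ₀ e))
        (fibrewise_expBivector E G F M (T.rMatrix ξ₀ e))
        (distFormsTranspose Ψ h1 (pHor F M B.form (distG E G) w)) := by
  have : FiniteDimensional ℝ (Lie E G) := inferInstanceAs (FiniteDimensional ℝ E)
  let := distFormsAddCommGroup (F := F) (M := M) (distG E G)
  let := distFormsAddCommGroup (F := F) (M := M) (T.distMinus B ξ₀)
  have hS₀ : ∀ u : distForms F M (distG E G), distFormsTranspose (F := F) (M := M) Ψ h1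
      (nilExp ((1 / 2 : ℂ) • quadOp (distIota E G F M (distG E G)) (T.rMatrix ξ₀ e)) u) =
      (postComp (T.distMinus B ξ₀) (expBivector E G F M (T.rMatrix ξ₀ e))
        (fibrewise_expBivector E G F M (T.rMatrix ξ₀ e)) ∘ₗ
        distFormsTranspose (F := F) (M := M) Ψ h1) u :=
    fun u => distForms_ext fun φ => nilExp_distIota _ u (Ψ φ)
  have hact : ∀ (x : Fin T.rank → ℝ) (u : distForms F M (distG E G)),
      distFormsTranspose (F := F) (M := M) Ψ h1 (actDistForms E F M (T.par x) u) =
        actHardyForms F M T B ξ₀ x (distFormsTranspose (F := F) (M := M) Ψ h1 u) := by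
    intro x u
    refine distForms_ext fun φ => ?_
    change pull E F (T.par x)⁻¹ (u.1 (conjFun E (T.par x) (Ψ φ))) =
        pull E F (T.par x)⁻¹ (u.1 (Ψ φ))
    rw [h3]
  exact map_twist_basicTensor (X := distForms F M (distG E G))
    (X' := distForms F M (T.distMinus B ξ₀)) (I := G) (I' := Fin T.rank → ℝ)
    B.symm (distIota E G F M (distG E G)) distIota_sq (torusIota F M B T ξ₀) (fun ξ => (ξ : Lie E G))
    (T.rMatrix ξ₀ e) (clTwist B (T.rMatrix ξ₀ e)) rfl (clProj B T) (distFormsTranspose Ψ h1)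
    (postComp (T.distMinus B ξ₀) (expBivector E G F M (T.rMatrix ξ₀ e))
        (fibrewise_expBivector E G F M (T.rMatrix ξ₀ e)) ∘ₗ distFormsTranspose Ψ h1) hS₀
    (clTwist_clIota B _) (clTwist_clParity B _) (clProj_clIota B T) (clProj_clParity B T)
    (clHor_clProj B T) (fun ξ u => rfl) T.par (clAd B) (actDistForms E F M)
    (actHardyForms F M T B ξ₀)
    (fun x y => by rw [← clTwist_clAd B _ _ (rMatrix_invariant B T ξ₀ e he x), clProj_clAd]) hact

/-- A diagram chase with all spaces abstract: the restriction is the given map cut down to basic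
elements, and the last identity is checked on c = PG w. -/
theorem exists_restriction_assembly {A A' X X' W W' : Type*}
    [AddCommGroup A] [Module ℂ A] [AddCommGroup A'] [Module ℂ A']
    [AddCommMonoid X] [Module ℂ X] [AddCommMonoid X'] [Module ℂ X']
    [AddCommMonoid W] [Module ℂ W] [AddCommMonoid W'] [Module ℂ W']
    {bG : Submodule ℂ W} {cG : Submodule ℂ X} {bT : Submodule ℂ W'} {cT : Submodule ℂ X'}
    (r : A →ₗ[ℂ] A') (rΩ : X →ₗ[ℂ] X')
    (hG : W →ₗ[ℂ] X) (hT : W' →ₗ[ℂ] X') (K : (X →ₗ[ℂ] X') → W →ₗ[ℂ] W')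
    (hK : ∀ w : bG, K rΩ w ∈ bT) (Q : X' →ₗ[ℂ] X') (p₁ : (A →ₗ[ℂ] A') → Prop)
    (p₂ : (A →ₗ[ℂ] A') → (X →ₗ[ℂ] X') → Prop) (h₁ : p₁ r) (h₂ : p₂ r rΩ)
    (hPG : ∃ PG : bG ≃ₗ[ℂ] cG, ∀ w : bG, (PG w : X) = hG w)
    (hPT : ∃ PT : bT ≃ₗ[ℂ] cT, ∀ w : bT, (PT w : X') = hT w)
    (hKQ : ∀ w : bG, hT (K rΩ w) = Q (rΩ (hG w))) :
    ∃ (r : A →ₗ[ℂ] A') (rΩ : X →ₗ[ℂ] X') (PG : bG ≃ₗ[ℂ] cG) (PT : bT ≃ₗ[ℂ] cT)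
      (R : bG →ₗ[ℂ] bT), p₁ r ∧ p₂ r rΩ ∧ (∀ w : bG, (PG w : X) = hG w) ∧
      (∀ w : bT, (PT w : X') = hT w) ∧ (∀ w : bG, (R w : W') = K rΩ w) ∧
      ∀ c : cG, (PT (R (PG.symm c)) : X') = Q (rΩ c) := by
  obtain ⟨PG, hPG⟩ := hPG
  obtain ⟨PT, hPT⟩ := hPT
  refine ⟨r, rΩ, PG, PT, (K rΩ ∘ₗ Submodule.subtype _).codRestrict _ hK, h₁, h₂, hPG, hPT,
    fun w => rfl, fun c => ?_⟩
  obtain ⟨w, rfl⟩ := PG.surjective c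
  rw [LinearEquiv.symm_apply_apply, hPT, hPG]
  exact hKQ w

/-- The Weil model, the Cartan model and the restriction map, given the map of test functions whose
transpose is `r_G^T`. -/
theorem exists_restriction_of_testMap (e : (Fin T.rank → ℤ) → ℂ ⊗[ℝ] Lie E G)
    (he : T.IsRootBasis B ξ₀ e) (Ψ : periodicFun T.rank →ₗ[ℂ] smoothFun E G)
    (h1 : ∀ v ∈ distG E G, v ∘ₗ Ψ ∈ T.distMinus B ξ₀)
    (h2 : ∀ μ ν : Fin T.rank → ℤ, T.IsDominant B ξ₀ μ → toReal ν = toReal μ + T.rho ξ₀ →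
      Ψ (character ν) = T.spherical ξ₀ μ)
    (h3 : ∀ x φ, conjFun E (T.par x) (Ψ φ) = Ψ φ) :
    ∃ (rGT : distG E G →ₗ[ℂ] T.distMinus B ξ₀)
      (rGTΩ : distForms F M (distG E G) →ₗ[ℂ] distForms F M (T.distMinus B ξ₀))
      (PG : weilBasicG F M B ≃ₗ[ℂ] cartanG F M E G)
      (PT : weilBasicT F M T B ξ₀ ≃ₗ[ℂ] cartanT F M T B ξ₀)
      (R : weilBasicG F M B →ₗ[ℂ] weilBasicT F M T B ξ₀),
      T.IsRestrictionMap B ξ₀ rGT ∧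
      IsTensorId rGT rGTΩ ∧
      (∀ w : weilBasicG F M B,
        (PG w : distForms F M (distG E G)) = pHor F M B.form (distG E G) w) ∧
      (∀ w : weilBasicT F M T B ξ₀,
        (PT w : distForms F M (T.distMinus B ξ₀)) =
          pHor F M (B.form.restrict T.lie) (T.distMinus B ξ₀) w) ∧
      (∀ w : weilBasicG F M B,
        (R w : WeilForms F M (B.form.restrict T.lie) (T.distMinus B ξ₀)) =
          TensorProduct.map (clProj B T ∘ₗ clTwist B (T.rMatrix ξ₀ e)) rGTΩ
            (w : WeilForms F M B.form (distG E G))) ∧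
      ∀ c : cartanG F M E G,
        (PT (R (PG.symm c)) : distForms F M (T.distMinus B ξ₀)) =
          postComp (T.distMinus B ξ₀) (expBivector E G F M (T.rMatrix ξ₀ e))
            (fibrewise_expBivector E G F M (T.rMatrix ξ₀ e))
            (rGTΩ (c : distForms F M (distG E G))) := by
  have : FiniteDimensional ℝ (Lie E G) := inferInstanceAs (FiniteDimensional ℝ E)
  let rGT : distG E G →ₗ[ℂ] T.distMinus B ξ₀ :=
    { toFun := fun u => ⟨u.1 ∘ₗ Ψ, h1 _ u.2⟩
      map_add' := fun _ _ => rfl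
      map_smul' := fun _ _ => rfl }
  have hK := map_twist B T ξ₀ (F := F) (M := M) e he Ψ h1 h3
  have hr : T.IsRestrictionMap B ξ₀ rGT := by
    intro u μ ν hμ hν
    change u.1 (Ψ (character ν)) = _
    rw [h2 μ ν hμ hν]
  exact exists_restriction_assembly (X := distForms F M (distG E G))
    (X' := distForms F M (T.distMinus B ξ₀)) (W := WeilForms F M B.form (distG E G))
    (W' := WeilForms F M (B.form.restrict T.lie) (T.distMinus B ξ₀))
    rGT (distFormsTranspose Ψ h1)
    (pHor F M B.form (distG E G)) (pHor F M (B.form.restrict T.lie) (T.distMinus B ξ₀))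
    (fun rGTΩ => TensorProduct.map (clProj B T ∘ₗ clTwist B (T.rMatrix ξ₀ e)) rGTΩ)
    hK.1 (postComp (T.distMinus B ξ₀) (expBivector E G F M (T.rMatrix ξ₀ e))
      (fibrewise_expBivector E G F M (T.rMatrix ξ₀ e)))
    (fun rGT => T.IsRestrictionMap B ξ₀ rGT) (fun rGT rGTΩ => IsTensorId rGT rGTΩ) hr
    (fun u m ℓ => rfl) (exists_equivG B) (exists_equivT B T ξ₀) hK.2

end Models

/-! ### Fourier coefficients on the torus -/

section Fourier

open MeasureTheory

variable {r : ℕ}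

theorem toReal_add (m n : Fin r → ℤ) : toReal (m + n) = toReal m + toReal n := by
  ext i; simp [toReal]

theorem toReal_neg (n : Fin r → ℤ) : toReal (-n) = -toReal n := by
  ext i; simp [toReal]

theorem toReal_injective : Function.Injective (toReal (r := r)) := fun m n h => by
  ext i
  have h1 : (m i : ℝ) = n i := congrFun h i
  exact_mod_cast h1

/-- Inverse powers of the norm are summable over a lattice as soon as the exponent exceeds the rank.
-/
theorem exists_summable_norm_toReal_pow (r : ℕ) :
    ∃ n : ℕ, Summable fun ν : Fin r → ℤ => ((1 + ‖toReal ν‖) ^ n)⁻¹ := by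
  let L : Submodule ℤ (Fin r → ℝ) := Submodule.span ℤ (Set.range (Pi.basisFun ℝ (Fin r)))
  have hmem : ∀ ν : Fin r → ℤ, toReal ν ∈ L := by
    intro ν
    have h : toReal ν = ∑ i, ν i • Pi.basisFun ℝ (Fin r) i := by
      ext j
      simp [toReal, Finset.sum_apply, Pi.single_apply]
    rw [h]
    exact Submodule.sum_mem _ fun i _ => Submodule.smul_mem _ _ (Submodule.subset_span ⟨i, rfl⟩)
  have h := ZLattice.summable_norm_pow_inv L (Module.finrank ℤ L + 1) (Nat.lt_succ_self _)
  have h2 := h.comp_injective (i := fun ν : Fin r → ℤ => (⟨toReal ν, hmem ν⟩ : L))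
    fun m n hmn => toReal_injective (Subtype.ext_iff.1 hmn)
  refine ⟨Module.finrank ℤ L + 1, h2.of_norm_bounded_eventually ?_⟩
  -- At ν = 0 the comparison fails, since the inverse norm takes the default value 0 there.
  refine (Set.finite_singleton (0 : Fin r → ℤ)).subset fun ν hν => ?_
  by_contra h0
  refine hν ?_
  have hpos : 0 < ‖toReal ν‖ := norm_pos_iff.2 fun h1 => h0 (toReal_injective
    (by rw [h1]; ext i; simp [toReal]))
  simp only [Function.comp_apply, Submodule.coe_norm, inv_pow, norm_inv, norm_pow]
  have h3 : ‖1 + ‖toReal ν‖‖ = 1 + ‖toReal ν‖ := Real.norm_of_nonneg (by positivity)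
  rw [Set.mem_ofPred_eq, h3]
  gcongr
  linarith

theorem periodic_add_single (φ : periodicFun r) (j : Fin r) (x : Fin r → ℝ) :
    φ.1 (x + Pi.single j 1) = φ.1 x := by
  have h : (Pi.single j 1 : Fin r → ℝ) = toReal (Pi.single j 1) := by
    ext i
    by_cases hi : i = j
    · subst hi; simp [toReal]
    · simp [toReal, hi]
  rw [h]
  exact φ.2.2 x _

theorem hasFDerivAt_periodic (φ : periodicFun r) (x : Fin r → ℝ) :
    HasFDerivAt φ.1 (fderiv ℝ φ.1 x) x :=
  (φ.2.1.differentiable (by simp) x).hasFDerivAt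

/-- The partial derivatives of a periodic function. -/
def pderivPeriodic (j : Fin r) (φ : periodicFun r) : periodicFun r :=
  ⟨fun x => fderiv ℝ φ.1 x (Pi.single j 1), by
    refine ⟨(φ.2.1.fderiv_right (m := ∞) (by simp)).clm_apply contDiff_const, fun x n => ?_⟩
    have h : φ.1 = fun y => φ.1 (y + toReal n) := funext fun y => (φ.2.2 y n).symm
    have h1 : fderiv ℝ φ.1 x = fderiv ℝ φ.1 (x + toReal n) := by
      conv_lhs => rw [h, fderiv_comp_add_right]
    exact congrArg (fun L : (Fin r → ℝ) →L[ℝ] ℂ => L (Pi.single j 1)) h1.symm⟩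

/-- Divergence theorem on the unit cube for the field whose only component is φ in direction j:
opposite faces contribute equally by periodicity. -/
theorem integral_pderivPeriodic (j : Fin r) (φ : periodicFun r) :
    ∫ x in Set.Icc (0 : Fin r → ℝ) 1, (pderivPeriodic j φ).1 x = 0 := by
  obtain _ | n := r
  · exact j.elim0
  have hdiv := integral_divergence_of_hasFDerivAt_off_countable' (0 : Fin (n + 1) → ℝ) 1
    zero_le_one (fun i => if i = j then φ.1 else 0)
    (fun i x => if i = j then fderiv ℝ φ.1 x else 0) ∅ Set.countable_empty
    (fun i => by
      split_ifs
      · exact φ.2.1.continuous.continuousOn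
      · exact continuousOn_const)
    (fun x _ i => by
      by_cases hi : i = j
      · simpa [hi] using hasFDerivAt_periodic φ x
      · simp only [hi, if_false]
        exact hasFDerivAt_const (0 : ℂ) x)
    (by
      have h : (fun x => ∑ i, (if i = j then fderiv ℝ φ.1 x else 0 : (Fin (n + 1) → ℝ) →L[ℝ] ℂ)
          (Pi.single i 1)) = (pderivPeriodic j φ).1 := by
        funext x
        rw [Finset.sum_eq_single j]
        · simp [pderivPeriodic]
        · intro i _ hi; simp [hi]
        · simp
      rw [h]
      exact (pderivPeriodic j φ).2.1.continuous.continuousOn.integrableOn_compact isCompact_Icc)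
  have h : ∀ x, ∑ i, (if i = j then fderiv ℝ φ.1 x else 0 : (Fin (n + 1) → ℝ) →L[ℝ] ℂ)
      (Pi.single i 1) = (pderivPeriodic j φ).1 x := by
    intro x
    rw [Finset.sum_eq_single j]
    · simp [pderivPeriodic]
    · intro i _ hi; simp [hi]
    · simp
  simp only [h] at hdiv
  rw [hdiv]
  refine Finset.sum_eq_zero fun i _ => ?_
  by_cases hi : i = j
  · subst hi
    rw [sub_eq_zero]
    congr 1
    funext x
    have h1 : (i.insertNth (1 : ℝ) x : Fin (n + 1) → ℝ) =
        (i.insertNth (0 : ℝ) x : Fin (n + 1) → ℝ) + Pi.single i 1 := by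
      refine (Fin.insertNth_eq_iff).2 ⟨by simp, ?_⟩
      ext k
      simp [Fin.removeNth]
    have h2 := periodic_add_single φ i (i.insertNth (0 : ℝ) x : Fin (n + 1) → ℝ)
    simpa [h1] using h2
  · simp [hi]

theorem dot_add_left (a b x : Fin r → ℝ) : dot (a + b) x = dot a x + dot b x := by
  simp [dot, add_mul, Finset.sum_add_distrib]

theorem dot_neg_left (a x : Fin r → ℝ) : dot (-a) x = -dot a x := by
  simp [dot]

theorem character_add (m n : Fin r → ℤ) (x : Fin r → ℝ) :
    (character (m + n)).1 x = (character m).1 x * (character n).1 x := by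
  simp only [character, toReal_add, dot_add_left]
  rw [← Complex.exp_add]
  push_cast
  ring_nf

theorem character_zero (x : Fin r → ℝ) : (character (0 : Fin r → ℤ)).1 x = 1 := by
  simp [character, toReal, dot]

theorem norm_character (n : Fin r → ℤ) (x : Fin r → ℝ) : ‖(character n).1 x‖ = 1 := by
  simp only [character]
  rw [show 2 * (Real.pi : ℂ) * Complex.I * ((dot (toReal n) x : ℝ) : ℂ) =
    ((2 * Real.pi * dot (toReal n) x : ℝ) : ℂ) * Complex.I by push_cast; ring]
  exact Complex.norm_exp_ofReal_mul_I _

theorem hasFDerivAt_character (n : Fin r → ℤ) (x v : Fin r → ℝ) :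
    fderiv ℝ (character n).1 x v =
      (2 * Real.pi * Complex.I * (dot (toReal n) v : ℝ)) * (character n).1 x := by
  have h1 : HasDerivAt (fun s : ℝ => x + s • v) v 0 := by
    simpa using ((hasDerivAt_id (0 : ℝ)).smul_const v).const_add x
  have h2 : HasDerivAt (fun s : ℝ => (character n).1 (x + s • v)) (fderiv ℝ (character n).1 x v) 0 := by
    have := hasFDerivAt_periodic (character n) (x + (0 : ℝ) • v)
    have h3 := this.comp_hasDerivAt (0 : ℝ) h1
    rw [zero_smul, add_zero] at h3
    exact h3
  refine h2.unique ?_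
  have h4 : ∀ s : ℝ, (character n).1 (x + s • v) = Complex.exp (s *
      (2 * Real.pi * Complex.I * (dot (toReal n) v : ℝ))) * (character n).1 x := by
    intro s
    simp only [character]
    rw [← Complex.exp_add]
    congr 1
    have : dot (toReal n) (x + s • v) = dot (toReal n) x + s * dot (toReal n) v := by
      simp only [dot, Pi.add_apply, Pi.smul_apply, smul_eq_mul, Finset.mul_sum,
        ← Finset.sum_add_distrib]
      exact Finset.sum_congr rfl fun i _ => by ring
    rw [this]
    push_cast
    ring
  simp only [h4]
  have h5 : HasDerivAt (fun s : ℝ => (s : ℂ) * (2 * Real.pi * Complex.I * (dot (toReal n) v : ℝ)))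
      (2 * Real.pi * Complex.I * (dot (toReal n) v : ℝ)) 0 := by
    simpa using (Complex.ofRealCLM.hasDerivAt (x := (0 : ℝ))).mul_const
      (2 * Real.pi * Complex.I * (dot (toReal n) v : ℝ) : ℂ)
  simpa using h5.cexp.mul_const ((character n).1 x)

theorem dot_single (ν : Fin r → ℝ) (j : Fin r) : dot ν (Pi.single j 1) = ν j := by
  simp [dot, Pi.single_apply]

/-- The product of periodic functions. -/
def mulPeriodic (φ ψ : periodicFun r) : periodicFun r :=
  ⟨fun x => φ.1 x * ψ.1 x, φ.2.1.mul ψ.2.1, fun x n => congrArg₂ (· * ·) (φ.2.2 x n) (ψ.2.2 x n)⟩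

/-- The Fourier coefficients of a periodic function. -/
def fourierCoeffT (ν : Fin r → ℤ) : periodicFun r →ₗ[ℂ] ℂ where
  toFun φ := ∫ x in Set.Icc (0 : Fin r → ℝ) 1, φ.1 x * (character (-ν)).1 x
  map_add' φ ψ := by
    have h : ∀ φ : periodicFun r, IntegrableOn (fun x => φ.1 x * (character (-ν)).1 x)
        (Set.Icc (0 : Fin r → ℝ) 1) := fun φ =>
      (mulPeriodic φ (character (-ν))).2.1.continuous.continuousOn.integrableOn_compact
        isCompact_Icc
    simp only [Submodule.coe_add, Pi.add_apply, add_mul]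
    exact integral_add (h φ) (h ψ)
  map_smul' c φ := by
    simp only [Submodule.coe_smul, Pi.smul_apply, smul_eq_mul, mul_assoc, RingHom.id_apply]
    exact integral_const_mul _ _

/-- Integration by parts: the derivative of φ · t^(-ν) has zero integral over a period. -/
theorem fourierCoeffT_pderivPeriodic (ν : Fin r → ℤ) (j : Fin r) (φ : periodicFun r) :
    fourierCoeffT ν (pderivPeriodic j φ) = (2 * Real.pi * Complex.I * ν j) * fourierCoeffT ν φ := by
  have h := integral_pderivPeriodic j (mulPeriodic φ (character (-ν)))
  have h1 : ∀ x, (pderivPeriodic j (mulPeriodic φ (character (-ν)))).1 x =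
      (pderivPeriodic j φ).1 x * (character (-ν)).1 x -
        (2 * Real.pi * Complex.I * ν j) * (φ.1 x * (character (-ν)).1 x) := by
    intro x
    have h2 := (hasFDerivAt_periodic φ x).mul (hasFDerivAt_periodic (character (-ν)) x)
    have h3 : fderiv ℝ (mulPeriodic φ (character (-ν))).1 x = _ := h2.fderiv
    simp only [pderivPeriodic, h3]
    simp only [add_apply, smul_apply, smul_eq_mul,
      hasFDerivAt_character, dot_single, toReal_neg]
    simp only [Pi.neg_apply, toReal]
    push_cast
    ring
  simp only [h1] at h
  rw [integral_sub, integral_const_mul, sub_eq_zero] at h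
  · exact h
  · exact (mulPeriodic _ (character (-ν))).2.1.continuous.continuousOn.integrableOn_compact
        isCompact_Icc
  · exact ((mulPeriodic φ (character (-ν))).2.1.continuous.continuousOn.integrableOn_compact
        isCompact_Icc).const_mul _

theorem fourierCoeffT_character_self (ν : Fin r → ℤ) : fourierCoeffT ν (character ν) = 1 := by
  have h : ∀ x, (character ν).1 x * (character (-ν)).1 x = 1 := fun x => by
    rw [← character_add, add_neg_cancel, character_zero]
  change ∫ x in Set.Icc (0 : Fin r → ℝ) 1, (character ν).1 x * (character (-ν)).1 x = 1
  simp [h, Measure.real, Real.volume_Icc_pi]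

/-- Orthogonality from distinct eigenvalues: computing the coefficient of ∂_j t^κ in two ways gives
the factors 2πi κ_j and 2πi ν_j. -/
theorem fourierCoeffT_character_of_ne {ν κ : Fin r → ℤ} (h : ν ≠ κ) :
    fourierCoeffT ν (character κ) = 0 := by
  obtain ⟨j, hj⟩ := Function.ne_iff.1 h
  have h1 := fourierCoeffT_pderivPeriodic ν j (character κ)
  have h2 : pderivPeriodic j (character κ) = (2 * Real.pi * Complex.I * κ j) • character κ := by
    refine Subtype.ext (funext fun x => ?_)
    simp only [pderivPeriodic, hasFDerivAt_character, dot_single]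
    rfl
  rw [h2, map_smul, smul_eq_mul, ← sub_eq_zero, ← sub_mul, ← mul_sub] at h1
  have h3 : (κ j : ℂ) - ν j ≠ 0 := by
    rw [sub_ne_zero]; exact_mod_cast hj.symm
  have h4 : (2 * Real.pi * Complex.I : ℂ) ≠ 0 := Complex.two_pi_I_ne_zero
  simpa [h3, h4] using h1

theorem norm_fourierCoeffT_le {φ : periodicFun r} {A : ℝ} (h : ∀ x, ‖φ.1 x‖ ≤ A)
    (ν : Fin r → ℤ) : ‖fourierCoeffT ν φ‖ ≤ A := by
  have h1 := norm_setIntegral_le_of_norm_le_const (μ := volume) (s := Set.Icc (0 : Fin r → ℝ) 1)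
    (f := fun x => φ.1 x * (character (-ν)).1 x) (C := A) isCompact_Icc.measure_lt_top
    (fun x _ => by rw [norm_mul, norm_character, mul_one]; exact h x)
  have h2 : volume.real (Set.Icc (0 : Fin r → ℝ) 1) = 1 := by
    simp [Measure.real, Real.volume_Icc_pi]
  rw [h2, mul_one] at h1
  exact h1

theorem pderivPeriodic_iterate (j : Fin r) (φ : periodicFun r) (k : ℕ) (x : Fin r → ℝ) :
    ((pderivPeriodic j)^[k] φ).1 x = iteratedFDeriv ℝ k φ.1 x fun _ => Pi.single j 1 := by
  induction k generalizing x with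
  | zero => simp
  | succ k ih =>
    rw [Function.iterate_succ_apply']
    have h : ((pderivPeriodic j)^[k] φ).1 =
        fun x => iteratedFDeriv ℝ k φ.1 x fun _ => Pi.single j 1 := funext ih
    have hd : DifferentiableAt ℝ (iteratedFDeriv ℝ k φ.1) x :=
      (φ.2.1.differentiable_iteratedFDeriv (m := k) (by exact_mod_cast ENat.natCast_lt_top k)) x
    simp only [pderivPeriodic, h]
    rw [iteratedFDeriv_succ_apply_left]
    rw [fderiv_continuousMultilinear_apply_const_apply hd]
    rfl

theorem fourierCoeffT_iterate (ν : Fin r → ℤ) (j : Fin r) (φ : periodicFun r) (k : ℕ) :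
    fourierCoeffT ν ((pderivPeriodic j)^[k] φ) =
      (2 * Real.pi * Complex.I * ν j) ^ k * fourierCoeffT ν φ := by
  induction k with
  | zero => simp
  | succ k ih =>
    rw [Function.iterate_succ_apply', fourierCoeffT_pderivPeriodic, ih, pow_succ]
    ring

/-- Differentiating k times in the direction j of the largest |ν_j| gains ‖ν‖^k, the norm being the
sup norm. This combines with (1 + t)^k ≤ 2^k (1 + t^k). -/
theorem norm_fourierCoeffT_mul_le {φ : periodicFun r} {A : ℝ} {k : ℕ}
    (h : ∀ j ≤ k, ∀ x, ‖iteratedFDeriv ℝ j φ.1 x‖ ≤ A) (ν : Fin r → ℤ) :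
    (1 + ‖toReal ν‖) ^ k * ‖fourierCoeffT ν φ‖ ≤ 2 ^ k * (A + A) := by
  have h0 : ‖fourierCoeffT ν φ‖ ≤ A := norm_fourierCoeffT_le (fun x => by
    simpa using h 0 (Nat.zero_le _) x) ν
  have hA : 0 ≤ A := (norm_nonneg _).trans h0
  have h1 : ‖toReal ν‖ ^ k * ‖fourierCoeffT ν φ‖ ≤ A := by
    -- In rank zero there is no direction to differentiate in, but then ν = 0.
    obtain _ | n := r
    · obtain _ | k := k
      · simpa using h0
      · rw [Subsingleton.elim (toReal ν) 0, norm_zero, zero_pow (Nat.succ_ne_zero _), zero_mul]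
        exact hA
    · obtain ⟨j, -, hj⟩ := Finset.exists_max_image Finset.univ (fun j => ‖toReal ν j‖)
        Finset.univ_nonempty
      have hn : ‖toReal ν‖ ≤ ‖toReal ν j‖ := (pi_norm_le_iff_of_nonneg (norm_nonneg _)).2
        fun i => hj i (Finset.mem_univ i)
      have h2 : ‖fourierCoeffT ν ((pderivPeriodic j)^[k] φ)‖ ≤ A := by
        refine norm_fourierCoeffT_le (fun x => ?_) ν
        rw [pderivPeriodic_iterate]
        refine (ContinuousMultilinearMap.le_opNorm _ _).trans ?_
        have : ‖(Pi.single j 1 : Fin (n + 1) → ℝ)‖ = 1 := by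
          rw [Pi.norm_single, norm_one]
        simpa [this] using h k le_rfl x
      rw [fourierCoeffT_iterate, norm_mul, norm_pow] at h2
      refine le_trans ?_ h2
      gcongr
      refine hn.trans ?_
      have h3 : ‖(2 * Real.pi * Complex.I * ν j : ℂ)‖ = 2 * Real.pi * ‖toReal ν j‖ := by
        simp [toReal, abs_of_pos Real.pi_pos]
      rw [h3]
      have := Real.pi_gt_three
      nlinarith [norm_nonneg (toReal ν j)]
  have h3 : (1 + ‖toReal ν‖) ^ k ≤ 2 ^ k * (1 + ‖toReal ν‖ ^ k) := by
    rcases le_total ‖toReal ν‖ 1 with ht | ht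
    · calc (1 + ‖toReal ν‖) ^ k ≤ 2 ^ k := by gcongr; linarith
        _ ≤ _ := le_mul_of_one_le_right (by positivity) (by linarith [pow_nonneg (norm_nonneg (toReal ν)) k])
    · calc (1 + ‖toReal ν‖) ^ k ≤ (2 * ‖toReal ν‖) ^ k := by gcongr; linarith
        _ = 2 ^ k * ‖toReal ν‖ ^ k := mul_pow _ _ _
        _ ≤ _ := by gcongr; linarith
  calc _ ≤ 2 ^ k * (1 + ‖toReal ν‖ ^ k) * ‖fourierCoeffT ν φ‖ := by gcongr
    _ = 2 ^ k * (‖fourierCoeffT ν φ‖ + ‖toReal ν‖ ^ k * ‖fourierCoeffT ν φ‖) := by ring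
    _ ≤ _ := by gcongr

/-- Rapid decay of Fourier coefficients. -/
theorem exists_fourierCoeffT_bound (r N : ℕ) : ∃ (k : ℕ) (b : (Fin r → ℤ) → ℝ), Summable b ∧
    ∀ (φ : periodicFun r) (A : ℝ), (∀ j ≤ k, ∀ x, ‖iteratedFDeriv ℝ j φ.1 x‖ ≤ A) →
      ∀ ν, ‖fourierCoeffT ν φ‖ * (1 + ‖toReal ν‖) ^ N ≤ A * b ν := by
  obtain ⟨n, hn⟩ := exists_summable_norm_toReal_pow r
  -- Of the n + N derivatives, N absorb the polynomial weight and n pay for a summable factor.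
  refine ⟨n + N, fun ν => 2 ^ (n + N) * 2 * ((1 + ‖toReal ν‖) ^ n)⁻¹, hn.mul_left _, ?_⟩
  intro φ A h ν
  have h1 := norm_fourierCoeffT_mul_le h ν
  have hpos : 0 < (1 + ‖toReal ν‖) ^ n := by positivity
  rw [pow_add] at h1
  calc ‖fourierCoeffT ν φ‖ * (1 + ‖toReal ν‖) ^ N =
      ((1 + ‖toReal ν‖) ^ n * (1 + ‖toReal ν‖) ^ N * ‖fourierCoeffT ν φ‖) *
        ((1 + ‖toReal ν‖) ^ n)⁻¹ := by field_simp
    _ ≤ 2 ^ (n + N) * (A + A) * ((1 + ‖toReal ν‖) ^ n)⁻¹ := by gcongr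
    _ = _ := by ring

/-- The derivatives are periodic too, so it is enough to bound them on the compact unit cube. -/
theorem exists_iteratedFDeriv_bound (φ : periodicFun r) (k : ℕ) :
    ∃ A, ∀ j ≤ k, ∀ x, ‖iteratedFDeriv ℝ j φ.1 x‖ ≤ A := by
  have h1 : ∀ j : ℕ, ∃ A, ∀ x, ‖iteratedFDeriv ℝ j φ.1 x‖ ≤ A := by
    intro j
    have hc : Continuous (iteratedFDeriv ℝ j φ.1) :=
      φ.2.1.continuous_iteratedFDeriv (by exact_mod_cast le_top)
    obtain ⟨A, hA⟩ := (isCompact_Icc (a := (0 : Fin r → ℝ)) (b := 1)).exists_bound_of_continuousOn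
      hc.continuousOn
    refine ⟨A, fun x => ?_⟩
    have hper : iteratedFDeriv ℝ j φ.1 x =
        iteratedFDeriv ℝ j φ.1 (x + toReal fun i => -⌊x i⌋) := by
      have h : φ.1 = fun y => φ.1 (y + toReal fun i => -⌊x i⌋) :=
        funext fun y => (φ.2.2 y _).symm
      conv_lhs => rw [h]
      rw [iteratedFDeriv_comp_add_right]
    rw [hper]
    refine hA _ ⟨fun i => ?_, fun i => ?_⟩
    · simp [toReal, Int.floor_le]
    · simp only [toReal, Pi.add_apply, Int.cast_neg, Pi.one_apply]
      linarith [Int.lt_floor_add_one (x i)]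
  choose A hA using h1
  refine ⟨∑ j ∈ Finset.range (k + 1), |A j|, fun j hj x => ?_⟩
  refine ((hA j x).trans (le_abs_self _)).trans ?_
  exact Finset.single_le_sum (f := fun j => |A j|) (fun _ _ => abs_nonneg _)
    (Finset.mem_range.2 (Nat.lt_succ_of_le hj))

end Fourier

/-! ### Smooth sums of series of functions on G -/

section SmoothSums

variable {E G : Type*} [NormedAddCommGroup E] [NormedSpace ℝ E]
  [TopologicalSpace G] [ChartedSpace E G] [Group G] [LieGroup 𝓘(ℝ, E) ∞ G]

theorem leftDeriv_add_left (ξ η : Lie E G) (f : G → ℂ) (g : G) :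
    leftDeriv E (ξ + η) f g = leftDeriv E ξ f g + leftDeriv E η f g := by
  have h : mulInvariantVectorField (I := 𝓘(ℝ, E)) (ξ + η) g =
      mulInvariantVectorField ξ g + mulInvariantVectorField η g :=
    map_add (mfderiv 𝓘(ℝ, E) 𝓘(ℝ, E) (g * ·) 1 : E →L[ℝ] E) ξ η
  unfold leftDeriv
  rw [h]
  exact map_add (mfderiv 𝓘(ℝ, E) 𝓘(ℝ, ℂ) f g : E →L[ℝ] ℂ) _ _

theorem leftDeriv_smul_left (c : ℝ) (ξ : Lie E G) (f : G → ℂ) (g : G) :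
    leftDeriv E (c • ξ) f g = c • leftDeriv E ξ f g := by
  have h : mulInvariantVectorField (I := 𝓘(ℝ, E)) (c • ξ) g =
      c • mulInvariantVectorField ξ g :=
    map_smul (mfderiv 𝓘(ℝ, E) 𝓘(ℝ, E) (g * ·) 1 : E →L[ℝ] E) c ξ
  unfold leftDeriv
  rw [h]
  exact map_smul (mfderiv 𝓘(ℝ, E) 𝓘(ℝ, ℂ) f g : E →L[ℝ] ℂ) _ _

/-- `ξ ↦ leftDeriv ξ f g` as a linear map. -/
def leftDerivLin (f : G → ℂ) (g : G) : Lie E G →ₗ[ℝ] ℂ where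
  toFun ξ := leftDeriv E ξ f g
  map_add' ξ η := leftDeriv_add_left ξ η f g
  map_smul' c ξ := leftDeriv_smul_left c ξ f g

variable (E) in
/-- The Maurer–Cartan form in the chart at `g`. -/
def maurerCartan (g : G) (y : E) : E →L[ℝ] E :=
  fderiv ℝ (fun z : E => chartAt E (1 : G) (((chartAt E g).symm y)⁻¹ * (chartAt E g).symm z)) y

theorem contDiffAt_leftTranslate (g : G) {y : E} (hy : y ∈ (chartAt E g).target) :
    ContDiffAt ℝ ∞ (fun p : E × E =>
      chartAt E (1 : G) (((chartAt E g).symm p.1)⁻¹ * (chartAt E g).symm p.2)) (y, y) := by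
  have hs : ContMDiffAt 𝓘(ℝ, E) 𝓘(ℝ, E) ∞ (chartAt E g).symm y :=
    (contMDiffOn_chart_symm (I := 𝓘(ℝ, E)) (n := ∞) (x := g)).contMDiffAt
      ((chartAt E g).open_target.mem_nhds hy)
  have h1 : ContMDiffAt 𝓘(ℝ, E × E) 𝓘(ℝ, E) ∞ (fun p : E × E => (chartAt E g).symm p.1) (y, y) :=
    ContMDiffAt.comp (y, y) hs contDiff_fst.contMDiff.contMDiffAt
  have h2 : ContMDiffAt 𝓘(ℝ, E × E) 𝓘(ℝ, E) ∞ (fun p : E × E => (chartAt E g).symm p.2) (y, y) :=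
    ContMDiffAt.comp (y, y) hs contDiff_snd.contMDiff.contMDiffAt
  have h3 := h1.inv.mul h2
  have hc : ContMDiffAt 𝓘(ℝ, E) 𝓘(ℝ, E) ∞ (chartAt E (1 : G)) 1 :=
    (contMDiffOn_chart (I := 𝓘(ℝ, E)) (n := ∞) (x := (1 : G))).contMDiffAt
      ((chartAt E (1 : G)).open_source.mem_nhds (mem_chart_source E 1))
  have h4 := ContMDiffAt.comp_of_eq hc h3 (by simp)
  exact h4.contDiffAt

theorem contDiffAt_maurerCartan (g : G) {y : E} (hy : y ∈ (chartAt E g).target) :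
    ContDiffAt ℝ ∞ (maurerCartan E g) y :=
  ContDiffAt.fderiv (n := ∞) (m := ∞) (contDiffAt_leftTranslate g hy) contDiffAt_id (by simp)

/-- With h the point at y, a nearby point x is h · (h⁻¹ x), and h⁻¹ x can be read in the chart at
the unit. The chain rule then gives the derivative of f along left translates composed with the
Maurer–Cartan form. -/
theorem hasFDerivAt_comp_chart_symm (g : G) {y : E} (hy : y ∈ (chartAt E g).target) {f : G → ℂ}
    (hf : ContMDiff 𝓘(ℝ, E) 𝓘(ℝ, ℂ) ∞ f) :
    HasFDerivAt (fun z => f ((chartAt E g).symm z))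
      (((mfderiv 𝓘(ℝ, E) 𝓘(ℝ, ℂ) f ((chartAt E g).symm y) : E →L[ℝ] ℂ).comp
        (mfderiv 𝓘(ℝ, E) 𝓘(ℝ, E) (fun x => (chartAt E g).symm y * x) 1 : E →L[ℝ] E)).comp
          (maurerCartan E g y)) y := by
  have : IsTopologicalGroup G := topologicalGroup_of_lieGroup 𝓘(ℝ, E) ∞
  set h := (chartAt E g).symm y with hh
  have hmul : ContMDiff 𝓘(ℝ, E) 𝓘(ℝ, E) ∞ fun x : G => h * x := contMDiff_const.mul contMDiff_id
  have h1 : HasMFDerivAt 𝓘(ℝ, E) 𝓘(ℝ, ℂ) (fun x => f (h * x)) 1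
      ((mfderiv 𝓘(ℝ, E) 𝓘(ℝ, ℂ) f (h * 1)).comp
        (mfderiv 𝓘(ℝ, E) 𝓘(ℝ, E) (fun x => h * x) 1)) :=
    ((hf.mdifferentiable (by simp) _).hasMFDerivAt).comp 1
      ((hmul.mdifferentiable (by simp) _).hasMFDerivAt)
  have h2 := h1.2
  simp only [writtenInExtChartAt, extChartAt, mfld_simps] at h2
  have h7 : HasFDerivAt (fun z : E => f (h * (chartAt E (1 : G)).symm z))
      ((mfderiv 𝓘(ℝ, E) 𝓘(ℝ, ℂ) f h : E →L[ℝ] ℂ).comp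
        (mfderiv 𝓘(ℝ, E) 𝓘(ℝ, E) (fun x => h * x) 1 : E →L[ℝ] E)) (chartAt E (1 : G) 1) := by
    have h8 : (mfderiv 𝓘(ℝ, E) 𝓘(ℝ, ℂ) f h : E →L[ℝ] ℂ) =
        (mfderiv 𝓘(ℝ, E) 𝓘(ℝ, ℂ) f (h * 1) : E →L[ℝ] ℂ) := by rw [mul_one]
    rw [h8]
    exact hasFDerivWithinAt_univ.1 h2
  have h3 : HasFDerivAt (fun z : E => chartAt E (1 : G) (h⁻¹ * (chartAt E g).symm z))
      (maurerCartan E g y) y := by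
    have h4 : ContDiffAt ℝ ∞ (fun z : E => chartAt E (1 : G) (h⁻¹ * (chartAt E g).symm z)) y :=
      (contDiffAt_leftTranslate g hy).comp y (contDiffAt_const.prodMk contDiffAt_id)
    exact (h4.differentiableAt (by simp)).hasFDerivAt
  have hval : chartAt E (1 : G) (h⁻¹ * (chartAt E g).symm y) = chartAt E (1 : G) 1 := by
    rw [← hh, inv_mul_cancel]
  have h5 := HasFDerivAt.comp y (by rw [hval]; exact h7) h3
  have hcont : ContinuousAt (fun z : E => h⁻¹ * (chartAt E g).symm z) y :=
    continuousAt_const.mul ((chartAt E g).symm.continuousAt hy)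
  have hev : ∀ᶠ z in nhds y, h⁻¹ * (chartAt E g).symm z ∈ (chartAt E (1 : G)).source := by
    refine hcont.eventually_mem ((chartAt E (1 : G)).open_source.mem_nhds ?_)
    rw [← hh, inv_mul_cancel]
    exact mem_chart_source E 1
  refine h5.congr_of_eventuallyEq ?_
  filter_upwards [hev] with z hz
  simp only [Function.comp_apply]
  rw [(chartAt E (1 : G)).left_inv hz, mul_inv_cancel_left]

variable [FiniteDimensional ℝ E]

variable (E) in
/-- The coefficients of the Maurer–Cartan form in a basis. -/
def maurerCartanCoeff (g : G) (a : Fin (Module.finrank ℝ E)) (y : E) : E →L[ℝ] ℝ :=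
  ((Module.finBasis ℝ E).coord a).toContinuousLinearMap.comp (maurerCartan E g y)

variable (E G) in
/-- A basis of the Lie algebra. -/
def lieBasis : Module.Basis (Fin (Module.finrank ℝ E)) ℝ (Lie E G) := Module.finBasis ℝ E

/-- Chart derivatives are combinations of left invariant derivatives with coefficients independent
of f. Bounds on `wordDeriv` therefore control series in every chart. -/
theorem hasFDerivAt_comp_chart_symm_sum (g : G) {y : E} (hy : y ∈ (chartAt E g).target) {f : G → ℂ}
    (hf : ContMDiff 𝓘(ℝ, E) 𝓘(ℝ, ℂ) ∞ f) :
    HasFDerivAt (fun z => f ((chartAt E g).symm z))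
      (∑ a, (maurerCartanCoeff E g a y).smulRight
        (leftDeriv E (lieBasis E G a) f ((chartAt E g).symm y))) y := by
  have h0 := hasFDerivAt_comp_chart_symm g hy hf
  refine h0.congr_fderiv (ContinuousLinearMap.ext fun v => ?_)
  change leftDerivLin f ((chartAt E g).symm y) (maurerCartan E g y v : E) = _
  have h : (maurerCartan E g y v : E) = (∑ a, (lieBasis E G).coord a (maurerCartan E g y v : E) •
      lieBasis E G a : Lie E G) := ((lieBasis E G).sum_repr (maurerCartan E g y v : E)).symm
  conv_lhs => rw [h, map_sum]
  simp only [map_smul]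
  exact (sum_apply Finset.univ (fun a => (maurerCartanCoeff E g a y).smulRight
    (leftDeriv E (lieBasis E G a) f ((chartAt E g).symm y))) v).symm

theorem contDiffOn_maurerCartanCoeff (g : G) (a : Fin (Module.finrank ℝ E)) :
    ContDiffOn ℝ ∞ (maurerCartanCoeff E g a) (chartAt E g).target := fun _ hy =>
  (contDiffAt_const.clm_comp (contDiffAt_maurerCartan g hy)).contDiffWithinAt

variable {ι : Type*}

variable (E) in
/-- Families of smooth functions all of whose derivatives are summable, uniformly on `G`. -/
def SummableSmooth (f : ι → G → ℂ) : Prop :=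
  (∀ i, ContMDiff 𝓘(ℝ, E) 𝓘(ℝ, ℂ) ∞ (f i)) ∧
    ∀ w : List (Lie E G), ∃ b : ι → ℝ, Summable b ∧ ∀ i g, ‖wordDeriv E w (f i) g‖ ≤ b i

theorem SummableSmooth.leftDeriv {f : ι → G → ℂ} (hf : SummableSmooth E f) (ξ : Lie E G) :
    SummableSmooth E fun i => leftDeriv E ξ (f i) := by
  refine ⟨fun i => leftDeriv_smooth E ξ (hf.1 i), fun w => ?_⟩
  obtain ⟨b, hb, h⟩ := hf.2 (w ++ [ξ])
  exact ⟨b, hb, fun i g => by simpa [wordDeriv] using h i g⟩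

theorem SummableSmooth.hasFDerivAt {f : ι → G → ℂ} (hf : SummableSmooth E f) (g : G) {y : E}
    (hy : y ∈ (chartAt E g).target) :
    HasFDerivAt (fun z => ∑' i, f i ((chartAt E g).symm z))
      (∑ a, (maurerCartanCoeff E g a y).smulRight
        (∑' i, WeilCartan.leftDeriv E (lieBasis E G a) (f i) ((chartAt E g).symm y))) y := by
  obtain ⟨b, hb, hbf⟩ := hf.2 []
  have h1 : ∀ a, ∃ b : ι → ℝ, Summable b ∧
      ∀ i g, ‖WeilCartan.leftDeriv E (lieBasis E G a) (f i) g‖ ≤ b i :=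
    fun a => hf.2 [lieBasis E G a]
  choose b' hb' hbf' using h1
  -- Termwise differentiation needs a majorant uniform near y; by continuity the Maurer–Cartan
  -- coefficients exceed their norm at y by less than 1 on a small ball.
  have h2 : ∀ᶠ z in nhds y, z ∈ (chartAt E g).target ∧
      ∀ a, ‖maurerCartanCoeff E g a z‖ < ‖maurerCartanCoeff E g a y‖ + 1 := by
    refine Filter.Eventually.and ((chartAt E g).open_target.mem_nhds hy) (Filter.eventually_all.2 fun a => ?_)
    have hc := ((contDiffOn_maurerCartanCoeff g a).continuousOn.continuousAt
      ((chartAt E g).open_target.mem_nhds hy)).norm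
    exact hc.eventually_lt_const (lt_add_one _)
  obtain ⟨ε, hε, hball⟩ := Metric.eventually_nhds_iff_ball.1 h2
  have hsum : Summable fun i => ∑ a, (‖maurerCartanCoeff E g a y‖ + 1) * b' a i :=
    summable_sum fun a _ => (hb' a).mul_left _
  have key := hasFDerivAt_tsum_of_isPreconnected (f := fun i z => f i ((chartAt E g).symm z))
    (f' := fun i z => ∑ a, (maurerCartanCoeff E g a z).smulRight
        (WeilCartan.leftDeriv E (lieBasis E G a) (f i) ((chartAt E g).symm z)))
    hsum Metric.isOpen_ball (convex_ball y ε).isPreconnected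
    (fun i z hz => hasFDerivAt_comp_chart_symm_sum g (hball z hz).1 (hf.1 i))
    (fun i z hz => by
      refine (norm_sum_le _ _).trans (Finset.sum_le_sum fun a _ => ?_)
      rw [ContinuousLinearMap.norm_smulRight_apply]
      exact mul_le_mul ((hball z hz).2 a).le (hbf' a i _) (norm_nonneg _) (by positivity))
    (Metric.mem_ball_self hε) (hb.of_norm_bounded fun i => hbf i _) (Metric.mem_ball_self hε)
  convert! key using 1
  have hs : ∀ a, Summable fun i =>
      WeilCartan.leftDeriv E (lieBasis E G a) (f i) ((chartAt E g).symm y) :=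
    fun a => (hb' a).of_norm_bounded fun i => hbf' a i _
  have h3 : ∀ a, HasSum (fun i => (maurerCartanCoeff E g a y).smulRight
      (WeilCartan.leftDeriv E (lieBasis E G a) (f i) ((chartAt E g).symm y)))
      ((maurerCartanCoeff E g a y).smulRight
        (∑' i, WeilCartan.leftDeriv E (lieBasis E G a) (f i) ((chartAt E g).symm y))) := fun a =>
    (hs a).hasSum.mapL (ContinuousLinearMap.smulRightL ℝ E ℂ (maurerCartanCoeff E g a y))
  exact (hasSum_sum fun a _ => h3 a).tsum_eq.symm

theorem SummableSmooth.continuous_tsum {f : ι → G → ℂ} (hf : SummableSmooth E f) :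
    Continuous fun g => ∑' i, f i g := by
  obtain ⟨b, hb, hbf⟩ := hf.2 []
  exact _root_.continuous_tsum (fun i => (hf.1 i).continuous) hb hbf

theorem contMDiff_of_comp_chart_symm {F : G → ℂ} {n : ℕ∞}
    (h : ∀ g : G, ContDiffOn ℝ n (fun z => F ((chartAt E g).symm z)) (chartAt E g).target) :
    ContMDiff 𝓘(ℝ, E) 𝓘(ℝ, ℂ) n F := by
  intro g
  have hc : ContMDiffAt 𝓘(ℝ, E) 𝓘(ℝ, E) n (chartAt E g) g :=
    ((contMDiffOn_chart (I := 𝓘(ℝ, E)) (n := ∞) (x := g)).of_le (by exact_mod_cast le_top)).contMDiffAt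
      ((chartAt E g).open_source.mem_nhds (mem_chart_source E g))
  have h1 : ContMDiffAt 𝓘(ℝ, E) 𝓘(ℝ, ℂ) n (fun z => F ((chartAt E g).symm z)) (chartAt E g g) :=
    ((h g).contDiffAt ((chartAt E g).open_target.mem_nhds (mem_chart_target E g))).contMDiffAt
  refine (ContMDiffAt.comp g h1 hc).congr_of_eventuallyEq ?_
  filter_upwards [(chartAt E g).open_source.mem_nhds (mem_chart_source E g)] with x hx
  simp only [Function.comp_apply, (chartAt E g).left_inv hx]

/-- The chart derivative of the sum consists of smooth coefficients times sums of the families of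
left derivatives, which satisfy the same hypothesis. -/
theorem SummableSmooth.contMDiff_nat (n : ℕ) {f : ι → G → ℂ} (hf : SummableSmooth E f) :
    ContMDiff 𝓘(ℝ, E) 𝓘(ℝ, ℂ) n fun g => ∑' i, f i g := by
  induction n generalizing f with
  | zero => exact contMDiff_zero_iff.2 hf.continuous_tsum
  | succ n ih =>
    refine contMDiff_of_comp_chart_symm (n := ((n + 1 : ℕ) : ℕ∞)) fun g => ?_
    push_cast
    rw [contDiffOn_succ_iff_fderiv_of_isOpen (chartAt E g).open_target]
    refine ⟨fun y hy => (hf.hasFDerivAt g hy).differentiableAt.differentiableWithinAt, by simp, ?_⟩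
    refine ContDiffOn.congr ?_ fun y hy => (hf.hasFDerivAt g hy).fderiv
    refine ContDiffOn.sum fun a _ => ?_
    refine ContDiffOn.smulRight ((contDiffOn_maurerCartanCoeff g a).of_le
      (by exact_mod_cast le_top)) ?_
    have h1 := (ih (hf.leftDeriv (lieBasis E G a))).contMDiffOn (s := Set.univ)
    have h2 := h1.comp ((contMDiffOn_chart_symm (I := 𝓘(ℝ, E)) (n := ∞) (x := g)).of_le
      (by exact_mod_cast le_top : (n : WithTop ℕ∞) ≤ ∞)) fun _ _ => Set.mem_univ _
    exact h2.contDiffOn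

theorem SummableSmooth.contMDiff {f : ι → G → ℂ} (hf : SummableSmooth E f) :
    ContMDiff 𝓘(ℝ, E) 𝓘(ℝ, ℂ) ∞ fun g => ∑' i, f i g :=
  contMDiff_infty.2 fun n => hf.contMDiff_nat n

theorem SummableSmooth.leftDeriv_tsum {f : ι → G → ℂ} (hf : SummableSmooth E f) (ξ : Lie E G)
    (g : G) : WeilCartan.leftDeriv E ξ (fun g => ∑' i, f i g) g =
      ∑' i, WeilCartan.leftDeriv E ξ (f i) g := by
  -- At the centre of its own chart, the manifold derivative is the ordinary derivative of the local
  -- expression.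
  have h1 : ∀ F : G → ℂ, ContMDiff 𝓘(ℝ, E) 𝓘(ℝ, ℂ) ∞ F → ∀ v : E,
      (mfderiv 𝓘(ℝ, E) 𝓘(ℝ, ℂ) F g : E →L[ℝ] ℂ) v =
        fderiv ℝ (fun z => F ((chartAt E g).symm z)) (chartAt E g g) v := by
    intro F hF v
    have h2 := (hF.mdifferentiable (by simp) g).hasMFDerivAt.2
    simp only [writtenInExtChartAt, extChartAt, mfld_simps] at h2
    let D : E →L[ℝ] ℂ := mfderiv 𝓘(ℝ, E) 𝓘(ℝ, ℂ) F g
    have h3 : HasFDerivAt (fun z => F ((chartAt E g).symm z)) D (chartAt E g g) :=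
      hasFDerivWithinAt_univ.1 h2
    rw [h3.fderiv]
    rfl
  have hy := mem_chart_target E g
  have h2 : ∀ v : E, (mfderiv 𝓘(ℝ, E) 𝓘(ℝ, ℂ) (fun g => ∑' i, f i g) g : E →L[ℝ] ℂ) v =
      ∑' i, (mfderiv 𝓘(ℝ, E) 𝓘(ℝ, ℂ) (f i) g : E →L[ℝ] ℂ) v := by
    intro v
    rw [h1 _ hf.contMDiff, (hf.hasFDerivAt g hy).fderiv]
    simp only [fun i => h1 _ (hf.1 i) v, (hasFDerivAt_comp_chart_symm_sum g hy (hf.1 _)).fderiv]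
    simp only [sum_apply, ContinuousLinearMap.smulRight_apply]
    have hs : ∀ a, Summable fun i =>
        WeilCartan.leftDeriv E (lieBasis E G a) (f i) ((chartAt E g).symm (chartAt E g g)) := by
      intro a
      obtain ⟨b, hb, hbf⟩ := hf.2 [lieBasis E G a]
      exact hb.of_norm_bounded fun i => hbf i _
    rw [Summable.tsum_finsetSum fun a _ => (hs a).const_smul _]
    exact Finset.sum_congr rfl fun a _ => ((hs a).tsum_const_smul _).symm
  exact h2 _

theorem SummableSmooth.wordDeriv {f : ι → G → ℂ} (hf : SummableSmooth E f)
    (w : List (Lie E G)) : SummableSmooth E (fun i => wordDeriv E w (f i)) ∧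
      ∀ g, wordDeriv E w (fun g => ∑' i, f i g) g = ∑' i, wordDeriv E w (f i) g := by
  induction w with
  | nil => exact ⟨hf, fun _ => rfl⟩
  | cons ξ w ih =>
    refine ⟨ih.1.leftDeriv ξ, fun g => ?_⟩
    have h := ih.1.leftDeriv_tsum ξ g
    rw [← funext ih.2] at h
    exact h

end SmoothSums

/-! ### One-parameter subgroups and the centralizer of a maximal torus -/

section OneParameter

variable {E G : Type*} [NormedAddCommGroup E] [NormedSpace ℝ E]
  [TopologicalSpace G] [ChartedSpace E G] [Group G] [LieGroup 𝓘(ℝ, E) ∞ G]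

theorem comp_smulRight_one {V W : Type*} [NormedAddCommGroup V] [NormedSpace ℝ V]
    [NormedAddCommGroup W] [NormedSpace ℝ W] (A : V →L[ℝ] W) (v : V) :
    A.comp ((1 : ℝ →L[ℝ] ℝ).smulRight v) = (1 : ℝ →L[ℝ] ℝ).smulRight (A v) := by
  ext; simp

theorem smulRight_one_congr {V : Type*} [NormedAddCommGroup V] [NormedSpace ℝ V] {v w : V}
    (h : v = w) : (1 : ℝ →L[ℝ] ℝ).smulRight v = (1 : ℝ →L[ℝ] ℝ).smulRight w := by rw [h]

theorem contMDiff_mulLeft_smooth (g : G) :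
    ContMDiff 𝓘(ℝ, E) 𝓘(ℝ, E) ∞ fun x : G => g * x := contMDiff_const.mul contMDiff_id

theorem mfderiv_mulLeft_invariantField (g h : G) (ξ : Lie E G) :
    (mfderiv 𝓘(ℝ, E) 𝓘(ℝ, E) (fun x : G => g * x) h : E →L[ℝ] E)
      (mulInvariantVectorField ξ h) = mulInvariantVectorField (I := 𝓘(ℝ, E)) ξ (g * h) := by
  have h1 := ((contMDiff_mulLeft_smooth (E := E) g).mdifferentiable (by simp) (h * 1)).hasMFDerivAt.comp
    (1 : G) ((contMDiff_mulLeft_smooth (E := E) h).mdifferentiable (by simp) 1).hasMFDerivAt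
  have h2 : (fun x : G => g * x) ∘ (fun x : G => h * x) = fun x : G => g * h * x := by
    funext x; simp [mul_assoc]
  rw [h2] at h1
  have h3 := h1.mfderiv
  have h4 : (mfderiv 𝓘(ℝ, E) 𝓘(ℝ, E) (fun x : G => g * x) h : E →L[ℝ] E) =
    (mfderiv 𝓘(ℝ, E) 𝓘(ℝ, E) (fun x : G => g * x) (h * 1) : E →L[ℝ] E) := by rw [mul_one]
  rw [h4]
  exact (congrArg (fun L : E →L[ℝ] E => L ξ) h3).symm

theorem contMDiff_invariantField (ξ : Lie E G) :
    ContMDiff 𝓘(ℝ, E) 𝓘(ℝ, E).tangent 1 fun g : G =>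
      (⟨g, mulInvariantVectorField ξ g⟩ : TangentBundle 𝓘(ℝ, E) G) := by
  have hm : ContMDiff (𝓘(ℝ, E).prod 𝓘(ℝ, E)) 𝓘(ℝ, E) ∞ fun p : G × G => p.1 * p.2 :=
    contMDiff_mul 𝓘(ℝ, E) ∞
  have h := contMDiff_partial hm (1 : G) ξ
  refine ContMDiff.of_le (n := ∞) ?_ (by exact_mod_cast le_top)
  refine (congrArg (ContMDiff _ _ _) (funext fun g => ?_)).mpr h
  have h1 : ∀ (x : G) (v : E), x = g →
      (⟨g, v⟩ : TangentBundle 𝓘(ℝ, E) G) = ⟨x, v⟩ := by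
    rintro x v rfl; rfl
  exact h1 _ _ (mul_one g)

theorem isMIntegralCurveOn_mulLeft {γ : ℝ → G} {ξ : Lie E G} {s : Set ℝ}
    (h : IsMIntegralCurveOn (I := 𝓘(ℝ, E)) γ (mulInvariantVectorField ξ) s) (g : G) :
    IsMIntegralCurveOn (I := 𝓘(ℝ, E)) (fun t => g * γ t) (mulInvariantVectorField ξ) s := by
  intro t ht
  have h1 := ((contMDiff_mulLeft_smooth (E := E) g).mdifferentiable (by simp)
    (γ t)).hasMFDerivAt.comp_hasMFDerivWithinAt t (h t ht)
  refine h1.congr_mfderiv ?_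
  have h2 := mfderiv_mulLeft_invariantField g (γ t) ξ
  exact (comp_smulRight_one (V := E) (W := E) (mfderiv 𝓘(ℝ, E) 𝓘(ℝ, E) (fun x : G => g * x) (γ t) : E →L[ℝ] E)
    (mulInvariantVectorField (I := 𝓘(ℝ, E)) ξ (γ t) : E)).trans (smulRight_one_congr (V := E) h2)

theorem isMIntegralCurve_mulLeft {γ : ℝ → G} {ξ : Lie E G}
    (h : IsMIntegralCurve (I := 𝓘(ℝ, E)) γ (mulInvariantVectorField ξ)) (g : G) :
    IsMIntegralCurve (I := 𝓘(ℝ, E)) (fun t => g * γ t) (mulInvariantVectorField ξ) := by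
  rw [isMIntegralCurve_iff_isMIntegralCurveOn] at h ⊢
  exact isMIntegralCurveOn_mulLeft h g

/-- `γ` is a one-parameter subgroup with velocity `ξ`. -/
structure IsOneParameter (γ : ℝ → G) (ξ : Lie E G) : Prop where
  map_add : ∀ s t, γ (s + t) = γ s * γ t
  hasMFDerivAt : HasMFDerivAt 𝓘(ℝ, ℝ) 𝓘(ℝ, E) γ 0 ((1 : ℝ →L[ℝ] ℝ).smulRight (ξ : E))

theorem IsOneParameter.map_zero {γ : ℝ → G} {ξ : Lie E G} (h : IsOneParameter γ ξ) : γ 0 = 1 := by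
  have := h.map_add 0 0
  simpa using this

theorem mulInvariantVectorField_one (ξ : Lie E G) :
    (mulInvariantVectorField (I := 𝓘(ℝ, E)) ξ (1 : G) : E) = ξ := by
  have h : (fun x : G => (1 : G) * x) = id := funext fun x => one_mul x
  have h1 : (mfderiv 𝓘(ℝ, E) 𝓘(ℝ, E) (fun x : G => (1 : G) * x) 1 : E →L[ℝ] E) =
      ContinuousLinearMap.id ℝ E := by
    rw [h]; exact mfderiv_id
  exact congrArg (fun L : E →L[ℝ] E => L ξ) h1

/-- Writing γ(u) = γ(t) γ(u - t) transports the velocity from time 0 to time t by left translation.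
-/
theorem IsOneParameter.isMIntegralCurve {γ : ℝ → G} {ξ : Lie E G} (h : IsOneParameter γ ξ) :
    IsMIntegralCurve (I := 𝓘(ℝ, E)) γ (mulInvariantVectorField ξ) := by
  intro t
  have h1 : HasMFDerivAt 𝓘(ℝ, ℝ) 𝓘(ℝ, ℝ) (fun u : ℝ => u - t) t (ContinuousLinearMap.id ℝ ℝ) :=
    ((hasFDerivAt_id t).sub_const t).hasMFDerivAt
  have h2 : HasMFDerivAt 𝓘(ℝ, ℝ) 𝓘(ℝ, E) γ (t - t) ((1 : ℝ →L[ℝ] ℝ).smulRight (ξ : E)) := by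
    rw [sub_self]; exact h.hasMFDerivAt
  have h3 : HasMFDerivAt 𝓘(ℝ, E) 𝓘(ℝ, E) (fun x : G => γ t * x) (γ (t - t))
      (mfderiv 𝓘(ℝ, E) 𝓘(ℝ, E) (fun x : G => γ t * x) 1 : E →L[ℝ] E) := by
    rw [sub_self, h.map_zero]
    exact ((contMDiff_mulLeft_smooth (E := E) (γ t)).mdifferentiable (by simp) 1).hasMFDerivAt
  have h4 := HasMFDerivAt.comp (f := fun u : ℝ => γ (u - t)) t h3
    (HasMFDerivAt.comp (f := fun u : ℝ => u - t) t h2 h1)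
  have h5 : (fun x : G => γ t * x) ∘ (fun u : ℝ => γ (u - t)) = γ := by
    funext u
    simp only [Function.comp_apply]
    rw [← h.map_add, add_sub_cancel]
  rw [h5] at h4
  exact h4.congr_mfderiv (comp_smulRight_one (V := E) (W := E)
    (mfderiv 𝓘(ℝ, E) 𝓘(ℝ, E) (fun x : G => γ t * x) 1 : E →L[ℝ] E) (ξ : E))

theorem IsOneParameter.continuous {γ : ℝ → G} {ξ : Lie E G} (h : IsOneParameter γ ξ) :
    Continuous γ := h.isMIntegralCurve.continuous

/-- The derivative of a function along a one-parameter subgroup. -/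
theorem IsOneParameter.hasDerivAt {γ : ℝ → G} {ξ : Lie E G} (h : IsOneParameter γ ξ)
    {V : Type*} [NormedAddCommGroup V] [NormedSpace ℝ V] {f : G → V} {f' : E →L[ℝ] V}
    (hf : HasMFDerivAt 𝓘(ℝ, E) 𝓘(ℝ, V) f 1 f') : HasDerivAt (fun s => f (γ s)) (f' ξ) 0 := by
  have hf' : HasMFDerivAt 𝓘(ℝ, E) 𝓘(ℝ, V) f (γ 0) f' := by rw [h.map_zero]; exact hf
  have h1 : HasFDerivAt (fun s => f (γ s)) ((1 : ℝ →L[ℝ] ℝ).smulRight (f' ξ)) 0 :=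
    ((hf'.comp (0 : ℝ) h.hasMFDerivAt).congr_mfderiv (comp_smulRight_one f' (ξ : E))).hasFDerivAt
  simpa using h1.hasDerivAt

theorem IsOneParameter.conj {γ : ℝ → G} {ξ : Lie E G} (h : IsOneParameter γ ξ) (g : G) :
    IsOneParameter (fun s => g * γ s * g⁻¹) (Ad E g ξ) := by
  refine ⟨fun s t => by rw [h.map_add]; group, ?_⟩
  have h3 : HasMFDerivAt 𝓘(ℝ, E) 𝓘(ℝ, E) (fun x : G => g * x * g⁻¹) (γ 0)
      (mfderiv 𝓘(ℝ, E) 𝓘(ℝ, E) (fun x : G => g * x * g⁻¹) 1 : E →L[ℝ] E) := by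
    rw [h.map_zero]
    exact ((contMDiff_conj E g).mdifferentiable (by simp) 1).hasMFDerivAt
  exact (h3.comp (0 : ℝ) h.hasMFDerivAt).congr_mfderiv (comp_smulRight_one (V := E) (W := E)
    (mfderiv 𝓘(ℝ, E) 𝓘(ℝ, E) (fun x : G => g * x * g⁻¹) 1 : E →L[ℝ] E) (ξ : E))

theorem MaximalTorus.par_zero (T : MaximalTorus E G) : T.par 0 = 1 := by
  have := T.map_add 0 0
  simpa using this

theorem MaximalTorus.hasMFDerivAt_par (T : MaximalTorus E G) :
    HasMFDerivAt 𝓘(ℝ, Fin T.rank → ℝ) 𝓘(ℝ, E) T.par 0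
      (mfderiv 𝓘(ℝ, Fin T.rank → ℝ) 𝓘(ℝ, E) T.par 0 : (Fin T.rank → ℝ) →L[ℝ] E) :=
  (T.smooth.mdifferentiable (by simp) 0).hasMFDerivAt

theorem MaximalTorus.isOneParameter (T : MaximalTorus E G) (h : Fin T.rank → ℝ) :
    IsOneParameter (fun s : ℝ => T.par (s • h)) (T.dpar h) := by
  refine ⟨fun s t => by rw [add_smul, T.map_add], ?_⟩
  have h1 : HasMFDerivAt 𝓘(ℝ, ℝ) 𝓘(ℝ, Fin T.rank → ℝ) (fun s : ℝ => s • h) 0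
      ((1 : ℝ →L[ℝ] ℝ).smulRight h) := by
    have h2 : HasFDerivAt (fun s : ℝ => s • h) ((1 : ℝ →L[ℝ] ℝ).smulRight h) 0 :=
      ((1 : ℝ →L[ℝ] ℝ).smulRight h).hasFDerivAt
    exact h2.hasMFDerivAt
  have h3 : HasMFDerivAt 𝓘(ℝ, Fin T.rank → ℝ) 𝓘(ℝ, E) T.par ((0 : ℝ) • h)
      (mfderiv 𝓘(ℝ, Fin T.rank → ℝ) 𝓘(ℝ, E) T.par 0 : (Fin T.rank → ℝ) →L[ℝ] E) := by
    rw [zero_smul]; exact T.hasMFDerivAt_par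
  exact (h3.comp (0 : ℝ) h1).congr_mfderiv (comp_smulRight_one (V := Fin T.rank → ℝ) (W := E)
    (mfderiv 𝓘(ℝ, Fin T.rank → ℝ) 𝓘(ℝ, E) T.par 0 : (Fin T.rank → ℝ) →L[ℝ] E) h)

variable [T2Space G]

/-- An integral curve of the left invariant field exists for a short time ε. Its left translates
start at every point and live equally long, so integral curves extend to all of ℝ; uniqueness gives
the homomorphism property. -/
theorem exists_isOneParameter [CompleteSpace E] (ξ : Lie E G) : ∃ γ : ℝ → G, IsOneParameter γ ξ := by
  obtain ⟨γ, hγ0, hγ⟩ := exists_isMIntegralCurveAt_of_contMDiffAt_boundaryless (I := 𝓘(ℝ, E))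
    (x₀ := (1 : G)) 0 (contMDiff_invariantField ξ).contMDiffAt
  obtain ⟨ε, hε, hγ⟩ := isMIntegralCurveAt_iff'.1 hγ
  rw [Real.ball_eq_Ioo, zero_sub, zero_add] at hγ
  obtain ⟨α, hα0, hα⟩ := exists_isMIntegralCurve_of_isMIntegralCurveOn (I := 𝓘(ℝ, E))
    (contMDiff_invariantField ξ) hε
    (fun x => ⟨fun t => x * γ t, by simp [hγ0], isMIntegralCurveOn_mulLeft hγ x⟩) (1 : G)
  refine ⟨α, fun s t => ?_, ?_⟩
  · have h1 := isMIntegralCurve_mulLeft hα (α s)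
    have h2 := hα.comp_add s
    have h3 := isMIntegralCurve_Ioo_eq_of_contMDiff_boundaryless (t₀ := 0)
      (contMDiff_invariantField ξ) h2 h1 (by simp [hα0])
    have h4 := congrFun h3 t
    simpa [add_comm] using h4
  · have h1 := hα 0
    refine h1.congr_mfderiv ?_
    refine ContinuousLinearMap.ext fun c => ?_
    have h2 : (mulInvariantVectorField (I := 𝓘(ℝ, E)) ξ (α 0) : E) = ξ := by
      rw [hα0]; exact mulInvariantVectorField_one ξ
    exact congrArg (fun v : E => c • v) h2

theorem IsOneParameter.unique {γ γ' : ℝ → G} {ξ : Lie E G} (h : IsOneParameter γ ξ)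
    (h' : IsOneParameter γ' ξ) : γ = γ' :=
  isMIntegralCurve_Ioo_eq_of_contMDiff_boundaryless (t₀ := 0) (contMDiff_invariantField ξ)
    h.isMIntegralCurve h'.isMIntegralCurve (by rw [h.map_zero, h'.map_zero])

theorem isOneParameter_one : IsOneParameter (fun _ : ℝ => (1 : G)) (0 : Lie E G) := by
  refine ⟨fun _ _ => by simp, ?_⟩
  refine (hasMFDerivAt_const (I := 𝓘(ℝ, ℝ)) (I' := 𝓘(ℝ, E)) (1 : G) (0 : ℝ)).congr_mfderiv ?_
  exact ContinuousLinearMap.ext fun c => (smul_zero (M := ℝ) (A := E) c).symm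

/-- If `T.dpar h` is zero, then s ↦ `T.par (s • h)` is trivial, so the whole line through h lies in
ℤ^rank. At s = 1/(2 h_i) the i-th coordinate would be ½. -/
theorem MaximalTorus.dpar_injective (T : MaximalTorus E G) : Function.Injective T.dpar := by
  refine (injective_iff_map_eq_zero _).2 fun h hh => ?_
  have h1 := T.isOneParameter h
  rw [hh] at h1
  have h2 := h1.unique isOneParameter_one
  have h3 : ∀ s : ℝ, ∃ n : Fin T.rank → ℤ, s • h = toReal n := fun s =>
    (T.kernel _).1 (congrFun h2 s)
  funext i
  by_contra hi
  obtain ⟨n, hn⟩ := h3 (1 / (2 * h i))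
  have h4 := congrFun hn i
  simp only [Pi.smul_apply, smul_eq_mul, toReal] at h4
  have h5 : 1 / (2 * h i) * h i = 1 / 2 := by
    have : h i ≠ 0 := hi
    field_simp
  rw [h5] at h4
  have h6 : (2 * n i : ℤ) = 1 := by
    have : (2 * (n i : ℝ)) = 1 := by linarith
    exact_mod_cast this
  omega

theorem hasFDerivAt_chart_comp {U : Type*} [NormedAddCommGroup U] [NormedSpace ℝ U] {c : U → G}
    (hc : c 0 = 1) {c' : U →L[ℝ] E} (hc' : HasMFDerivAt 𝓘(ℝ, U) 𝓘(ℝ, E) c 0 c') :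
    HasFDerivAt (fun x => chartAt E (1 : G) (c x)) c' 0 := by
  have h2 := hc'.2
  simp only [writtenInExtChartAt, extChartAt, mfld_simps] at h2
  rw [hc] at h2
  exact hasFDerivWithinAt_univ.1 h2

/-- In the chart at the unit, multiplication has derivative (u, v) ↦ u + v: each partial derivative
is the identity, because the other factor is held at 1. -/
theorem hasFDerivAt_chart_mul {V W : Type*} [NormedAddCommGroup V] [NormedSpace ℝ V]
    [NormedAddCommGroup W] [NormedSpace ℝ W] {a : V → G} {b : W → G} (ha : a 0 = 1) (hb : b 0 = 1)
    {a' : V →L[ℝ] E} {b' : W →L[ℝ] E} (ha' : HasMFDerivAt 𝓘(ℝ, V) 𝓘(ℝ, E) a 0 a')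
    (hb' : HasMFDerivAt 𝓘(ℝ, W) 𝓘(ℝ, E) b 0 b') :
    HasFDerivAt (fun p : V × W => chartAt E (1 : G) (a p.1 * b p.2))
      (a'.comp (ContinuousLinearMap.fst ℝ V W) + b'.comp (ContinuousLinearMap.snd ℝ V W)) 0 := by
  have : IsTopologicalGroup G := topologicalGroup_of_lieGroup 𝓘(ℝ, E) ∞
  set ψ := chartAt E (1 : G) with hψd
  have hψ : ψ 1 ∈ ψ.target := mem_chart_target E 1
  have h1s : (1 : G) ∈ ψ.source := mem_chart_source E 1
  have hs : ContMDiffAt 𝓘(ℝ, E) 𝓘(ℝ, E) ∞ ψ.symm (ψ 1) :=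
    (contMDiffOn_chart_symm (I := 𝓘(ℝ, E)) (n := ∞) (x := (1 : G))).contMDiffAt
      (ψ.open_target.mem_nhds hψ)
  have hmu : ContDiffAt ℝ ∞ (fun p : E × E => ψ (ψ.symm p.1 * ψ.symm p.2)) (ψ 1, ψ 1) := by
    have h1 : ContMDiffAt 𝓘(ℝ, E × E) 𝓘(ℝ, E) ∞ (fun p : E × E => ψ.symm p.1) (ψ 1, ψ 1) :=
      ContMDiffAt.comp (ψ 1, ψ 1) hs contDiff_fst.contMDiff.contMDiffAt
    have h2 : ContMDiffAt 𝓘(ℝ, E × E) 𝓘(ℝ, E) ∞ (fun p : E × E => ψ.symm p.2) (ψ 1, ψ 1) :=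
      ContMDiffAt.comp (ψ 1, ψ 1) hs contDiff_snd.contMDiff.contMDiffAt
    have hc : ContMDiffAt 𝓘(ℝ, E) 𝓘(ℝ, E) ∞ ψ 1 :=
      (contMDiffOn_chart (I := 𝓘(ℝ, E)) (n := ∞) (x := (1 : G))).contMDiffAt
        (ψ.open_source.mem_nhds h1s)
    exact (ContMDiffAt.comp_of_eq hc (h1.mul h2) (by simp [ψ.left_inv h1s])).contDiffAt
  have hmu' := (hmu.differentiableAt (by simp)).hasFDerivAt
  set D := fderiv ℝ (fun p : E × E => ψ (ψ.symm p.1 * ψ.symm p.2)) (ψ 1, ψ 1)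
  have hD1 : ∀ u : E, D (u, 0) = u := by
    intro u
    have h1 : HasFDerivAt (fun y : E => ψ (ψ.symm y * ψ.symm (ψ 1)))
        (D.comp (ContinuousLinearMap.inl ℝ E E)) (ψ 1) :=
      HasFDerivAt.comp (f := fun y : E => (y, ψ 1)) (ψ 1) hmu' (hasFDerivAt_prodMk_left (ψ 1) (ψ 1))
    have h2 : HasFDerivAt (fun y : E => ψ (ψ.symm y * ψ.symm (ψ 1)))
        (ContinuousLinearMap.id ℝ E) (ψ 1) := by
      refine (hasFDerivAt_id (ψ 1)).congr_of_eventuallyEq ?_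
      filter_upwards [ψ.open_target.mem_nhds hψ] with y hy
      rw [ψ.left_inv h1s, mul_one, ψ.right_inv hy, id]
    exact congrArg (fun A : E →L[ℝ] E => A u) (h1.unique h2)
  have hD2 : ∀ u : E, D (0, u) = u := by
    intro u
    have h1 : HasFDerivAt (fun y : E => ψ (ψ.symm (ψ 1) * ψ.symm y))
        (D.comp (ContinuousLinearMap.inr ℝ E E)) (ψ 1) :=
      HasFDerivAt.comp (f := fun y : E => (ψ 1, y)) (ψ 1) hmu' (hasFDerivAt_prodMk_right (ψ 1) (ψ 1))
    have h2 : HasFDerivAt (fun y : E => ψ (ψ.symm (ψ 1) * ψ.symm y))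
        (ContinuousLinearMap.id ℝ E) (ψ 1) := by
      refine (hasFDerivAt_id (ψ 1)).congr_of_eventuallyEq ?_
      filter_upwards [ψ.open_target.mem_nhds hψ] with y hy
      rw [ψ.left_inv h1s, one_mul, ψ.right_inv hy, id]
    exact congrArg (fun A : E →L[ℝ] E => A u) (h1.unique h2)
  have hab : HasFDerivAt (fun p : V × W => (ψ (a p.1), ψ (b p.2)))
      ((a'.comp (ContinuousLinearMap.fst ℝ V W)).prod (b'.comp (ContinuousLinearMap.snd ℝ V W)))
      0 :=
    (HasFDerivAt.comp (f := Prod.fst) (0 : V × W) (hasFDerivAt_chart_comp ha ha')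
      hasFDerivAt_fst).prodMk (HasFDerivAt.comp (f := Prod.snd) (0 : V × W)
        (hasFDerivAt_chart_comp hb hb') hasFDerivAt_snd)
  have hval : ((ψ (a (0 : V × W).1), ψ (b (0 : V × W).2)) : E × E) = (ψ 1, ψ 1) := by
    rw [Prod.fst_zero, Prod.snd_zero, ha, hb]
  have hcomp := HasFDerivAt.comp (f := fun p : V × W => (ψ (a p.1), ψ (b p.2))) (0 : V × W)
    (by rw [hval]; exact hmu') hab
  have hca : ∀ᶠ p : V × W in nhds 0, a p.1 ∈ ψ.source :=
    (ContinuousAt.comp (f := Prod.fst) (x := (0 : V × W)) ha'.1 continuousAt_fst).eventually_mem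
      (ψ.open_source.mem_nhds (by simpa [ha] using h1s))
  have hcb : ∀ᶠ p : V × W in nhds 0, b p.2 ∈ ψ.source :=
    (ContinuousAt.comp (f := Prod.snd) (x := (0 : V × W)) hb'.1 continuousAt_snd).eventually_mem
      (ψ.open_source.mem_nhds (by simpa [hb] using h1s))
  refine (hcomp.congr_of_eventuallyEq ?_).congr_fderiv (ContinuousLinearMap.ext fun p => ?_)
  · filter_upwards [hca, hcb] with p hpa hpb
    simp only [Function.comp_apply, ψ.left_inv hpa, ψ.left_inv hpb]
  · change D (a' p.1, b' p.2) = a' p.1 + b' p.2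
    rw [← hD1 (a' p.1), ← hD2 (b' p.2), ← map_add]
    simp [hD1, hD2]

/-- The Lie algebra of a maximal torus is its own centralizer. -/
theorem MaximalTorus.mem_lie_of_fixed [CompleteSpace E] (T : MaximalTorus E G) {ξ : Lie E G}
    (hξ : ∀ x, Ad E (T.par x) ξ = ξ) : ξ ∈ T.lie := by
  have : IsTopologicalGroup G := topologicalGroup_of_lieGroup 𝓘(ℝ, E) ∞
  obtain ⟨γ, hγ⟩ := exists_isOneParameter ξ
  have hcomm : ∀ x s, T.par x * γ s = γ s * T.par x := by
    intro x s
    have h1 := hγ.conj (T.par x)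
    rw [hξ] at h1
    have h2 : T.par x * γ s * (T.par x)⁻¹ = γ s := congrFun (h1.unique hγ) s
    exact mul_inv_eq_iff_eq_mul.1 h2
  have hcommp : ∀ x y, T.par x * T.par y = T.par y * T.par x := fun x y => by
    rw [← T.map_add, add_comm, T.map_add]
  have hcommγ : ∀ x y, γ x * γ y = γ y * γ x := fun x y => by
    rw [← hγ.map_add, add_comm, hγ.map_add]
  -- T and γ commute, so they generate the image of a homomorphism from ℝ^rank × ℝ. Its closure is
  -- closed, connected and abelian and contains T; maximality then puts γ inside T.
  let f : (Multiplicative ((Fin T.rank → ℝ) × ℝ)) →* G :=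
    { toFun := fun p => T.par p.toAdd.1 * γ p.toAdd.2
      map_one' := by simp [T.par_zero, hγ.map_zero]
      map_mul' := fun p q => by
        simp only [toAdd_mul, Prod.fst_add, Prod.snd_add, T.map_add, hγ.map_add]
        rw [mul_assoc, mul_assoc, ← mul_assoc (T.par _) (γ _) (γ _), hcomm, mul_assoc] }
  have hfc : Continuous fun p : (Fin T.rank → ℝ) × ℝ => T.par p.1 * γ p.2 :=
    (T.smooth.continuous.comp continuous_fst).mul (hγ.continuous.comp continuous_snd)
  have hrange : (f.range : Set G) = Set.range fun p : (Fin T.rank → ℝ) × ℝ => T.par p.1 * γ p.2 := by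
    ext g
    exact Iff.rfl
  have hH := T.maximal f.range.topologicalClosure f.range.isClosed_topologicalClosure
    (by
      rw [Subgroup.topologicalClosure_coe, hrange]
      exact (isConnected_range hfc).closure)
    (by
      intro a ha b hb
      have hab : ∀ a ∈ f.range, ∀ b ∈ f.range, a * b = b * a := by
        rintro _ ⟨p, rfl⟩ _ ⟨q, rfl⟩
        rw [← map_mul, mul_comm, map_mul]
      have := Subgroup.commGroupTopologicalClosure f.range fun x y =>
        Subtype.ext (hab _ x.2 _ y.2)
      exact congrArg Subtype.val ((Subgroup.commGroupTopologicalClosure f.range fun x y =>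
        Subtype.ext (hab _ x.2 _ y.2)).mul_comm ⟨a, ha⟩ ⟨b, hb⟩))
    (by
      rintro _ ⟨x, rfl⟩
      exact f.range.le_topologicalClosure ⟨Multiplicative.ofAdd (x, 0), by simp [f, hγ.map_zero]⟩)
  have hγT : ∀ s, ∃ x, T.par x = γ s := fun s =>
    hH (f.range.le_topologicalClosure ⟨Multiplicative.ofAdd (0, s), by simp [f, T.par_zero]⟩)
  -- If ξ ∉ 𝔱, this homomorphism is an immersion at 0, so its kernel is discrete and hence
  -- countable. But the kernel surjects onto ℝ.
  by_contra hnot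
  let ψ := chartAt E (1 : G)
  have hψ : ψ 1 ∈ ψ.target := mem_chart_target E 1
  let L : ((Fin T.rank → ℝ) × ℝ) →L[ℝ] E :=
    ((mfderiv 𝓘(ℝ, Fin T.rank → ℝ) 𝓘(ℝ, E) T.par 0 : (Fin T.rank → ℝ) →L[ℝ] E).comp
      (ContinuousLinearMap.fst ℝ _ ℝ)) +
      ((1 : ℝ →L[ℝ] ℝ).smulRight (ξ : E)).comp (ContinuousLinearMap.snd ℝ _ ℝ)
  have hL : HasFDerivAt (fun p : (Fin T.rank → ℝ) × ℝ => ψ (T.par p.1 * γ p.2)) L 0 :=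
    hasFDerivAt_chart_mul T.par_zero hγ.map_zero T.hasMFDerivAt_par hγ.hasMFDerivAt
  have hinj : LinearMap.ker L.toLinearMap = ⊥ := by
    refine LinearMap.ker_eq_bot'.2 fun p hp => ?_
    have hp' : T.dpar p.1 + p.2 • ξ = 0 := hp
    have h2 : p.2 = 0 := by
      by_contra h2
      refine hnot ⟨-(p.2⁻¹ • p.1), ?_⟩
      rw [map_neg, map_smul, eq_neg_of_add_eq_zero_left hp', smul_neg, smul_smul,
        inv_mul_cancel₀ h2, one_smul, neg_neg]
    rw [h2, zero_smul, add_zero] at hp'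
    exact Prod.ext (T.dpar_injective (by rw [hp']; exact (map_zero _).symm)) h2
  obtain ⟨K, -, hK⟩ := L.toLinearMap.exists_antilipschitzWith hinj
  -- An injective derivative keeps nearby nonzero points away from the value at 0, so 0 is isolated
  -- in the kernel.
  have hne := hL.eventually_ne (c := ψ 1) ⟨K, hK⟩
  let A : AddSubgroup ((Fin T.rank → ℝ) × ℝ) := f.ker.toAddSubgroup'
  have hA : ∀ p, p ∈ A ↔ T.par p.1 * γ p.2 = 1 := fun p => Iff.rfl
  have hdisc : DiscreteTopology A := by
    obtain ⟨U, hU, hUo, h0U⟩ := eventually_nhds_iff.1 (eventually_nhdsWithin_iff.1 hne)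
    rw [discreteTopology_iff_isOpen_singleton_zero]
    refine ⟨U, hUo, ?_⟩
    ext p
    refine ⟨fun hp => ?_, fun hp => by rw [Set.mem_singleton_iff.1 hp]; exact h0U⟩
    by_contra hp0
    refine hU p.1 hp (fun h => hp0 (Subtype.ext h)) ?_
    rw [(hA _).1 p.2]
  have hcount : Countable A := countable_of_Lindelof_of_discrete
  -- If γ s = `T.par x`, then (-x, s) lies in the kernel.
  have hsurj : Function.Surjective fun p : A => p.1.2 := by
    intro s
    obtain ⟨x, hx⟩ := hγT s
    refine ⟨⟨(-x, s), (hA _).2 ?_⟩, rfl⟩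
    simp only
    rw [← hx, ← T.map_add, neg_add_cancel, T.par_zero]
  exact not_countable (α := ℝ) hsurj.countable

end OneParameter

/-! ### The Lie bracket as derivative of the adjoint action -/

section AdjointBracket

variable {E G : Type*} [NormedAddCommGroup E] [NormedSpace ℝ E]
  [TopologicalSpace G] [ChartedSpace E G] [Group G] [LieGroup 𝓘(ℝ, E) ∞ G]

variable (E) in
/-- The function `g ↦ Ad g η` with values in the model space. -/
def adjointFun (η : Lie E G) (g : G) : E := Ad E g η

/-- The adjoint action as a continuous linear map. -/
def adjointCLM (g : G) : E →L[ℝ] E := mfderiv 𝓘(ℝ, E) 𝓘(ℝ, E) (fun h : G => g * h * g⁻¹) 1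

/-- Smoothness is known as a map to the tangent bundle. All values lie over the unit, where the
preferred trivialization is the identity, so it passes to the fibre component. -/
theorem contMDiff_adjointFun (η : Lie E G) :
    ContMDiff 𝓘(ℝ, E) 𝓘(ℝ, E) ∞ (adjointFun E η) := by
  have hm : ContMDiff (𝓘(ℝ, E).prod 𝓘(ℝ, E)) 𝓘(ℝ, E) ∞ fun p : G × G => p.1 * p.2 * p.1⁻¹ :=
    (contMDiff_fst.mul contMDiff_snd).mul contMDiff_fst.inv
  have h := contMDiff_partial hm (1 : G) η
  have h0 : ContMDiff 𝓘(ℝ, E) 𝓘(ℝ, E).tangent ∞ fun g : G =>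
      (⟨1, adjointFun E η g⟩ : TangentBundle 𝓘(ℝ, E) G) := by
    refine (congrArg (ContMDiff _ _ _) (funext fun g => ?_)).mpr h
    have h1 : ∀ (x : G) (v : E), x = 1 →
        (⟨1, v⟩ : TangentBundle 𝓘(ℝ, E) G) = ⟨x, v⟩ := by
      rintro x v rfl; rfl
    exact h1 (g * 1 * g⁻¹) (adjointFun E η g) (by rw [mul_one, mul_inv_cancel])
  intro g
  have h2 := ((Bundle.contMDiffAt_totalSpace).1 (h0 g)).2
  refine h2.congr_of_eventuallyEq (Filter.Eventually.of_forall fun g' => ?_)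
  have h3 := (tangentBundleCore 𝓘(ℝ, E) G).coordChange_self (achart E (1 : G)) 1
    (mem_chart_source E 1) (adjointFun E η g')
  exact h3.symm

/-- The derivative of `g ↦ Ad g η` at the unit. -/
def adjointDeriv (η : Lie E G) : E →L[ℝ] E := mfderiv 𝓘(ℝ, E) 𝓘(ℝ, E) (adjointFun E η) 1

theorem hasMFDerivAt_adjointFun (η : Lie E G) :
    HasMFDerivAt 𝓘(ℝ, E) 𝓘(ℝ, E) (adjointFun E η) 1 (adjointDeriv (E := E) η) :=
  ((contMDiff_adjointFun (E := E) η).mdifferentiable (by simp) 1).hasMFDerivAt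

theorem adjointDeriv_add (η η' : Lie E G) :
    adjointDeriv (η + η') = adjointDeriv η + adjointDeriv η' := by
  have h : adjointFun E (η + η') = adjointFun E η + adjointFun E η' := by
    funext g; exact map_add (Ad E g) η η'
  have h1 := HasMFDerivAt.add (E' := E) (f := adjointFun E η) (g := adjointFun E η') (z := (1 : G))
    (hasMFDerivAt_adjointFun η) (hasMFDerivAt_adjointFun η')
  rw [← h] at h1
  exact h1.mfderiv

theorem adjointDeriv_smul (c : ℝ) (η : Lie E G) :
    adjointDeriv (c • η) = c • adjointDeriv η := by
  have h : adjointFun E (c • η) = c • adjointFun E η := by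
    funext g; exact map_smul (Ad E g) c η
  have h1 := HasMFDerivAt.const_smul (E' := E) (f := adjointFun E η) (z := (1 : G))
    (hasMFDerivAt_adjointFun η) c
  rw [← h] at h1
  exact h1.mfderiv

/-- The derivative of the adjoint action, `ad ξ η = [ξ, η]`. -/
def adBracket : Lie E G →ₗ[ℝ] Lie E G →ₗ[ℝ] Lie E G :=
  LinearMap.mk₂ ℝ (fun ξ η => adjointDeriv η ξ)
    (fun ξ ξ' η => map_add (adjointDeriv η) ξ ξ') (fun c ξ η => map_smul (adjointDeriv η) c ξ)
    (fun ξ η η' => by rw [adjointDeriv_add]; rfl) (fun c ξ η => by rw [adjointDeriv_smul]; rfl)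

theorem hasDerivAt_adjointFun {γ : ℝ → G} {ξ : Lie E G} (hγ : IsOneParameter γ ξ) (η : Lie E G) :
    HasDerivAt (fun s => adjointFun E η (γ s)) (adBracket ξ η : E) 0 :=
  hγ.hasDerivAt (hasMFDerivAt_adjointFun η)

/-- The derivative at s = 0 of Ad(g γ(s) g⁻¹) Ad(g) η = Ad(g) Ad(γ(s)) η. -/
theorem Ad_adBracket [T2Space G] [CompleteSpace E] (g : G) (ξ η : Lie E G) :
    Ad E g (adBracket ξ η) = adBracket (Ad E g ξ) (Ad E g η) := by
  obtain ⟨γ, hγ⟩ := exists_isOneParameter ξ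
  have h1 := hasDerivAt_adjointFun (hγ.conj g) (Ad E g η)
  have h2 := (adjointCLM g).hasFDerivAt.comp_hasDerivAt (0 : ℝ) (hasDerivAt_adjointFun hγ η)
  have h3 : (fun s => adjointFun E (Ad E g η) (g * γ s * g⁻¹)) =
      fun s => adjointCLM g (adjointFun E η (γ s)) := by
    funext s
    change Ad E (g * γ s * g⁻¹) (Ad E g η) = Ad E g (Ad E (γ s) η)
    rw [Ad_mul, Ad_mul, Ad_inv_Ad]
  rw [h3] at h1
  exact HasDerivAt.unique (F := E) h2 h1

/-- The complex bilinear extension of the bracket. -/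
def adBracketC : (ℂ ⊗[ℝ] Lie E G) →ₗ[ℂ] (ℂ ⊗[ℝ] Lie E G) →ₗ[ℂ] (ℂ ⊗[ℝ] Lie E G) :=
  LinearMap.BilinMap.baseChange ℂ (adBracket (E := E) (G := G))

theorem adBracketC_tmul (a b : ℂ) (ξ η : Lie E G) :
    adBracketC (a ⊗ₜ ξ) (b ⊗ₜ η) = (b * a) ⊗ₜ[ℝ] adBracket ξ η := by
  simp [adBracketC, mul_comm]

theorem Ad_adBracketC [T2Space G] [CompleteSpace E] (g : G) (x y : ℂ ⊗[ℝ] Lie E G) :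
    (Ad E g).baseChange ℂ (adBracketC x y) =
      adBracketC ((Ad E g).baseChange ℂ x) ((Ad E g).baseChange ℂ y) := by
  induction x using TensorProduct.induction_on with
  | zero => simp
  | add x x' hx hx' => simp only [map_add, LinearMap.add_apply, hx, hx']
  | tmul a ξ =>
    induction y using TensorProduct.induction_on with
    | zero => simp
    | add y y' hy hy' => simp only [map_add, hy, hy']
    | tmul b η => simp only [adBracketC_tmul, LinearMap.baseChange_tmul, Ad_adBracket]

end AdjointBracket

/-! ### Weight vectors in 𝔤_ℂ -/

section Weights

variable {E G : Type*} [NormedAddCommGroup E] [NormedSpace ℝ E]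
  [TopologicalSpace G] [ChartedSpace E G] [Group G] [LieGroup 𝓘(ℝ, E) ∞ G]
  {T : MaximalTorus E G}

theorem character_neg_eq_conj {r : ℕ} (ν : Fin r → ℤ) (x : Fin r → ℝ) :
    (character (-ν)).1 x = (starRingEnd ℂ) ((character ν).1 x) := by
  have h1 := character_mul_conj ν x
  have h2 : (character ν).1 x * (character (-ν)).1 x = 1 := by
    rw [← character_add, add_neg_cancel, character_zero]
  have h3 : (character ν).1 x ≠ 0 := fun h => by simp [h] at h2
  exact mul_left_cancel₀ h3 (h2.trans h1.symm)

theorem MaximalTorus.IsWeightVector.conj {α : Fin T.rank → ℤ} {x : ℂ ⊗[ℝ] Lie E G}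
    (hx : T.IsWeightVector α x) : T.IsWeightVector (-α) (conjC _ x) := by
  intro y
  rw [← conjC_baseChange, hx y, conjC_smul, character_neg_eq_conj]

theorem MaximalTorus.IsWeightVector.bracket [T2Space G] [CompleteSpace E]
    {α β : Fin T.rank → ℤ} {x y : ℂ ⊗[ℝ] Lie E G}
    (hx : T.IsWeightVector α x) (hy : T.IsWeightVector β y) :
    T.IsWeightVector (α + β) (adBracketC x y) := by
  intro z
  rw [Ad_adBracketC, hx z, hy z, character_add]
  simp [smul_smul, mul_comm]

/-- The real and imaginary parts on a complexification. -/
def complexifyPart {𝔞 : Type*} [AddCommGroup 𝔞] [Module ℝ 𝔞] (f : ℂ →ₗ[ℝ] ℝ) :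
    (ℂ ⊗[ℝ] 𝔞) →ₗ[ℝ] 𝔞 :=
  (TensorProduct.lid ℝ 𝔞).toLinearMap ∘ₗ LinearMap.rTensor 𝔞 f

theorem complexifyPart_baseChange {𝔞 : Type*} [AddCommGroup 𝔞] [Module ℝ 𝔞] (f : ℂ →ₗ[ℝ] ℝ)
    (g : 𝔞 →ₗ[ℝ] 𝔞) (x : ℂ ⊗[ℝ] 𝔞) :
    complexifyPart f (g.baseChange ℂ x) = g (complexifyPart f x) := by
  induction x using TensorProduct.induction_on with
  | zero => simp
  | add x x' hx hx' => simp only [map_add, hx, hx']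
  | tmul a ξ => simp [complexifyPart]

theorem eq_re_add_im {𝔞 : Type*} [AddCommGroup 𝔞] [Module ℝ 𝔞] (x : ℂ ⊗[ℝ] 𝔞) :
    x = 1 ⊗ₜ complexifyPart Complex.reLm x + Complex.I ⊗ₜ complexifyPart Complex.imLm x := by
  induction x using TensorProduct.induction_on with
  | zero => simp
  | add x x' hx hx' =>
    conv_lhs => rw [hx, hx']
    simp only [map_add, TensorProduct.tmul_add]
    abel
  | tmul a ξ =>
    simp only [complexifyPart, LinearMap.comp_apply, LinearMap.rTensor_tmul,
      LinearEquiv.coe_coe, TensorProduct.lid_tmul, Complex.reLm_coe, Complex.imLm_coe,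
      ← TensorProduct.smul_tmul]
    rw [← TensorProduct.add_tmul]
    congr 1
    apply Complex.ext <;> simp

/-- The real and imaginary parts are fixed by T, hence lie in 𝔱 by `MaximalTorus.mem_lie_of_fixed`.
-/
theorem MaximalTorus.IsWeightVector.eq_of_zero [T2Space G] [CompleteSpace E]
    {x : ℂ ⊗[ℝ] Lie E G} (hx : T.IsWeightVector 0 x) :
    ∃ h k : Fin T.rank → ℝ, x = 1 ⊗ₜ T.dpar h + Complex.I ⊗ₜ T.dpar k := by
  have h1 : ∀ f : ℂ →ₗ[ℝ] ℝ, complexifyPart f x ∈ T.lie := fun f =>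
    T.mem_lie_of_fixed fun y => by
      rw [← complexifyPart_baseChange, hx y, character_zero, one_smul]
  obtain ⟨h, hh⟩ := h1 Complex.reLm
  obtain ⟨k, hk⟩ := h1 Complex.imLm
  exact ⟨h, k, by rw [hh, hk]; exact eq_re_add_im x⟩

end Weights

/-! ### Weight decomposition of torus representations -/

section TorusRepresentations

variable {r : ℕ}

/-- A smooth homomorphism is the exponential of its derivative at 0: ψ(s y) exp(-s c(y)) is constant
in s. Triviality on the basis vectors forces the derivative there into 2πiℤ. -/
theorem exists_eq_character {ψ : (Fin r → ℝ) → ℂ} (hψ : ContDiff ℝ ∞ ψ)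
    (hadd : ∀ x y, ψ (x + y) = ψ x * ψ y) (hint : ∀ n : Fin r → ℤ, ψ (toReal n) = 1) :
    ∃ α : Fin r → ℤ, ∀ x, ψ x = (character α).1 x := by
  set c := fderiv ℝ ψ 0
  have hc : HasFDerivAt ψ c 0 := (hψ.differentiable (by simp) 0).hasFDerivAt
  have h0 : ψ 0 = 1 := by
    have := hint 0
    rwa [show toReal (0 : Fin r → ℤ) = 0 by ext i; simp [toReal]] at this
  have hderiv : ∀ (y : Fin r → ℝ) (s : ℝ), HasDerivAt (fun s : ℝ => ψ (s • y)) (ψ (s • y) * c y) s := by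
    intro y s
    have h1 : HasDerivAt (fun u : ℝ => (u - s) • y) y s := by
      simpa using ((hasDerivAt_id s).sub_const s).smul_const y
    have h2 : HasDerivAt (fun u : ℝ => ψ ((u - s) • y)) (c y) s := by
      have hc' : HasFDerivAt ψ c ((s - s) • y) := by rw [sub_self, zero_smul]; exact hc
      exact HasFDerivAt.comp_hasDerivAt s hc' h1
    refine (h2.const_mul (ψ (s • y))).congr_of_eventuallyEq (Filter.Eventually.of_forall fun u => ?_)
    change ψ (u • y) = ψ (s • y) * ψ ((u - s) • y)
    rw [← hadd, ← add_smul, add_sub_cancel]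
  have hexp : ∀ y, ψ y = Complex.exp (c y) := by
    intro y
    have h1 : ∀ s : ℝ, HasDerivAt (fun s : ℝ => ψ (s • y) * Complex.exp (-(s * c y))) 0 s := by
      intro s
      have h2 : HasDerivAt (fun s : ℝ => -((s : ℂ) * c y)) (-(c y)) s := by
        have h := ((Complex.ofRealCLM.hasDerivAt (x := s)).mul_const (c y)).neg
        exact h.congr_deriv (by simp)
      have h3 := (hderiv y s).mul h2.cexp
      refine h3.congr_deriv ?_
      ring
    have h2 := is_const_of_deriv_eq_zero (fun s => (h1 s).differentiableAt)
      (fun s => (h1 s).deriv) 1 0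
    simp only [one_smul, zero_smul, h0, Complex.ofReal_one, one_mul, Complex.ofReal_zero, zero_mul,
      neg_zero, Complex.exp_zero] at h2
    rw [Complex.exp_neg, mul_inv_eq_one₀ (Complex.exp_ne_zero _)] at h2
    exact h2
  have hα : ∀ j : Fin r, ∃ n : ℤ, c (Pi.single j 1) = n * (2 * Real.pi * Complex.I) := by
    intro j
    refine Complex.exp_eq_one_iff.1 ?_
    rw [← hexp]
    have h := hint (Pi.single j 1)
    rwa [show toReal (Pi.single j 1 : Fin r → ℤ) = Pi.single j 1 by
      ext i
      by_cases hi : i = j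
      · subst hi; simp [toReal]
      · simp [toReal, hi]] at h
  choose α hα using hα
  refine ⟨α, fun x => ?_⟩
  rw [hexp]
  change _ = Complex.exp _
  congr 1
  have hx : x = ∑ j, x j • (Pi.single j 1 : Fin r → ℝ) := by
    ext i
    simp [Finset.sum_apply, Pi.single_apply]
  conv_lhs => rw [hx, map_sum]
  simp only [map_smul, hα, dot, toReal, Complex.real_smul]
  push_cast
  rw [Finset.mul_sum]
  exact Finset.sum_congr rfl fun j _ => by ring

theorem exists_torsion (q : Fin r → ℚ) : ∃ (N : ℕ) (n : Fin r → ℤ), N ≠ 0 ∧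
    N • (fun i => (q i : ℝ)) = toReal n := by
  refine ⟨∏ j, (q j).den, fun i => (∏ j ∈ Finset.univ.erase i, ((q j).den : ℤ)) * (q i).num,
    Finset.prod_ne_zero_iff.2 fun j _ => (q j).den_nz, ?_⟩
  ext i
  simp only [toReal, Pi.smul_apply, nsmul_eq_mul, Int.cast_mul, Int.cast_prod, Int.cast_natCast]
  rw [← Finset.mul_prod_erase Finset.univ _ (Finset.mem_univ i)]
  have h : ((q i).den : ℝ) * (q i : ℝ) = (q i).num := by
    exact_mod_cast Rat.den_mul_eq_num (q i)
  push_cast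
  rw [mul_right_comm, h, mul_comm]

/-- A representation of a torus is a direct sum of weight spaces. -/
theorem span_weightVectors_eq_top {V : Type*} [AddCommGroup V] [Module ℂ V] [FiniteDimensional ℂ V]
    (A : (Fin r → ℝ) → Module.End ℂ V) (hadd : ∀ x y, A (x + y) = A x * A y)
    (hint : ∀ n : Fin r → ℤ, A (toReal n) = 1)
    (hsmooth : ∀ (ℓ : Module.Dual ℂ V) (v : V), ContDiff ℝ ∞ fun x => ℓ (A x v)) :
    Submodule.span ℂ {v | ∃ α : Fin r → ℤ, ∀ x, A x v = (character α).1 x • v} = ⊤ := by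
  let f : (Fin r → ℚ) → Module.End ℂ V := fun q => A fun i => (q i : ℝ)
  have hA0 : A 0 = 1 := by
    have := hint 0
    rwa [show toReal (0 : Fin r → ℤ) = 0 by ext i; simp [toReal]] at this
  have hpow : ∀ (N : ℕ) x, A (N • x) = A x ^ N := by
    intro N x
    induction N with
    | zero => rw [zero_smul, hA0, pow_zero]
    | succ N ih => rw [succ_nsmul, hadd, ih, pow_succ]
  -- Rational points have finite order N in the torus, so they act by roots of the separable
  -- polynomial X^N - 1. Generalized eigenspaces are then eigenspaces.
  have hss : ∀ q, (f q).IsFinitelySemisimple := by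
    intro q
    obtain ⟨N, n, hN, hn⟩ := exists_torsion q
    refine (Module.End.isFinitelySemisimple_iff_isSemisimple).2 ?_
    have hsep : (Polynomial.X ^ N - Polynomial.C (1 : ℂ)).Separable :=
      Polynomial.separable_X_pow_sub_C 1 (by exact_mod_cast hN) one_ne_zero
    refine Module.End.isSemisimple_of_squarefree_aeval_eq_zero hsep.squarefree ?_
    simp only [map_sub, map_pow, Polynomial.aeval_X, map_one]
    rw [sub_eq_zero]
    change A _ ^ N = 1
    rw [← hpow, hn, hint]
  have htop := Module.End.iSup_iInf_maxGenEigenspace_eq_top_of_iSup_maxGenEigenspace_eq_top_of_commute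
    f (fun p q _ => by
      change A _ * A _ = A _ * A _
      rw [← hadd, add_comm, hadd])
    (fun q => Module.End.iSup_maxGenEigenspace_eq_top (f q))
  rw [eq_top_iff, ← htop]
  refine iSup_le fun χ v hv => ?_
  have hv' : ∀ q, f q v = χ q • v := fun q => by
    have h := (Submodule.mem_iInf _).1 hv q
    rw [(hss q).maxGenEigenspace_eq_eigenspace] at h
    exact Module.End.mem_eigenspace_iff.1 h
  by_cases hv0 : v = 0
  · rw [hv0]; exact Submodule.zero_mem _
  -- A functional normalized to 1 at v reads off the eigenvalue as a smooth function of x.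
  obtain ⟨ℓ₁, hℓ₁⟩ : ∃ ℓ : Module.Dual ℂ V, ℓ v ≠ 0 := by
    by_contra! h
    exact hv0 ((Module.forall_dual_apply_eq_zero_iff ℂ v).1 h)
  set ℓ₀ := (ℓ₁ v)⁻¹ • ℓ₁
  have hℓ₀ : ℓ₀ v = 1 := by simp [ℓ₀, hℓ₁]
  have hdense : DenseRange (fun q : Fin r → ℚ => fun i => (q i : ℝ)) :=
    DenseRange.piMap fun _ => Rat.denseRange_cast
  -- Rational points are dense, so being an eigenvector extends to all x by continuity.
  have key : ∀ (ℓ : Module.Dual ℂ V) x, ℓ (A x v) = ℓ₀ (A x v) * ℓ v := by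
    intro ℓ
    refine congrFun (hdense.equalizer (hsmooth ℓ v).continuous
      ((hsmooth ℓ₀ v).continuous.mul continuous_const) (funext fun q => ?_))
    change ℓ (f q v) = ℓ₀ (f q v) * ℓ v
    rw [hv', map_smul, map_smul, hℓ₀, smul_eq_mul, smul_eq_mul, mul_one]
  have hAv : ∀ x, A x v = ℓ₀ (A x v) • v := fun x => by
    rw [← sub_eq_zero]
    refine (Module.forall_dual_apply_eq_zero_iff ℂ _).1 fun ℓ => ?_
    rw [map_sub, map_smul, smul_eq_mul, key, sub_self]
  obtain ⟨α, hα⟩ := exists_eq_character (hsmooth ℓ₀ v)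
    (fun x y => by
      rw [hadd, Module.End.mul_apply, hAv y, map_smul, map_smul, map_smul, hℓ₀, smul_eq_mul,
        smul_eq_mul, mul_one, mul_comm])
    (fun n => by rw [hint, Module.End.one_apply, hℓ₀])
  exact Submodule.subset_span ⟨α, fun x => by rw [← hα x]; exact hAv x⟩

end TorusRepresentations

section

variable {E G : Type*} [NormedAddCommGroup E] [NormedSpace ℝ E] [FiniteDimensional ℝ E]
  [TopologicalSpace G] [ChartedSpace E G] [Group G] [LieGroup 𝓘(ℝ, E) ∞ G]

theorem MaximalTorus.span_weightVectors (T : MaximalTorus E G) :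
    Submodule.span ℂ {x : ℂ ⊗[ℝ] Lie E G | ∃ α, T.IsWeightVector α x} = ⊤ := by
  have : FiniteDimensional ℝ (Lie E G) := inferInstanceAs (FiniteDimensional ℝ E)
  refine span_weightVectors_eq_top (fun x => (Ad E (T.par x)).baseChange ℂ) (fun x y => ?_)
    (fun n => ?_) fun ℓ v => ?_
  · refine complexify_induction fun a => ?_
    rw [Module.End.mul_apply]
    simp only [LinearMap.baseChange_tmul, T.map_add, Ad_mul]
  · refine complexify_induction fun a => ?_
    rw [(T.kernel _).2 ⟨n, rfl⟩, Module.End.one_apply, LinearMap.baseChange_tmul, Ad_one]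
  · induction v using TensorProduct.induction_on with
    | zero => simpa using contDiff_const
    | add v w hv hw =>
      have h := hv.add hw
      refine (congrArg (ContDiff ℝ ∞) (funext fun x => ?_)).mpr h
      change ℓ _ = ℓ _ + ℓ _
      rw [← LinearMap.map_add ℓ, ← LinearMap.map_add]
    | tmul c ξ =>
      let L₀ : E →ₗ[ℝ] ℂ :=
        (ℓ.restrictScalars ℝ ∘ₗ TensorProduct.mk ℝ ℂ (Lie E G) c : Lie E G →ₗ[ℝ] ℂ)
      let L : E →L[ℝ] ℂ := L₀.toContinuousLinearMap
      have h : ContMDiff 𝓘(ℝ, Fin T.rank → ℝ) 𝓘(ℝ, E) ∞ fun x => adjointFun E ξ (T.par x) :=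
        (contMDiff_adjointFun ξ).comp T.smooth
      exact L.contDiff.comp h.contDiff

end

/-! ### Infinitesimal representations and matrix coefficients -/

section Derivatives

variable {E G : Type*} [NormedAddCommGroup E] [NormedSpace ℝ E] [FiniteDimensional ℝ E]
  [TopologicalSpace G] [ChartedSpace E G] [Group G] [LieGroup 𝓘(ℝ, E) ∞ G] [T2Space G]

/-- The left invariant derivative is the derivative along a one-parameter group. -/
theorem IsOneParameter.hasDerivAt_leftDeriv {γ : ℝ → G} {ξ : Lie E G} (hγ : IsOneParameter γ ξ)
    {f : G → ℂ} (hf : ContMDiff 𝓘(ℝ, E) 𝓘(ℝ, ℂ) ∞ f) (g : G) :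
    HasDerivAt (fun s => f (g * γ s)) (leftDeriv E ξ f g) 0 := by
  have h1 : HasMFDerivAt 𝓘(ℝ, E) 𝓘(ℝ, E) (fun x : G => g * x) 1
      (mfderiv 𝓘(ℝ, E) 𝓘(ℝ, E) (fun x : G => g * x) 1 : E →L[ℝ] E) :=
    ((contMDiff_mulLeft_smooth (E := E) g).mdifferentiable (by simp) 1).hasMFDerivAt
  have h2 : HasMFDerivAt 𝓘(ℝ, E) 𝓘(ℝ, ℂ) f (g * 1)
      (mfderiv 𝓘(ℝ, E) 𝓘(ℝ, ℂ) f g : E →L[ℝ] ℂ) := by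
    rw [mul_one]; exact (hf.mdifferentiable (by simp) g).hasMFDerivAt
  exact hγ.hasDerivAt (h2.comp (1 : G) h1)

variable {n : ℕ} {π : Representation ℂ G (EuclideanSpace ℂ (Fin n))}

theorem IsOneParameter.hasDerivAt_rep {γ : ℝ → G} {ξ : Lie E G} (hγ : IsOneParameter γ ξ)
    (hπ : ∀ w, ContMDiff 𝓘(ℝ, E) 𝓘(ℝ, EuclideanSpace ℂ (Fin n)) ∞ fun g => π g w)
    (w : EuclideanSpace ℂ (Fin n)) :
    HasDerivAt (fun s => π (γ s) w)
      ((mfderiv 𝓘(ℝ, E) 𝓘(ℝ, EuclideanSpace ℂ (Fin n)) (fun g => π g w) 1 :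
        E →L[ℝ] EuclideanSpace ℂ (Fin n)) ξ) 0 :=
  hγ.hasDerivAt ((hπ w).mdifferentiable (by simp) 1).hasMFDerivAt

variable (hπ : ∀ w, ContMDiff 𝓘(ℝ, E) 𝓘(ℝ, EuclideanSpace ℂ (Fin n)) ∞ fun g => π g w)

/-- The infinitesimal representation of the Lie algebra. -/
def infRep : Lie E G →ₗ[ℝ] Module.End ℂ (EuclideanSpace ℂ (Fin n)) where
  toFun ξ :=
    { toFun := fun w => (mfderiv 𝓘(ℝ, E) 𝓘(ℝ, EuclideanSpace ℂ (Fin n)) (fun g => π g w) 1 :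
        E →L[ℝ] EuclideanSpace ℂ (Fin n)) ξ
      map_add' := fun w w' => by
        obtain ⟨γ, hγ⟩ := exists_isOneParameter ξ
        have h := (hγ.hasDerivAt_rep hπ w).add (hγ.hasDerivAt_rep hπ w')
        refine HasDerivAt.unique (hγ.hasDerivAt_rep hπ (w + w')) ?_
        exact (congrArg (fun f => HasDerivAt f _ 0) (funext fun s => map_add (π (γ s)) w w')).mpr h
      map_smul' := fun c w => by
        obtain ⟨γ, hγ⟩ := exists_isOneParameter ξ
        have h := (hγ.hasDerivAt_rep hπ w).const_smul c
        refine HasDerivAt.unique (hγ.hasDerivAt_rep hπ (c • w)) ?_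
        exact (congrArg (fun f => HasDerivAt f _ 0) (funext fun s => map_smul (π (γ s)) c w)).mpr h }
  map_add' ξ η := LinearMap.ext fun w => map_add
    (mfderiv 𝓘(ℝ, E) 𝓘(ℝ, EuclideanSpace ℂ (Fin n)) (fun g => π g w) 1 :
        E →L[ℝ] EuclideanSpace ℂ (Fin n)) ξ η
  map_smul' c ξ := LinearMap.ext fun w => map_smul
    (mfderiv 𝓘(ℝ, E) 𝓘(ℝ, EuclideanSpace ℂ (Fin n)) (fun g => π g w) 1 :
        E →L[ℝ] EuclideanSpace ℂ (Fin n)) c ξ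

theorem hasDerivAt_infRep {γ : ℝ → G} {ξ : Lie E G} (hγ : IsOneParameter γ ξ)
    (w : EuclideanSpace ℂ (Fin n)) : HasDerivAt (fun s => π (γ s) w) (infRep hπ ξ w) 0 :=
  hγ.hasDerivAt_rep hπ w

/-- The complexified infinitesimal representation. -/
def infRepC : (ℂ ⊗[ℝ] Lie E G) →ₗ[ℂ] Module.End ℂ (EuclideanSpace ℂ (Fin n)) :=
  (infRep hπ).liftBaseChange ℂ

theorem infRepC_tmul (c : ℂ) (ξ : Lie E G) : infRepC hπ (c ⊗ₜ ξ) = c • infRep hπ ξ := by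
  simp [infRepC]

theorem infRepC_apply (x : ℂ ⊗[ℝ] Lie E G) (w : EuclideanSpace ℂ (Fin n)) :
    infRepC hπ x w = infAction π w x := by
  induction x using TensorProduct.induction_on with
  | zero => simp
  | add x y hx hy => simp only [map_add, LinearMap.add_apply, hx, hy]
  | tmul c ξ =>
    rw [infRepC_tmul]
    simp only [infAction]
    rfl

theorem infRep_Ad (g : G) (ξ : Lie E G) (w : EuclideanSpace ℂ (Fin n)) :
    infRep hπ (Ad E g ξ) (π g w) = π g (infRep hπ ξ w) := by
  obtain ⟨γ, hγ⟩ := exists_isOneParameter ξ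
  have h1 := hasDerivAt_infRep hπ (hγ.conj g) (π g w)
  have h2 := (((π g).toContinuousLinearMap.restrictScalars ℝ).hasFDerivAt).comp_hasDerivAt (0 : ℝ)
    (hasDerivAt_infRep hπ hγ w)
  refine HasDerivAt.unique h1 ((congrArg (fun f => HasDerivAt f _ 0) (funext fun s => ?_)).mpr h2)
  change π (g * γ s * g⁻¹) (π g w) = π g (π (γ s) w)
  rw [← Module.End.mul_apply, ← Module.End.mul_apply, ← map_mul, ← map_mul, inv_mul_cancel_right]

/-- Differentiate dπ(Ad γ(s) η) π(γ(s)) w = π(γ(s)) dπ(η) w at s = 0, using the product rule on the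
left. -/
theorem infRep_adBracket (ξ η : Lie E G) (w : EuclideanSpace ℂ (Fin n)) :
    infRep hπ (adBracket ξ η) w =
      infRep hπ ξ (infRep hπ η w) - infRep hπ η (infRep hπ ξ w) := by
  have : FiniteDimensional ℝ (EuclideanSpace ℂ (Fin n)) := FiniteDimensional.complexToReal _
  obtain ⟨γ, hγ⟩ := exists_isOneParameter ξ
  let β₀ : E →ₗ[ℝ] EuclideanSpace ℂ (Fin n) →ₗ[ℝ] EuclideanSpace ℂ (Fin n) :=
    (LinearMap.mk₂ ℝ (fun ζ u => infRep hπ ζ u) (fun _ _ _ => by simp) (fun _ _ _ => by simp)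
      (fun _ _ _ => by simp) (fun c _ _ => by simp) :
      Lie E G →ₗ[ℝ] EuclideanSpace ℂ (Fin n) →ₗ[ℝ] EuclideanSpace ℂ (Fin n))
  let β := β₀.toContinuousBilinearMap
  have h1 := (β.hasFDerivAt.comp_hasDerivAt (0 : ℝ) (hasDerivAt_adjointFun hγ η)).clm_apply
    (hasDerivAt_infRep hπ hγ w)
  have h2 := hasDerivAt_infRep hπ hγ (infRep hπ η w)
  have h3 := HasDerivAt.unique h2
    ((congrArg (fun f => HasDerivAt f _ 0) (funext fun s => ?_)).mpr h1)
  · have e1 : (β ∘ fun s => adjointFun E η (γ s)) 0 (infRep hπ ξ w) =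
        infRep hπ η (infRep hπ ξ w) := by
      change infRep hπ (Ad E (γ 0) η) _ = _
      rw [hγ.map_zero, Ad_one]
    rw [h3, e1, hγ.map_zero, map_one, Module.End.one_apply, add_sub_cancel_right]
    rfl
  · exact (infRep_Ad hπ (γ s) η w).symm

theorem infRepC_adBracketC (x y : ℂ ⊗[ℝ] Lie E G) (w : EuclideanSpace ℂ (Fin n)) :
    infRepC hπ (adBracketC x y) w =
      infRepC hπ x (infRepC hπ y w) - infRepC hπ y (infRepC hπ x w) := by
  induction x using TensorProduct.induction_on with
  | zero => simp
  | add x x' hx hx' =>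
    simp only [map_add, LinearMap.add_apply, hx, hx']
    abel
  | tmul a ξ =>
    induction y using TensorProduct.induction_on with
    | zero => simp
    | add y y' hy hy' =>
      simp only [map_add, LinearMap.add_apply, hy, hy']
      abel
    | tmul b η =>
      simp only [adBracketC_tmul, infRepC_tmul, LinearMap.smul_apply, map_smul, infRep_adBracket,
        smul_sub, smul_smul]
      rw [mul_comm]

theorem leftDeriv_matrixCoeff {v u : EuclideanSpace ℂ (Fin n)} (ξ : Lie E G) (g : G) :
    leftDeriv E ξ (fun g => inner ℂ v (π g u)) g = inner ℂ v (π g (infRep hπ ξ u)) := by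
  obtain ⟨γ, hγ⟩ := exists_isOneParameter ξ
  have hs : ContMDiff 𝓘(ℝ, E) 𝓘(ℝ, ℂ) ∞ fun g => inner ℂ v (π g u) :=
    (((innerSL ℂ v).restrictScalars ℝ).contDiff).contMDiff.comp (hπ u)
  have h1 := hγ.hasDerivAt_leftDeriv hs g
  have h2 := ((((innerSL ℂ v) ∘L (π g).toContinuousLinearMap).restrictScalars
    ℝ).hasFDerivAt).comp_hasDerivAt (0 : ℝ) (hasDerivAt_infRep hπ hγ u)
  refine HasDerivAt.unique h1 ((congrArg (fun f => HasDerivAt f _ 0) (funext fun s => ?_)).mpr h2)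
  change inner ℂ v (π (g * γ s) u) = inner ℂ v (π g (π (γ s) u))
  rw [map_mul, Module.End.mul_apply]

/-- Left invariant derivatives fall on the right-hand vector, so bounding the derivatives of a
matrix coefficient amounts to bounding products of the operators dπ(ξ) on u. -/
theorem wordDeriv_matrixCoeff {v u : EuclideanSpace ℂ (Fin n)} (w : List (Lie E G)) (g : G) :
    wordDeriv E w (fun g => inner ℂ v (π g u)) g =
      inner ℂ v (π g (w.foldr (fun ξ => infRep hπ ξ) u)) := by
  induction w generalizing g with
  | nil => rfl
  | cons ξ w ih =>
    change leftDeriv E ξ (wordDeriv E w _) g = _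
    rw [funext ih, leftDeriv_matrixCoeff hπ]
    rfl

theorem inner_infRep (hu : ∀ g w w', inner ℂ (π g w) (π g w') = inner ℂ w w')
    (ξ : Lie E G) (w w' : EuclideanSpace ℂ (Fin n)) :
    inner ℂ (infRep hπ ξ w) w' = - inner ℂ w (infRep hπ ξ w') := by
  obtain ⟨γ, hγ⟩ := exists_isOneParameter ξ
  have h1 := (hasDerivAt_infRep hπ hγ w).inner ℂ (hasDerivAt_infRep hπ hγ w')
  simp only [hu, hγ.map_zero, map_one, Module.End.one_apply] at h1
  have h2 := h1.unique (hasDerivAt_const (0 : ℝ) _)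
  exact eq_neg_of_add_eq_zero_right h2

theorem inner_infRepC (hu : ∀ g w w', inner ℂ (π g w) (π g w') = inner ℂ w w')
    (x : ℂ ⊗[ℝ] Lie E G) (w w' : EuclideanSpace ℂ (Fin n)) :
    inner ℂ (infRepC hπ x w) w' = - inner ℂ w (infRepC hπ (conjC _ x) w') := by
  induction x using TensorProduct.induction_on with
  | zero => simp
  | add x y hx hy =>
    simp only [map_add, LinearMap.add_apply, inner_add_left, inner_add_right, hx, hy]
    ring
  | tmul c ξ =>
    have e : conjC (Lie E G) (c ⊗ₜ ξ) = (starRingEnd ℂ c) ⊗ₜ ξ := rfl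
    rw [e, infRepC_tmul, infRepC_tmul, LinearMap.smul_apply, LinearMap.smul_apply,
      inner_smul_left, inner_smul_right, inner_infRep hπ hu, mul_neg]

end Derivatives

/-! ### The Casimir operator -/

section Casimir

theorem repr_orthonormal {V ι : Type*} [AddCommGroup V] [Module ℝ V] [Fintype ι] [DecidableEq ι]
    {B : LinearMap.BilinForm ℝ V} {b : Module.Basis ι ℝ V}
    (hb : ∀ i j, B (b i) (b j) = if i = j then 1 else 0) (x : V) : ∑ a, B (b a) x • b a = x := by
  conv_rhs => rw [← b.sum_repr x]
  refine Finset.sum_congr rfl fun a _ => ?_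
  congr 1
  conv_lhs => rw [← b.sum_repr x, map_sum]
  simp only [map_smul, hb, smul_eq_mul, mul_ite, mul_one, mul_zero]
  simp

/-- The contraction of a bilinear map with an inner product is independent of the orthonormal
basis. -/
theorem sum_orthonormal_eq {V W ι κ : Type*} [AddCommGroup V] [Module ℝ V] [AddCommGroup W]
    [Module ℝ W] [Fintype ι] [Fintype κ] {B : LinearMap.BilinForm ℝ V} {b : ι → V} {c : κ → V}
    (hb : ∀ x, ∑ a, B (b a) x • b a = x) (hc : ∀ x, ∑ a, B (c a) x • c a = x)
    (hB : ∀ x y, B x y = B y x) (β : V →ₗ[ℝ] V →ₗ[ℝ] W) :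
    ∑ a, β (c a) (c a) = ∑ a, β (b a) (b a) := by
  have h1 : ∀ a, β (c a) (c a) = ∑ i, B (b i) (c a) • β (b i) (c a) := fun a => by
    have h : β (c a) (c a) = β (∑ i, B (b i) (c a) • b i) (c a) := by rw [hb]
    rw [h, map_sum, LinearMap.sum_apply]
    simp only [map_smul, LinearMap.smul_apply]
  have h2 : ∀ i, β (b i) (b i) = ∑ a, B (b i) (c a) • β (b i) (c a) := fun i => by
    have h : β (b i) (b i) = β (b i) (∑ a, B (c a) (b i) • c a) := by rw [hc]
    rw [h, map_sum]
    simp only [map_smul, hB (c _) (b i)]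
  simp only [h1, h2]
  exact Finset.sum_comm

variable {E G : Type*} [NormedAddCommGroup E] [NormedSpace ℝ E] [FiniteDimensional ℝ E]
  [TopologicalSpace G] [ChartedSpace E G] [Group G] [LieGroup 𝓘(ℝ, E) ∞ G] [T2Space G]
  {n : ℕ} {π : Representation ℂ G (EuclideanSpace ℂ (Fin n))}
  (hπ : ∀ w, ContMDiff 𝓘(ℝ, E) 𝓘(ℝ, EuclideanSpace ℂ (Fin n)) ∞ fun g => π g w)

/-- Ad g maps the orthonormal basis to another one, and the Casimir operator does not depend on the
basis. -/
theorem casimir_comm {ι : Type*} [Fintype ι] {B : InvariantInnerProduct E G} {b : ι → Lie E G}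
    (hb : ∀ x, ∑ a, B.form (b a) x • b a = x) (g : G) (w : EuclideanSpace ℂ (Fin n)) :
    ∑ a, infRep hπ (b a) (infRep hπ (b a) (π g w)) =
      π g (∑ a, infRep hπ (b a) (infRep hπ (b a) w)) := by
  have hc : ∀ x, ∑ a, B.form (Ad E g (b a)) x • Ad E g (b a) = x := fun x => by
    have h := congrArg (Ad E g) (hb (Ad E g⁻¹ x))
    rw [Ad_Ad_inv, map_sum] at h
    refine Eq.trans (Finset.sum_congr rfl fun a _ => ?_) h
    rw [map_smul, ← B.invariant g (b a), Ad_Ad_inv]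
  let β : Lie E G →ₗ[ℝ] Lie E G →ₗ[ℝ] EuclideanSpace ℂ (Fin n) :=
    LinearMap.mk₂ ℝ (fun ξ η => infRep hπ ξ (infRep hπ η (π g w))) (fun _ _ _ => by simp)
      (fun _ _ _ => by simp) (fun _ _ _ => by simp) (fun _ _ _ => by simp)
  have h := sum_orthonormal_eq hb hc B.symm β
  refine h.symm.trans ?_
  rw [map_sum]
  refine Finset.sum_congr rfl fun a _ => ?_
  change infRep hπ (Ad E g (b a)) (infRep hπ (Ad E g (b a)) (π g w)) = _
  rw [infRep_Ad, infRep_Ad]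

/-- In an irreducible unitary representation, the infinitesimal action is bounded, up to a constant,
by its value on any unit vector. -/
theorem sum_norm_infRep_sq (hirr : π.IsIrreducible)
    (hu : ∀ g w w', inner ℂ (π g w) (π g w') = inner ℂ w w') {ι : Type*} [Fintype ι]
    {B : InvariantInnerProduct E G} {b : ι → Lie E G} (hb : ∀ x, ∑ a, B.form (b a) x • b a = x)
    {v : EuclideanSpace ℂ (Fin n)} (hv : ‖v‖ = 1) (w : EuclideanSpace ℂ (Fin n)) :
    ∑ a, ‖infRep hπ (b a) w‖ ^ 2 = (∑ a, ‖infRep hπ (b a) v‖ ^ 2) * ‖w‖ ^ 2 := by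
  let K : Module.End ℂ (EuclideanSpace ℂ (Fin n)) := ∑ a, infRep hπ (b a) * infRep hπ (b a)
  have hK : ∀ w, K w = ∑ a, infRep hπ (b a) (infRep hπ (b a) w) := fun w => by
    simp [K, LinearMap.sum_apply]
  -- Schur's lemma: the Casimir operator is a scalar c.
  obtain ⟨c, hc⟩ := (Representation.IsIrreducible.algebraMap_intertwiningMap_bijective_of_isAlgClosed
    (ρ := π)).2 (K.intertwiningMap_of_isIntertwiningMap π π fun g w => by
      rw [hK, hK]; exact casimir_comm hπ hb g w)
  have hKc : ∀ w, K w = c • w := fun w => by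
    have h := congrArg (fun f : Representation.IntertwiningMap π π => f.toLinearMap w) hc
    exact h.symm
  -- Each dπ(b_a) is skew-adjoint, so the sum of squares is -⟨w, K w⟩ = -c ‖w‖²; the unit vector v
  -- then determines c.
  have h1 : ∀ w, ((∑ a, ‖infRep hπ (b a) w‖ ^ 2 : ℝ) : ℂ) = -c * (‖w‖ : ℂ) ^ 2 := fun w => by
    have h2 : inner ℂ w (K w) = c * (‖w‖ : ℂ) ^ 2 := by
      rw [hKc, inner_smul_right, inner_self_eq_norm_sq_to_K]
      rfl
    rw [neg_mul, ← h2, hK, inner_sum, ← Finset.sum_neg_distrib]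
    push_cast
    refine Finset.sum_congr rfl fun a _ => ?_
    rw [← inner_infRep hπ hu, inner_self_eq_norm_sq_to_K]
    rfl
  have h2 := h1 v
  rw [hv, Complex.ofReal_one, one_pow, mul_one] at h2
  have h3 := h1 w
  rw [← h2] at h3
  exact_mod_cast h3

end Casimir

/-! ### Growth of representations in the highest weight -/

section HighestWeight

variable {E G : Type*} [NormedAddCommGroup E] [NormedSpace ℝ E] [FiniteDimensional ℝ E]
  [TopologicalSpace G] [ChartedSpace E G] [Group G] [LieGroup 𝓘(ℝ, E) ∞ G]

/-- `v` is a highest weight vector of unit length in the unitary irreducible representation `π` of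
highest weight `μ`. -/
structure MaximalTorus.IsHighestWeight (T : MaximalTorus E G) (ξ₀ : Fin T.rank → ℝ)
    (μ : Fin T.rank → ℤ) {n : ℕ} (π : Representation ℂ G (EuclideanSpace ℂ (Fin n)))
    (v : EuclideanSpace ℂ (Fin n)) : Prop where
  irreducible : π.IsIrreducible
  smooth : ∀ w, ContMDiff 𝓘(ℝ, E) 𝓘(ℝ, EuclideanSpace ℂ (Fin n)) ∞ fun g => π g w
  unitary : ∀ g w w', inner ℂ (π g w) (π g w') = inner ℂ w w'
  norm_eq_one : ‖v‖ = 1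
  annihilated : ∀ α ∈ T.posRoots ξ₀, ∀ e, T.IsWeightVector α e → infAction π v e = 0
  weight : ∀ x, π (T.par x) v = (character μ).1 x • v

variable [T2Space G] {T : MaximalTorus E G} {ξ₀ : Fin T.rank → ℝ} {μ : Fin T.rank → ℤ} {n : ℕ}
  {π : Representation ℂ G (EuclideanSpace ℂ (Fin n))} {v : EuclideanSpace ℂ (Fin n)}

theorem wordDeriv_zero (w : List (Lie E G)) : wordDeriv E w (0 : G → ℂ) = 0 := by
  induction w with
  | nil => rfl
  | cons ξ w ih =>
    change leftDeriv E ξ (wordDeriv E w 0) = 0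
    rw [ih]
    funext g
    have hz : (mfderiv 𝓘(ℝ, E) 𝓘(ℝ, ℂ) (0 : G → ℂ) g : E →L[ℝ] ℂ) = 0 :=
      mfderiv_const (c := (0 : ℂ))
    exact congrArg (fun L : E →L[ℝ] ℂ => L (mulInvariantVectorField (I := 𝓘(ℝ, E)) ξ g)) hz

theorem norm_dot_le {r : ℕ} (x h : Fin r → ℝ) : |dot x h| ≤ (∑ i, |h i|) * ‖x‖ := by
  unfold dot
  refine (Finset.abs_sum_le_sum_abs _ _).trans ?_
  rw [Finset.sum_mul]
  refine Finset.sum_le_sum fun i _ => ?_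
  rw [abs_mul, mul_comm]
  exact mul_le_mul_of_nonneg_left (norm_le_pi_norm x i) (abs_nonneg _)

theorem MaximalTorus.IsHighestWeight.infRep_dpar (H : T.IsHighestWeight ξ₀ μ π v)
    (h : Fin T.rank → ℝ) :
    infRep H.smooth (T.dpar h) v = (2 * Real.pi * Complex.I * (dot (toReal μ) h : ℝ) : ℂ) • v := by
  have h1 := hasDerivAt_infRep H.smooth (T.isOneParameter h) v
  simp only [H.weight] at h1
  have h2 : HasDerivAt (fun s : ℝ => (character μ).1 (s • h))
      (2 * Real.pi * Complex.I * (dot (toReal μ) h : ℝ) : ℂ) 0 := by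
    have e : (fun s : ℝ => (character μ).1 (s • h)) =
        fun s : ℝ => Complex.exp ((s : ℂ) * (2 * Real.pi * Complex.I * (dot (toReal μ) h : ℝ))) := by
      funext s
      change Complex.exp _ = _
      congr 1
      simp only [dot, Pi.smul_apply, smul_eq_mul]
      push_cast
      simp only [Finset.mul_sum]
      exact Finset.sum_congr rfl fun i _ => by ring
    rw [e]
    have h3 := ((Complex.ofRealCLM.hasDerivAt (x := 0)).mul_const
      (2 * Real.pi * Complex.I * (dot (toReal μ) h : ℝ) : ℂ)).cexp
    exact h3.congr_deriv (by simp)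
  exact h1.unique (h2.smul_const v)

theorem MaximalTorus.IsHighestWeight.norm_infRep_dpar_le (H : T.IsHighestWeight ξ₀ μ π v)
    (h : Fin T.rank → ℝ) :
    ‖infRep H.smooth (T.dpar h) v‖ ≤ (2 * Real.pi * ∑ i, |h i|) * (1 + ‖toReal μ‖) := by
  rw [H.infRep_dpar, norm_smul, H.norm_eq_one, mul_one]
  have h1 : ‖(2 * Real.pi * Complex.I * (dot (toReal μ) h : ℝ) : ℂ)‖ =
      2 * Real.pi * |dot (toReal μ) h| := by
    simp [Real.pi_pos.le]
  rw [h1, mul_assoc _ (∑ i, |h i|)]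
  refine mul_le_mul_of_nonneg_left ((norm_dot_le _ _).trans ?_) (by positivity)
  exact mul_le_mul_of_nonneg_left (by linarith) (Finset.sum_nonneg fun i _ => abs_nonneg _)

/-- `x` acts on highest weight vectors with at most linear growth in the highest weight. -/
def MaximalTorus.HasLinearGrowth (T : MaximalTorus E G) (ξ₀ : Fin T.rank → ℝ)
    (x : ℂ ⊗[ℝ] Lie E G) : Prop :=
  ∃ C : ℝ, 0 ≤ C ∧ ∀ (μ : Fin T.rank → ℤ) (n : ℕ)
    (π : Representation ℂ G (EuclideanSpace ℂ (Fin n))) (v : EuclideanSpace ℂ (Fin n))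
    (H : T.IsHighestWeight ξ₀ μ π v), ‖infRepC H.smooth x v‖ ≤ C * (1 + ‖toReal μ‖)

theorem MaximalTorus.IsWeightVector.hasLinearGrowth_zero {x : ℂ ⊗[ℝ] Lie E G}
    (hx : T.IsWeightVector 0 x) : T.HasLinearGrowth ξ₀ x := by
  obtain ⟨h, k, rfl⟩ := hx.eq_of_zero
  refine ⟨(2 * Real.pi * ∑ i, |h i|) + (2 * Real.pi * ∑ i, |k i|),
    add_nonneg (mul_nonneg (by positivity) (Finset.sum_nonneg fun i _ => abs_nonneg _))
      (mul_nonneg (by positivity) (Finset.sum_nonneg fun i _ => abs_nonneg _)),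
    fun μ n π v H => ?_⟩
  rw [LinearMap.map_add, infRepC_tmul, infRepC_tmul, one_smul, add_mul]
  refine (norm_add_le _ _).trans (add_le_add (H.norm_infRep_dpar_le h) ?_)
  rw [LinearMap.smul_apply, norm_smul, Complex.norm_I, one_mul]
  exact H.norm_infRep_dpar_le k

theorem MaximalTorus.IsWeightVector.hasLinearGrowth {α : Fin T.rank → ℤ} {x : ℂ ⊗[ℝ] Lie E G}
    (hx : T.IsWeightVector α x) (hξ₀ : T.IsRegular ξ₀) : T.HasLinearGrowth ξ₀ x := by
  by_cases hα : α = 0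
  · subst hα
    exact hx.hasLinearGrowth_zero
  by_cases hx0 : x = 0
  · exact ⟨0, le_rfl, fun μ n π v H => by rw [hx0]; simp⟩
  have hroot : α ∈ T.roots := ⟨hα, x, hx0, hx⟩
  rcases lt_or_gt_of_ne (hξ₀ α hroot) with hneg | hpos
  -- For a negative root, the conjugate x̄ belongs to a positive root and kills v, so ‖x v‖² = -⟨v,
  -- [x̄, x] v⟩. The bracket has weight zero, where linear growth is known.
  · obtain ⟨C, hC, hbound⟩ := MaximalTorus.IsWeightVector.hasLinearGrowth_zero (ξ₀ := ξ₀)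
      (x := adBracketC (conjC _ x) x) (by simpa using hx.conj.bracket hx)
    refine ⟨C + 1, by positivity, fun μ n π v H => ?_⟩
    have h1 : infRepC H.smooth (conjC _ x) v = 0 := by
      by_cases hc : conjC _ x = 0
      · rw [hc]; simp
      rw [infRepC_apply]
      refine H.annihilated (-α) ⟨⟨neg_ne_zero.2 hα, _, hc, hx.conj⟩, ?_⟩ _ hx.conj
      rw [toReal_neg, dot_neg_left]
      linarith
    have h2 : inner ℂ (infRepC H.smooth x v) (infRepC H.smooth x v) =
        - inner ℂ v (infRepC H.smooth (adBracketC (conjC _ x) x) v) := by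
      rw [inner_infRepC H.smooth H.unitary, infRepC_adBracketC, h1, map_zero, sub_zero]
    have h3 : ‖infRepC H.smooth x v‖ ^ 2 ≤ C * (1 + ‖toReal μ‖) := by
      have h4 := congrArg norm h2
      rw [norm_neg, inner_self_eq_norm_sq_to_K, norm_pow, RCLike.norm_ofReal, abs_norm] at h4
      rw [h4]
      refine (norm_inner_le_norm _ _).trans ?_
      rw [H.norm_eq_one, one_mul]
      exact hbound μ n π v H
    have h5 : 1 ≤ 1 + ‖toReal μ‖ := by linarith [norm_nonneg (toReal μ)]
    -- Here only the square of the norm is at most C (1 + ‖μ‖); since 1 + ‖μ‖ ≥ 1, this is below the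
    -- square of (C + 1)(1 + ‖μ‖).
    refine (sq_le_sq₀ (norm_nonneg _) (by positivity)).1 ?_
    nlinarith [mul_nonneg hC hC]
  · refine ⟨0, le_rfl, fun μ n π v H => ?_⟩
    rw [infRepC_apply, H.annihilated α ⟨hroot, hpos⟩ x hx]
    simp

theorem MaximalTorus.IsRegular.hasLinearGrowth (hξ₀ : T.IsRegular ξ₀) (x : ℂ ⊗[ℝ] Lie E G) :
    T.HasLinearGrowth ξ₀ x := by
  have hx : x ∈ Submodule.span ℂ {x : ℂ ⊗[ℝ] Lie E G | ∃ α, T.IsWeightVector α x} := by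
    rw [T.span_weightVectors]; trivial
  induction hx using Submodule.span_induction with
  | mem x hx =>
    obtain ⟨α, hα⟩ := hx
    exact hα.hasLinearGrowth hξ₀
  | zero => exact ⟨0, le_rfl, fun μ n π v H => by simp⟩
  | add x y _ _ hx hy =>
    obtain ⟨C, hC, hx⟩ := hx
    obtain ⟨C', hC', hy⟩ := hy
    refine ⟨C + C', by positivity, fun μ n π v H => ?_⟩
    rw [LinearMap.map_add, add_mul]
    exact (norm_add_le _ _).trans (add_le_add (hx μ n π v H) (hy μ n π v H))
  | smul c x _ hx =>
    obtain ⟨C, hC, hx⟩ := hx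
    refine ⟨‖c‖ * C, by positivity, fun μ n π v H => ?_⟩
    rw [map_smul, LinearMap.smul_apply, norm_smul, mul_assoc]
    exact mul_le_mul_of_nonneg_left (hx μ n π v H) (norm_nonneg c)

/-- The infinitesimal action on the irreducible representations has at most linear growth in the
highest weight. -/
theorem MaximalTorus.IsRegular.exists_norm_infRep_le (hξ₀ : T.IsRegular ξ₀)
    (B : InvariantInnerProduct E G) (ξ : Lie E G) :
    ∃ C : ℝ, 0 ≤ C ∧ ∀ (μ : Fin T.rank → ℤ) (n : ℕ)
      (π : Representation ℂ G (EuclideanSpace ℂ (Fin n))) (v : EuclideanSpace ℂ (Fin n))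
      (H : T.IsHighestWeight ξ₀ μ π v) (w : EuclideanSpace ℂ (Fin n)),
        ‖infRep H.smooth ξ w‖ ≤ C * (1 + ‖toReal μ‖) * ‖w‖ := by
  have : FiniteDimensional ℝ (Lie E G) := inferInstanceAs (FiniteDimensional ℝ E)
  obtain ⟨b, hb⟩ := exists_orthonormal_basis B.symm B.pos
  have hb' := repr_orthonormal hb
  choose C hC hbound using fun a => hξ₀.hasLinearGrowth ((1 : ℂ) ⊗ₜ[ℝ] b a)
  refine ⟨(∑ a, |B.form (b a) ξ|) * ∑ a, C a,
    mul_nonneg (Finset.sum_nonneg fun a _ => abs_nonneg _) (Finset.sum_nonneg fun a _ => hC a),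
    fun μ n π v H w => ?_⟩
  have hμ : 0 ≤ 1 + ‖toReal μ‖ := by positivity
  have h1 : ∀ a, ‖infRep H.smooth (b a) v‖ ≤ C a * (1 + ‖toReal μ‖) := fun a => by
    have h := hbound a μ n π v H
    rwa [infRepC_tmul, one_smul] at h
  have h2 : ∀ a, ‖infRep H.smooth (b a) w‖ ≤ (∑ a, C a) * (1 + ‖toReal μ‖) * ‖w‖ := fun a => by
    refine (sq_le_sq₀ (norm_nonneg _) (mul_nonneg (mul_nonneg
      (Finset.sum_nonneg fun a _ => hC a) hμ) (norm_nonneg _))).1 ?_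
    -- The Casimir identity replaces the arbitrary vector w by the highest weight vector v, where
    -- the linear bounds are available.
    calc ‖infRep H.smooth (b a) w‖ ^ 2 ≤ ∑ a, ‖infRep H.smooth (b a) w‖ ^ 2 :=
          Finset.single_le_sum (f := fun a => ‖infRep H.smooth (b a) w‖ ^ 2)
            (fun a _ => sq_nonneg _) (Finset.mem_univ a)
      _ = (∑ a, ‖infRep H.smooth (b a) v‖ ^ 2) * ‖w‖ ^ 2 :=
          sum_norm_infRep_sq H.smooth H.irreducible H.unitary hb' H.norm_eq_one w
      _ ≤ (∑ a, ‖infRep H.smooth (b a) v‖) ^ 2 * ‖w‖ ^ 2 :=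
          mul_le_mul_of_nonneg_right
            (Finset.sum_sq_le_sq_sum_of_nonneg fun a _ => norm_nonneg _) (sq_nonneg _)
      _ ≤ ((∑ a, C a) * (1 + ‖toReal μ‖)) ^ 2 * ‖w‖ ^ 2 := by
          refine mul_le_mul_of_nonneg_right (pow_le_pow_left₀
            (Finset.sum_nonneg fun a _ => norm_nonneg _) ?_ 2) (sq_nonneg _)
          rw [Finset.sum_mul]
          exact Finset.sum_le_sum fun a _ => h1 a
      _ = _ := by ring
  conv_lhs => rw [← hb' ξ]
  rw [map_sum, LinearMap.sum_apply]
  refine (norm_sum_le _ _).trans ?_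
  rw [mul_assoc, mul_assoc, Finset.sum_mul]
  refine Finset.sum_le_sum fun a _ => ?_
  rw [map_smul, LinearMap.smul_apply, norm_smul, Real.norm_eq_abs, ← mul_assoc (∑ a, C a)]
  exact mul_le_mul_of_nonneg_left (h2 a) (abs_nonneg _)

/-- The bound on dπ(ξ) holds on all vectors and not just on v, so it can be applied to each factor
of the product in turn. -/
theorem MaximalTorus.IsRegular.exists_norm_foldr_le (hξ₀ : T.IsRegular ξ₀)
    (B : InvariantInnerProduct E G) (l : List (Lie E G)) :
    ∃ C : ℝ, 0 ≤ C ∧ ∀ (μ : Fin T.rank → ℤ) (n : ℕ)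
      (π : Representation ℂ G (EuclideanSpace ℂ (Fin n))) (v : EuclideanSpace ℂ (Fin n))
      (H : T.IsHighestWeight ξ₀ μ π v),
        ‖l.foldr (fun ξ => infRep H.smooth ξ) v‖ ≤ C * (1 + ‖toReal μ‖) ^ l.length := by
  induction l with
  | nil => exact ⟨1, zero_le_one, fun μ n π v H => by simp [H.norm_eq_one]⟩
  | cons ξ l ih =>
    obtain ⟨C, hC, h⟩ := ih
    obtain ⟨C', hC', h'⟩ := hξ₀.exists_norm_infRep_le B ξ
    refine ⟨C' * C, mul_nonneg hC' hC, fun μ n π v H => ?_⟩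
    refine (h' μ n π v H _).trans ?_
    refine (mul_le_mul_of_nonneg_left (h μ n π v H) (by positivity)).trans_eq ?_
    rw [List.length_cons, pow_succ]
    ring

/-- The derivatives of the functions `Δ_μ` have at most polynomial growth in `μ`. -/
theorem MaximalTorus.IsRegular.exists_norm_wordDeriv_spherical_le (hξ₀ : T.IsRegular ξ₀)
    (B : InvariantInnerProduct E G) (w : List (Lie E G)) :
    ∃ C : ℝ, 0 ≤ C ∧ ∀ (μ : Fin T.rank → ℤ) (g : G),
      ‖wordDeriv E w (T.spherical ξ₀ μ).1 g‖ ≤ C * (1 + ‖toReal μ‖) ^ w.length := by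
  obtain ⟨C, hC, h⟩ := hξ₀.exists_norm_foldr_le B w
  refine ⟨C, hC, fun μ g => ?_⟩
  by_cases hex : ∃ Δ, T.IsSpherical ξ₀ μ Δ
  -- The constant is uniform over all highest weight data, so it does not matter which
  -- representation and vector were chosen.
  · have hs : T.IsSpherical ξ₀ μ (T.spherical ξ₀ μ) := by
      rw [MaximalTorus.spherical, dif_pos hex]
      exact hex.choose_spec
    obtain ⟨n, π, v, h1, h2, h3, h4, h5, h6, h7⟩ := hs
    have H : T.IsHighestWeight ξ₀ μ π v := ⟨h1, h2, h3, h4, h5, h6⟩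
    rw [show (T.spherical ξ₀ μ).1 = _ from funext h7, wordDeriv_matrixCoeff H.smooth]
    refine (norm_inner_le_norm _ _).trans ?_
    rw [h4, one_mul]
    refine le_trans (le_of_eq ?_) (h μ n π v H)
    rw [@norm_eq_sqrt_re_inner ℂ, h3, ← @norm_eq_sqrt_re_inner ℂ]
  -- Where there is no such representation, `spherical` takes the default value 0.
  · rw [MaximalTorus.spherical, dif_neg hex]
    rw [show ((0 : smoothFun E G) : G → ℂ) = 0 from rfl, wordDeriv_zero]
    simpa using mul_nonneg hC (by positivity)

/-- v is an eigenvector of T with a unimodular eigenvalue, so t on the left and t⁻¹ on the right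
contribute inverse factors. -/
theorem MaximalTorus.spherical_conj (x : Fin T.rank → ℝ) (g : G) :
    (T.spherical ξ₀ μ).1 (T.par x * g * (T.par x)⁻¹) = (T.spherical ξ₀ μ).1 g := by
  by_cases hex : ∃ Δ, T.IsSpherical ξ₀ μ Δ
  · have hs : T.IsSpherical ξ₀ μ (T.spherical ξ₀ μ) := by
      rw [MaximalTorus.spherical, dif_pos hex]
      exact hex.choose_spec
    obtain ⟨n, π, v, -, -, h3, -, -, h6, h7⟩ := hs
    have h8 : ∀ w, inner ℂ v (π (T.par x) w) = (character μ).1 x * inner ℂ v w := fun w => by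
      have h9 : v = (starRingEnd ℂ ((character μ).1 x)) • π (T.par x) v := by
        rw [h6, smul_smul, mul_comm, character_mul_conj, one_smul]
      conv_lhs => rw [h9, inner_smul_left, h3, Complex.conj_conj]
    have h10 : π (T.par x)⁻¹ v = (starRingEnd ℂ ((character μ).1 x)) • v := by
      have e : T.par (-x) = (T.par x)⁻¹ :=
        eq_inv_of_mul_eq_one_left (by rw [← T.map_add, neg_add_cancel, T.par_zero])
      rw [← e, h6, ← character_neg_eq_conj]
      congr 1
      change Complex.exp _ = Complex.exp _
      rw [toReal_neg, dot_neg_left]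
      simp [dot]
    rw [h7, h7, map_mul, map_mul, Module.End.mul_apply, Module.End.mul_apply, h8, h10,
      map_smul, inner_smul_right, ← mul_assoc, character_mul_conj, one_mul]
  · rw [MaximalTorus.spherical, dif_neg hex]
    rfl

end HighestWeight

/-! ### Construction of the transpose of r_G^T -/

section TestMap

variable {E G : Type*} [NormedAddCommGroup E] [NormedSpace ℝ E] [FiniteDimensional ℝ E]
  [TopologicalSpace G] [ChartedSpace E G] [Group G] [LieGroup 𝓘(ℝ, E) ∞ G] [T2Space G]

open Classical in
/-- The function `Δ_(ν - ρ)` if `ν ∈ ρ + Λ^*_+`, and zero otherwise. -/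
def MaximalTorus.shiftedSpherical (T : MaximalTorus E G) (B : InvariantInnerProduct E G)
    (ξ₀ : Fin T.rank → ℝ) (ν : Fin T.rank → ℤ) : smoothFun E G :=
  if h : ν ∈ T.hardySpectrum B ξ₀ then T.spherical ξ₀ h.choose else 0

variable (B : InvariantInnerProduct E G) (T : MaximalTorus E G) {ξ₀ : Fin T.rank → ℝ}

theorem MaximalTorus.shiftedSpherical_of_notMem {ν : Fin T.rank → ℤ}
    (h : ν ∉ T.hardySpectrum B ξ₀) : T.shiftedSpherical B ξ₀ ν = 0 := dif_neg h

theorem MaximalTorus.shiftedSpherical_eq {μ ν : Fin T.rank → ℤ} (hμ : T.IsDominant B ξ₀ μ)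
    (hν : toReal ν = toReal μ + T.rho ξ₀) : T.shiftedSpherical B ξ₀ ν = T.spherical ξ₀ μ := by
  have h : ν ∈ T.hardySpectrum B ξ₀ := ⟨μ, hμ, by rw [hν, add_comm]⟩
  rw [MaximalTorus.shiftedSpherical, dif_pos h]
  congr 1
  refine toReal_injective ?_
  have h1 := h.choose_spec.2
  exact add_left_cancel (h1.symm.trans (hν.trans (add_comm _ _)))

theorem leftDeriv_const_mul (c : ℂ) (ξ : Lie E G) {f : G → ℂ}
    (hf : ContMDiff 𝓘(ℝ, E) 𝓘(ℝ, ℂ) ∞ f) (g : G) :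
    leftDeriv E ξ (fun g => c * f g) g = c * leftDeriv E ξ f g := by
  obtain ⟨γ, hγ⟩ := exists_isOneParameter ξ
  have hc : ContDiff ℝ ∞ fun z : ℂ => c * z := contDiff_const.mul contDiff_id
  exact (hγ.hasDerivAt_leftDeriv (hc.contMDiff.comp hf) g).unique
    ((hγ.hasDerivAt_leftDeriv hf g).const_mul c)

theorem wordDeriv_const_mul (c : ℂ) (w : List (Lie E G)) {f : G → ℂ}
    (hf : ContMDiff 𝓘(ℝ, E) 𝓘(ℝ, ℂ) ∞ f) :
    ContMDiff 𝓘(ℝ, E) 𝓘(ℝ, ℂ) ∞ (wordDeriv E w f) ∧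
      wordDeriv E w (fun g => c * f g) = fun g => c * wordDeriv E w f g := by
  induction w with
  | nil => exact ⟨hf, rfl⟩
  | cons ξ w ih =>
    refine ⟨leftDeriv_smooth E ξ ih.1, ?_⟩
    change leftDeriv E ξ (wordDeriv E w _) = _
    rw [ih.2]
    exact funext fun g => leftDeriv_const_mul c ξ ih.1 g

theorem MaximalTorus.IsRegular.exists_norm_wordDeriv_le (hξ₀ : T.IsRegular ξ₀)
    (w : List (Lie E G)) :
    ∃ C : ℝ, 0 ≤ C ∧ ∀ (ν : Fin T.rank → ℤ) (g : G),
      ‖wordDeriv E w (T.shiftedSpherical B ξ₀ ν).1 g‖ ≤ C * (1 + ‖toReal ν‖) ^ w.length := by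
  obtain ⟨C, hC, h⟩ := hξ₀.exists_norm_wordDeriv_spherical_le B w
  -- The factor accounts for the shift by ρ: 1 + ‖μ‖ ≤ (1 + ‖ρ‖)(1 + ‖ν‖) when ν = ρ + μ.
  refine ⟨C * (1 + ‖T.rho ξ₀‖) ^ w.length, by positivity, fun ν g => ?_⟩
  by_cases hν : ν ∈ T.hardySpectrum B ξ₀
  · obtain ⟨μ, hμ, hμν⟩ := hν
    rw [T.shiftedSpherical_eq B hμ (by rw [hμν, add_comm])]
    refine (h μ g).trans ?_
    rw [mul_assoc, ← mul_pow]
    refine mul_le_mul_of_nonneg_left (pow_le_pow_left₀ (by positivity) ?_ _) hC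
    have h1 : ‖toReal μ‖ ≤ ‖toReal ν‖ + ‖T.rho ξ₀‖ := by
      rw [show toReal μ = toReal ν - T.rho ξ₀ by rw [hμν, add_sub_cancel_left]]
      exact norm_sub_le _ _
    nlinarith [norm_nonneg (toReal ν), norm_nonneg (T.rho ξ₀)]
  · rw [T.shiftedSpherical_of_notMem B hν]
    rw [show ((0 : smoothFun E G) : G → ℂ) = 0 from rfl, wordDeriv_zero]
    simpa using by positivity

variable (ξ₀) in
/-- The terms of the series `∑ φ̂(ν) Δ_(ν - ρ)`. -/
def MaximalTorus.testTerm (φ : periodicFun T.rank) (ν : Fin T.rank → ℤ) (g : G) : ℂ :=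
  fourierCoeffT ν φ * (T.shiftedSpherical B ξ₀ ν).1 g

/-- Rapid decay of the Fourier coefficients beats polynomial growth. Since the bound is linear in A,
with k and b independent of φ, it yields both convergence of the series and continuity of `testMap`.
-/
theorem MaximalTorus.IsRegular.exists_norm_wordDeriv_testTerm_le (hξ₀ : T.IsRegular ξ₀)
    (w : List (Lie E G)) : ∃ (k : ℕ) (b : (Fin T.rank → ℤ) → ℝ), Summable b ∧
      ∀ (φ : periodicFun T.rank) (A : ℝ), (∀ j ≤ k, ∀ x, ‖iteratedFDeriv ℝ j φ.1 x‖ ≤ A) →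
        ∀ ν (g : G), ‖wordDeriv E w (T.testTerm B ξ₀ φ ν) g‖ ≤ A * b ν := by
  obtain ⟨C, hC, h⟩ := hξ₀.exists_norm_wordDeriv_le B T w
  obtain ⟨k, b, hb, hbound⟩ := exists_fourierCoeffT_bound T.rank w.length
  refine ⟨k, fun ν => C * b ν, hb.mul_left C, fun φ A hA ν g => ?_⟩
  have h1 : wordDeriv E w (T.testTerm B ξ₀ φ ν) g =
      fourierCoeffT ν φ * wordDeriv E w (T.shiftedSpherical B ξ₀ ν).1 g :=
    congrFun (wordDeriv_const_mul _ w (T.shiftedSpherical B ξ₀ ν).2).2 g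
  rw [h1, norm_mul]
  calc _ ≤ ‖fourierCoeffT ν φ‖ * (C * (1 + ‖toReal ν‖) ^ w.length) :=
        mul_le_mul_of_nonneg_left (h ν g) (norm_nonneg _)
    _ = C * (‖fourierCoeffT ν φ‖ * (1 + ‖toReal ν‖) ^ w.length) := by ring
    _ ≤ C * (A * b ν) := mul_le_mul_of_nonneg_left (hbound φ A hA ν) hC
    _ = A * (C * b ν) := by ring

theorem MaximalTorus.IsRegular.summableSmooth_testTerm (hξ₀ : T.IsRegular ξ₀)
    (φ : periodicFun T.rank) : SummableSmooth E (T.testTerm B ξ₀ φ) := by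
  refine ⟨fun ν => ?_, fun w => ?_⟩
  · exact (wordDeriv_const_mul 1 [] (fourierCoeffT ν φ • T.shiftedSpherical B ξ₀ ν).2).1
  · obtain ⟨k, b, hb, h⟩ := hξ₀.exists_norm_wordDeriv_testTerm_le B T w
    obtain ⟨A, hA⟩ := exists_iteratedFDeriv_bound φ k
    exact ⟨fun ν => A * b ν, hb.mul_left A, h φ A hA⟩

theorem SummableSmooth.summable {ι : Type*} {f : ι → G → ℂ} (hf : SummableSmooth E f) (g : G) :
    Summable fun i => f i g := by
  obtain ⟨b, hb, h⟩ := hf.2 []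
  exact hb.of_norm_bounded fun i => h i g

/-- The transpose `φ ↦ ∑ φ̂(ν) Δ_(ν - ρ)` of the restriction map. -/
def MaximalTorus.IsRegular.testMap (hξ₀ : T.IsRegular ξ₀) :
    periodicFun T.rank →ₗ[ℂ] smoothFun E G where
  toFun φ := ⟨fun g => ∑' ν, T.testTerm B ξ₀ φ ν g, (hξ₀.summableSmooth_testTerm B T φ).contMDiff⟩
  map_add' φ ψ := by
    refine Subtype.ext (funext fun g => ?_)
    change ∑' ν, T.testTerm B ξ₀ (φ + ψ) ν g =
      ∑' ν, T.testTerm B ξ₀ φ ν g + ∑' ν, T.testTerm B ξ₀ ψ ν g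
    rw [← ((hξ₀.summableSmooth_testTerm B T φ).summable g).tsum_add
      ((hξ₀.summableSmooth_testTerm B T ψ).summable g)]
    exact tsum_congr fun ν => by simp only [MaximalTorus.testTerm, _root_.map_add, add_mul]
  map_smul' c φ := by
    refine Subtype.ext (funext fun g => ?_)
    change ∑' ν, T.testTerm B ξ₀ (c • φ) ν g = c * ∑' ν, T.testTerm B ξ₀ φ ν g
    rw [← tsum_mul_left]
    exact tsum_congr fun ν => by
      simp only [MaximalTorus.testTerm, map_smul, smul_eq_mul, mul_assoc]

theorem MaximalTorus.IsRegular.testMap_character (hξ₀ : T.IsRegular ξ₀) (ν : Fin T.rank → ℤ) :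
    hξ₀.testMap B T (character ν) = T.shiftedSpherical B ξ₀ ν := by
  refine Subtype.ext (funext fun g => ?_)
  change ∑' κ, T.testTerm B ξ₀ (character ν) κ g = _
  rw [tsum_eq_single ν fun κ hκ => by
    rw [MaximalTorus.testTerm, fourierCoeffT_character_of_ne hκ, zero_mul]]
  rw [MaximalTorus.testTerm, fourierCoeffT_character_self, one_mul]

theorem MaximalTorus.IsRegular.exists_norm_wordDeriv_testMap_le (hξ₀ : T.IsRegular ξ₀)
    (w : List (Lie E G)) : ∃ (k : ℕ) (C : ℝ), 0 ≤ C ∧ ∀ (φ : periodicFun T.rank),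
      (∀ j ≤ k, ∀ x, ‖iteratedFDeriv ℝ j φ.1 x‖ ≤ 1) →
        ∀ g : G, ‖wordDeriv E w (hξ₀.testMap B T φ).1 g‖ ≤ C := by
  obtain ⟨k, b, hb, h⟩ := hξ₀.exists_norm_wordDeriv_testTerm_le B T w
  -- The estimate for φ = 0 with A = 1 shows that the majorant is nonnegative.
  have hb0 : ∀ ν, 0 ≤ b ν := fun ν => by
    have h0 := h 0 1 (fun j _ x => by
      rw [show ((0 : periodicFun T.rank) : (Fin T.rank → ℝ) → ℂ) = 0 from rfl]
      simp) ν 1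
    rw [one_mul] at h0
    exact (norm_nonneg _).trans h0
  refine ⟨k, ∑' ν, b ν, tsum_nonneg hb0, fun φ hφ g => ?_⟩
  have h1 := ((hξ₀.summableSmooth_testTerm B T φ).wordDeriv w).2 g
  change ‖wordDeriv E w (fun g => ∑' ν, T.testTerm B ξ₀ φ ν g) g‖ ≤ _
  rw [h1]
  exact tsum_of_norm_bounded hb.hasSum fun ν => by simpa using h φ 1 hφ ν g

/-- Continuity of Ψ makes the composite a distribution, and Ψ sends characters outside ρ + Λ*_+ to
zero, so its spectrum is as required. -/
theorem MaximalTorus.IsRegular.comp_testMap_mem (hξ₀ : T.IsRegular ξ₀)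
    {u : smoothFun E G →ₗ[ℂ] ℂ} (hu : u ∈ distG E G) :
    u ∘ₗ hξ₀.testMap B T ∈ T.distMinus B ξ₀ := by
  obtain ⟨S, C, hS, h⟩ := hu
  refine ⟨?_, fun ν hν => ?_⟩
  · choose k D hD hbound using hξ₀.exists_norm_wordDeriv_testMap_le B T
    -- Dividing by K brings Ψ(φ) into the neighbourhood of zero on which u is bounded; the summand 1
    -- keeps K positive when there are no words.
    let K := 1 + ∑ w ∈ hS.toFinset, D w
    have hK : 0 < K := by
      have : 0 ≤ ∑ w ∈ hS.toFinset, D w := Finset.sum_nonneg fun w _ => hD w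
      positivity
    refine ⟨hS.toFinset.sup k, K * C, fun φ hφ => ?_⟩
    have h1 := h ((K⁻¹ : ℂ) • hξ₀.testMap B T φ) fun w hw g => by
      have hw' : w ∈ hS.toFinset := hS.mem_toFinset.2 hw
      have h2 := hbound w φ (fun j hj => hφ j (hj.trans (Finset.le_sup hw'))) g
      have h3 : wordDeriv E w ((K⁻¹ : ℂ) • hξ₀.testMap B T φ : smoothFun E G).1 g =
          (K⁻¹ : ℂ) * wordDeriv E w (hξ₀.testMap B T φ).1 g :=
        congrFun (wordDeriv_const_mul _ w (hξ₀.testMap B T φ).2).2 g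
      rw [h3, norm_mul, norm_inv, Complex.norm_real, Real.norm_of_nonneg hK.le,
        inv_mul_le_iff₀ hK, mul_one]
      refine h2.trans ?_
      have h4 := Finset.single_le_sum (fun w _ => hD w) hw'
      change D w ≤ 1 + _
      linarith
    rw [map_smul, norm_smul, norm_inv, Complex.norm_real, Real.norm_of_nonneg hK.le,
      inv_mul_le_iff₀ hK] at h1
    exact h1
  · rw [LinearMap.comp_apply, hξ₀.testMap_character, T.shiftedSpherical_of_notMem B hν, map_zero]

theorem exists_testMap (hξ₀ : T.IsRegular ξ₀) : ∃ Ψ : periodicFun T.rank →ₗ[ℂ] smoothFun E G,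
    (∀ v ∈ distG E G, v ∘ₗ Ψ ∈ T.distMinus B ξ₀) ∧
    (∀ μ ν : Fin T.rank → ℤ, T.IsDominant B ξ₀ μ → toReal ν = toReal μ + T.rho ξ₀ →
      Ψ (character ν) = T.spherical ξ₀ μ) ∧
    (∀ x φ, conjFun E (T.par x) (Ψ φ) = Ψ φ) := by
  refine ⟨hξ₀.testMap B T, fun v hv => hξ₀.comp_testMap_mem B T hv, fun μ ν hμ hν => ?_,
    fun x φ => Subtype.ext (funext fun g => tsum_congr fun ν => ?_)⟩
  · rw [hξ₀.testMap_character, T.shiftedSpherical_eq B hμ hν]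
  · change fourierCoeffT ν φ * _ = fourierCoeffT ν φ * _
    congr 1
    by_cases h : ν ∈ T.hardySpectrum B ξ₀
    · rw [MaximalTorus.shiftedSpherical, dif_pos h]
      exact T.spherical_conj x g
    · rw [T.shiftedSpherical_of_notMem B h]
      rfl

end TestMap

end

end WeilCartan

/-! ### The Cartan model of the restriction map -/

theorem mainTheorem11
    {E G F M : Type*}
    [NormedAddCommGroup E] [NormedSpace ℝ E] [FiniteDimensional ℝ E]
    [NormedAddCommGroup F] [NormedSpace ℝ F] [FiniteDimensional ℝ F]
    -- a compact connected Lie group `G`, which is a product of a simply connected group and a torus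
    [TopologicalSpace G] [ChartedSpace E G] [Group G] [LieGroup 𝓘(ℝ, E) ∞ G]
    [T2Space G] [CompactSpace G] [ConnectedSpace G] (hG : IsSimplyConnectedTimesTorus G)
    -- a `G`-manifold `M`
    [TopologicalSpace M] [ChartedSpace F M] [IsManifold 𝓘(ℝ, F) ∞ M]
    [T2Space M] [SecondCountableTopology M]
    [MulAction G M] [ContMDiffSMul 𝓘(ℝ, E) 𝓘(ℝ, F) ∞ G M]
    -- an invariant inner product, a maximal torus, a Weyl chamber and normalized root vectors
    (B : InvariantInnerProduct E G) (T : MaximalTorus E G)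
    (ξ₀ : Fin T.rank → ℝ) (hξ₀ : T.IsRegular ξ₀)
    (e : (Fin T.rank → ℤ) → ℂ ⊗[ℝ] Lie E G) (he : T.IsRootBasis B ξ₀ e) :
    -- there are: the map `r_G^T`,
    ∃ (rGT : distG E G →ₗ[ℂ] T.distMinus B ξ₀)
      -- the map `r_G^T ⊗ 1 : 𝓔'(G) ⊗ Ω(M) → 𝓔'(T)^- ⊗ Ω(M)`,
      (rGTΩ : distForms F M (distG E G) →ₗ[ℂ] distForms F M (T.distMinus B ξ₀))
      -- the identifications of the Weil and Cartan models, for `G` and `T`,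
      (PG : weilBasicG F M B ≃ₗ[ℂ] cartanG F M E G)
      (PT : weilBasicT F M T B ξ₀ ≃ₗ[ℂ] cartanT F M T B ξ₀)
      -- and the restriction map `R_G^T ⊗ 1` between the basic subspaces, such that
      (R : weilBasicG F M B →ₗ[ℂ] weilBasicT F M T B ξ₀),
      T.IsRestrictionMap B ξ₀ rGT ∧
      IsTensorId rGT rGTΩ ∧
      (∀ w : weilBasicG F M B,
        (PG w : distForms F M (distG E G)) = pHor F M B.form (distG E G) w) ∧
      (∀ w : weilBasicT F M T B ξ₀,
        (PT w : distForms F M (T.distMinus B ξ₀)) =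
          pHor F M (B.form.restrict T.lie) (T.distMinus B ξ₀) w) ∧
      (∀ w : weilBasicG F M B,
        (R w : WeilForms F M (B.form.restrict T.lie) (T.distMinus B ξ₀)) =
          TensorProduct.map (clProj B T ∘ₗ clTwist B (T.rMatrix ξ₀ e)) rGTΩ
            (w : WeilForms F M B.form (distG E G))) ∧
      -- the induced map of Cartan models is `r_G^T ⊗ exp (½ ι(r_M))`
      ∀ c : cartanG F M E G,
        (PT (R (PG.symm c)) : distForms F M (T.distMinus B ξ₀)) =
          postComp (T.distMinus B ξ₀) (expBivector E G F M (T.rMatrix ξ₀ e))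
            (fibrewise_expBivector E G F M (T.rMatrix ξ₀ e))
            (rGTΩ (c : distForms F M (distG E G))) := by
  exact exists_restriction_of_testMap B T ξ₀ e he (exists_testMap B T hξ₀).choose
    (exists_testMap B T hξ₀).choose_spec.1 (exists_testMap B T hξ₀).choose_spec.2.1
    (exists_testMap B T hξ₀).choose_spec.2.2
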